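/- **Notation.** $\mathbb N=\{0,1,2,\dots\}$, $\mathbb N^*=\{1,2,\dots\}$. Let $m\in\mathbb N^*$ and $I_m=\{(j,\alpha)\in\mathbb N\times\mathbb N: j+\alpha\le m,\ j<m\}$. Let $c_{j,\alpha}(x)$ ($(j,\alpha)\in I_m$) and $a(x)$ be holomorphic near $x=0\in\mathbb C$ and put $$C(x;\lambda,\rho)=\lambda^m-\sum_{(j,\alpha)\in I_m}c_{j,\alpha}(x)\,\lambda^j\rho(\rho-1)\cdots(\rho-\alpha+1),\qquad L(\lambda,\rho)=C(0;\lambda,\rho).$$ Let $\mathcal M$ be a finite subset of $\mathbb N\times\mathbb N$, $N=\#\mathcal M$, and let $G_2(t,x,\boldsymbol z)$, $\boldsymbol z=\{z_{j,\alpha}\}_{(j,\alpha)\in\mathcal M}$, be holomorphic near the origin of $\mathbb C_t\times\mathbb C_x\times\mathbb C^N_{\boldsymbol z}$ with a Taylor expansion in $(t,\boldsymbol z)$ of the form $$G_2(t,x,\boldsymbol z)=\sum_{i+|\boldsymbol\nu|\ge2}g_{i,\boldsymbol\nu}(x)\,t^i\boldsymbol z^{\boldsymbol\nu}.$$ Consider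 the equation $$C(x;t\partial_t,x\partial_x)u=a(x)t+G_2\bigl(t,x,\{(t\partial_t)^j\partial_x^\alpha u\}_{(j,\alpha)\in\mathcal M}\bigr),\tag{E}$$ where in $C(x;t\partial_t,x\partial_x)$ the coefficients $c_{j,\alpha}(x)$ act from the left. **Newton polygon.** Put $c_{m,0}(x)=-1$, $\Lambda_0=\{(m,0)\}\cup\{(j,\alpha)\in I_m: c_{j,\alpha}(0)\ne0\}$, and let $\mathcal N_0\subset\mathbb R^2$ be the convex hull of $\bigcup_{(j,\alpha)\in\Lambda_0}\{(x,y):x\le j,\ y\le\alpha\}$. Its vertices are $(m_1,n_1)=(m,0),(m_2,n_2),\dots,(m_p,n_p)$ with $m_1>m_2>\cdots>m_p$; its boundary consists of a vertical half line, the segments $\Gamma_i$ joining $(m_i,n_i)$ to $(m_{i+1},n_{i+1})$ ($1\le i\le p-1$), and a horizontal half line $\Gamma_p$ ending at $(m_p,n_p)$. Put $P_i(X)=\sum_{(j,\alpha)\in\Lambda_0\cap\Gamma_i}c_{j,\alpha}(0)X^{j-m_{i+1}}$ for $1\le i\le p-1$ and $P_p(X)=\sum_{(j,\alpha)\in\Lambda_0\cap\Gamma_p}c_{j,\alpha}(0)X^{j}$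 (a nonzero constant if $m_p=0$). **Conditions.** (N) $L(k,l)\ne0$ for all $(k,l)\in\mathbb N^*\times\mathbb N$. (GP) For $1\le i\le p-1$ all roots of $P_i$ lie in $\mathbb C\setminus[0,\infty)$, and all roots of $P_p$ lie in $\mathbb C\setminus\mathbb N^*$. **Indices.** Let $\Lambda_1=\{(j,\alpha)\in I_m: c_{j,\alpha}(0)=0,\ c_{j,\alpha}\not\equiv0\}$; for $(j,\alpha)\in\Lambda_1$ let $p_{j,\alpha}$ be the order of the zero of $c_{j,\alpha}$ at $0$ and $d_{j,\alpha}=\min\{y\in\mathbb R:(j,\alpha-y)\in\mathcal N_0\}$, and set $$\sigma_0=\max\Bigl[1,\ \max_{(j,\alpha)\in\Lambda_1}\frac{p_{j,\alpha}+d_{j,\alpha}}{p_{j,\alpha}}\Bigr].$$ For $\mu\in\mathbb N$ let $J_\mu=\{(i,\boldsymbol\nu)\in\mathbb N\times\mathbb N^N: i+|\boldsymbol\nu|\ge2,\ |\boldsymbol\nu|\ge1,\ (\partial_x^\mu g_{i,\boldsymbol\nu})(0)\ne0\}$; for $|\boldsymbol\nu|\ge1$ let $m_{\boldsymbol\nu,\mu}=\max\{\,j+\max\{\alpha,\mu+\sigma_0(\alpha-\mu)\}:(j,\alpha)\in\mathcal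 M,\ \nu_{j,\alpha}>0\}$, and set $$s_0=1+\max\Bigl[0,\ \sup_{\mu\ge0}\ \sup_{(i,\boldsymbol\nu)\in J_\mu}\frac{m_{\boldsymbol\nu,\mu}-m}{i+|\boldsymbol\nu|-1}\Bigr]$$ (maxima and suprema over empty sets are omitted). For $s,\sigma\ge1$, $G\{t,x\}_{(s,\sigma)}$ is the set of all $\sum_{k,l\ge0}a_{k,l}t^kx^l\in\mathbb C[[t,x]]$ such that $\sum_{k,l\ge0}\frac{a_{k,l}}{k!^{s-1}l!^{\sigma-1}}t^kx^l$ converges in a neighbourhood of $(0,0)$. **Theorem.** Suppose that (N) and (GP) hold. Then equation (E) has a unique formal solution $u(t,x)\in\mathbb C[[t,x]]$ satisfying $u(0,x)\equiv0$, and it belongs to $G\{t,x\}_{(s,\sigma)}$ for all $s\ge s_0$ and $\sigma\ge\sigma_0$. -/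

import Mathlib

open scoped Nat Topology

noncomputable section

namespace TotChar

/-! ### Power series, Taylor series, Gevrey classes -/

/-- The ring `ℂ[[t, x]]`; variable `0` is `t`, variable `1` is `x`. -/
abbrev FormalTX : Type := MvPowerSeries (Fin 2) ℂ

/-- A formal power series converges in a neighbourhood of the origin. -/
def ConvergesNearZero {ι : Type} [Fintype ι] (f : MvPowerSeries ι ℂ) : Prop :=
  ∀ᶠ z in 𝓝 (0 : ι → ℂ), Summable fun e : ι →₀ ℕ => MvPowerSeries.coeff e f * ∏ i, z i ^ e i

/-- The series `∑ a_{k,l} / (k!^(s-1) l!^(σ-1)) t^k x^l` attached to `∑ a_{k,l} t^k x^l`. -/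
def borel (s σ : ℝ) (f : FormalTX) : FormalTX := fun e =>
  MvPowerSeries.coeff e f /
    ((((e 0)! : ℝ) ^ (s - 1) * ((e 1)! : ℝ) ^ (σ - 1) : ℝ) : ℂ)

/-- The formal Gevrey class `G{t,x}_{(s,σ)}`, for `s ≥ 1`, `σ ≥ 1`. -/
def Gevrey (s σ : ℝ) : Set FormalTX :=
  {f | 1 ≤ s ∧ 1 ≤ σ ∧ ConvergesNearZero (borel s σ f)}

/-- The Taylor series at the origin of a function of finitely many complex variables. The
coefficient at the multi-index `e` is `(∂^e f)(0) / e!`, the mixed partial derivative `∂^e` being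
the iterated derivative in the coordinate directions, direction `i` occurring `e i` times. -/
def taylorSeries {ι : Type} [Fintype ι] [DecidableEq ι] (f : (ι → ℂ) → ℂ) : MvPowerSeries ι ℂ :=
  fun e =>
    let dirs : List ι := (Finsupp.toMultiset e).toList
    iteratedFDeriv ℂ dirs.length f 0 (fun k => Pi.single (dirs.get k) (1 : ℂ)) /
      ((∏ i, (e i)! : ℕ) : ℂ)

/-- The Taylor series at `x = 0` of a function `f(x)`, as an element of `ℂ[[t, x]]`. -/
def taylorX (f : ℂ → ℂ) : FormalTX := fun e =>
  if e 0 = 0 then iteratedDeriv (e 1) f 0 / ((e 1)! : ℂ) else 0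

/-! ### Differential operators on `ℂ[[t, x]]` -/

/-- `∂_x`. -/
def dX : Module.End ℂ FormalTX := (MvPowerSeries.pderiv ℂ (1 : Fin 2)).toLinearMap

/-- `t ∂_t`. -/
def eulerT : Module.End ℂ FormalTX :=
  LinearMap.mulLeft ℂ (MvPowerSeries.X 0) ∘ₗ (MvPowerSeries.pderiv ℂ (0 : Fin 2)).toLinearMap

/-- `x ∂_x`. -/
def eulerX : Module.End ℂ FormalTX := LinearMap.mulLeft ℂ (MvPowerSeries.X 1) ∘ₗ dX

/-! ### The linear part

The data are an integer `m ≥ 1` and functions `c (j, α)`, `(j, α) ∈ I m`, holomorphic near `0`. -/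

/-- `I_m = {(j, α) : j + α ≤ m, j < m}`. -/
def I (m : ℕ) : Finset (ℕ × ℕ) :=
  (Finset.range (m + 1) ×ˢ Finset.range (m + 1)).filter fun p => p.1 + p.2 ≤ m ∧ p.1 < m

/-- `C(x; λ, ρ) = λ^m - ∑ c_{j,α}(x) λ^j ρ(ρ-1)⋯(ρ-α+1)`. -/
def C (m : ℕ) (c : ℕ × ℕ → ℂ → ℂ) (x lam rho : ℂ) : ℂ :=
  lam ^ m - ∑ p ∈ I m, c p x * lam ^ p.1 * (descPochhammer ℂ p.2).eval rho

/-- `L(λ, ρ) = C(0; λ, ρ)`. -/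
def L (m : ℕ) (c : ℕ × ℕ → ℂ → ℂ) (lam rho : ℂ) : ℂ := C m c 0 lam rho

/-- The operator `C(x; t∂_t, x∂_x)`, with the coefficients acting from the left. -/
def opC (m : ℕ) (c : ℕ × ℕ → ℂ → ℂ) (u : FormalTX) : FormalTX :=
  (eulerT ^ m) u -
    ∑ p ∈ I m, taylorX (c p) *
      (eulerT ^ p.1) ((Polynomial.aeval eulerX (descPochhammer ℂ p.2)) u)

/-- The non-resonance condition (N). -/
def NonResonant (m : ℕ) (c : ℕ × ℕ → ℂ → ℂ) : Prop :=
  ∀ k l : ℕ, 1 ≤ k → L m c k l ≠ 0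

/-! ### Newton polygon and generalized Poincaré condition -/

/-- The numbers `c_{j,α}(0)`, with the convention `c_{m,0} = -1`. -/
def c0 (m : ℕ) (c : ℕ × ℕ → ℂ → ℂ) (p : ℕ × ℕ) : ℂ := if p = (m, 0) then -1 else c p 0

open Classical in
/-- `Λ_0 = {(m, 0)} ∪ {(j, α) ∈ I_m : c_{j,α}(0) ≠ 0}`. -/
def Lam0 (m : ℕ) (c : ℕ × ℕ → ℂ → ℂ) : Finset (ℕ × ℕ) :=
  insert (m, 0) ((I m).filter fun p => c p 0 ≠ 0)

/-- A lattice point seen in the plane. -/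
def pt (p : ℕ × ℕ) : ℝ × ℝ := ((p.1 : ℝ), (p.2 : ℝ))

/-- The Newton polygon `N_0` at `x = 0`: the convex hull of the union of the quadrants
`{(x, y) : x ≤ j, y ≤ α}`, `(j, α) ∈ Λ_0`. -/
def newton (m : ℕ) (c : ℕ × ℕ → ℂ → ℂ) : Set (ℝ × ℝ) :=
  convexHull ℝ (⋃ p ∈ Lam0 m c, {q : ℝ × ℝ | q.1 ≤ (p.1 : ℝ) ∧ q.2 ≤ (p.2 : ℝ)})

/-- The part of the boundary of the Newton polygon lying on its supporting line of slope `-r`,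
`r ≥ 0`. For `r = 0` this is the horizontal half line `Γ_p`. For `r > 0` it is one of the segments
`Γ_1, …, Γ_{p-1}` if it has more than one point, and a vertex otherwise. -/
def side (m : ℕ) (c : ℕ × ℕ → ℂ → ℂ) (r : ℝ) : Set (ℝ × ℝ) :=
  {q | q ∈ newton m c ∧ ∀ q' ∈ newton m c, r * q'.1 + q'.2 ≤ r * q.1 + q.2}

open Classical in
/-- `Λ_0 ∩ Γ`, for the side `Γ` of slope `-r`. -/
def sidePts (m : ℕ) (c : ℕ × ℕ → ℂ → ℂ) (r : ℝ) : Finset (ℕ × ℕ) :=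
  (Lam0 m c).filter fun p => pt p ∈ side m c r

/-- The abscissa of the left end point of a side of slope `-r`, `r > 0` (this end point is a
vertex of the Newton polygon, hence in `Λ_0`). -/
def leftEnd (m : ℕ) (c : ℕ × ℕ → ℂ → ℂ) (r : ℝ) : ℕ :=
  sInf {j : ℕ | ∃ p ∈ sidePts m c r, p.1 = j}

/-- The characteristic polynomial on the side of slope `-r`, `r > 0`: the sum of
`c_{j,α}(0) X^(j - m')` over `Λ_0 ∩ Γ`, where `m'` is the abscissa of the left end point. -/
def charPoly (m : ℕ) (c : ℕ × ℕ → ℂ → ℂ) (r : ℝ) : Polynomial ℂ :=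
  ∑ p ∈ sidePts m c r, Polynomial.C (c0 m c p) * Polynomial.X ^ (p.1 - leftEnd m c r)

/-- The characteristic polynomial on the horizontal half line: the sum of `c_{j,α}(0) X^j` over
`Λ_0 ∩ Γ_p`. (If the abscissa `m_p` of the end point is `0`, this is a nonzero constant, so that
there are no characteristic roots.) -/
def charPolyLast (m : ℕ) (c : ℕ × ℕ → ℂ → ℂ) : Polynomial ℂ :=
  ∑ p ∈ sidePts m c 0, Polynomial.C (c0 m c p) * Polynomial.X ^ p.1

/-- The generalized Poincaré condition (GP): the characteristic roots on the segments of the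
boundary of the Newton polygon are not in `[0, ∞)`, and those on the horizontal half line are
not positive integers. -/
def GenPoincare (m : ℕ) (c : ℕ × ℕ → ℂ → ℂ) : Prop :=
  (∀ r : ℝ, 0 < r → (side m c r).Nontrivial →
    ∀ lam : ℂ, (charPoly m c r).IsRoot lam → ∀ y : ℝ, 0 ≤ y → lam ≠ (y : ℂ)) ∧
  (∀ lam : ℂ, (charPolyLast m c).IsRoot lam → ∀ k : ℕ, 1 ≤ k → lam ≠ (k : ℂ))

/-! ### The irregularity at `x = 0` -/

/-- `Λ_1 = {(j, α) ∈ I_m : c_{j,α}(0) = 0, c_{j,α} ≢ 0}`. -/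
def Lam1 (m : ℕ) (c : ℕ × ℕ → ℂ → ℂ) : Set (ℕ × ℕ) :=
  {p | p ∈ I m ∧ c p 0 = 0 ∧ analyticOrderAt (c p) 0 ≠ ⊤}

/-- `d_{j,α} = min {y : (j, α - y) ∈ N_0}`. -/
def dist (m : ℕ) (c : ℕ × ℕ → ℂ → ℂ) (p : ℕ × ℕ) : ℝ :=
  sInf {y : ℝ | ((p.1 : ℝ), (p.2 : ℝ) - y) ∈ newton m c}

/-- The irregularity `σ_0 = max [1, max_{Λ_1} (p_{j,α} + d_{j,α}) / p_{j,α}]`, where `p_{j,α}` is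
the order of the zero of `c_{j,α}` at `0`. (The supremum is over a finite nonempty set.) -/
def sigma0 (m : ℕ) (c : ℕ × ℕ → ℂ → ℂ) : ℝ :=
  sSup (insert 1 ((fun p => ((analyticOrderNatAt (c p) 0 : ℝ) + dist m c p) /
    (analyticOrderNatAt (c p) 0 : ℝ)) '' Lam1 m c))

/-! ### The nonlinear part

`M` is a finite subset of `ℕ × ℕ` and `G` a function of `t`, `x` and `z = (z_{j,α})_{(j,α) ∈ M}`. -/

/-- The variables: `Sum.inl 0` is `t`, `Sum.inl 1` is `x`, `Sum.inr (j, α)` is `z_{j,α}`. -/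
abbrev Vars (M : Finset (ℕ × ℕ)) : Type := Fin 2 ⊕ M

/-- The exponent of the monomial `t^i x^μ z^ν`. -/
def expo {M : Finset (ℕ × ℕ)} (i μ : ℕ) (ν : M →₀ ℕ) : Vars M →₀ ℕ :=
  Finsupp.single (Sum.inl 0) i + Finsupp.single (Sum.inl 1) μ + Finsupp.mapDomain Sum.inr ν

/-- The coefficient of `t^i x^μ z^ν` in the Taylor series of `G`, that is, the coefficient
`(∂_x^μ g_{i,ν})(0) / μ!` of `x^μ` in `g_{i,ν}(x)`. -/
def gCoeff {M : Finset (ℕ × ℕ)} (G : (Vars M → ℂ) → ℂ) (i : ℕ) (ν : M →₀ ℕ) (μ : ℕ) : ℂ :=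
  MvPowerSeries.coeff (expo i μ ν) (taylorSeries G)

/-- The Taylor expansion of `G` in `(t, z)` has only terms `g_{i,ν}(x) t^i z^ν` with
`i + |ν| ≥ 2`. -/
def OrderAtLeastTwo {M : Finset (ℕ × ℕ)} (G : (Vars M → ℂ) → ℂ) : Prop :=
  ∀ (i : ℕ) (ν : M →₀ ℕ), i + ν.degree < 2 → ∀ μ : ℕ, gCoeff G i ν μ = 0

/-- The formal series `G(t, x, {(t∂_t)^j ∂_x^α u}_{(j,α) ∈ M})`, for `u` with `u(0, x) = 0`: the
substitution into the Taylor series of `G`. -/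
def compose {M : Finset (ℕ × ℕ)} (G : (Vars M → ℂ) → ℂ) (u : FormalTX) : FormalTX :=
  MvPowerSeries.subst
    (Sum.elim (fun k : Fin 2 => (MvPowerSeries.X k : FormalTX))
      (fun p : M => (eulerT ^ p.1.1) ((dX ^ p.1.2) u)))
    (taylorSeries G)

/-- `u ∈ ℂ[[t, x]]` satisfies `u(0, x) ≡ 0`. -/
def VanishesAtTZero (u : FormalTX) : Prop :=
  ∀ l : ℕ, MvPowerSeries.coeff (Finsupp.single 1 l) u = 0

/-- `u` is a formal solution, with `u(0, x) ≡ 0`, of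
`C(x; t∂_t, x∂_x) u = a(x) t + G(t, x, {(t∂_t)^j ∂_x^α u}_{(j,α) ∈ M})`. -/
def IsFormalSolution (m : ℕ) (c : ℕ × ℕ → ℂ → ℂ) (a : ℂ → ℂ) {M : Finset (ℕ × ℕ)}
    (G : (Vars M → ℂ) → ℂ) (u : FormalTX) : Prop :=
  VanishesAtTZero u ∧ opC m c u = taylorX a * MvPowerSeries.X 0 + compose G u

/-- `J_μ = {(i, ν) : i + |ν| ≥ 2, |ν| ≥ 1, (∂_x^μ g_{i,ν})(0) ≠ 0}`. -/
def J {M : Finset (ℕ × ℕ)} (G : (Vars M → ℂ) → ℂ) (μ : ℕ) : Set (ℕ × (M →₀ ℕ)) :=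
  {q | 2 ≤ q.1 + q.2.degree ∧ 1 ≤ q.2.degree ∧ gCoeff G q.1 q.2 μ ≠ 0}

/-- `m_{ν,μ}`, the maximum over the `(j, α)` with `ν_{j,α} > 0` of
`j + max {α, μ + σ_0 (α - μ)}`. (A supremum over a finite set, nonempty if `|ν| ≥ 1`.) -/
def mNu (σ₀ : ℝ) {M : Finset (ℕ × ℕ)} (ν : M →₀ ℕ) (μ : ℕ) : ℝ :=
  sSup ((fun p : M => (p.1.1 : ℝ) + max (p.1.2 : ℝ) (μ + σ₀ * ((p.1.2 : ℝ) - μ))) ''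
    {p : M | 0 < ν p})

/-- The numbers `(m_{ν,μ} - m) / (i + |ν| - 1)`, for `μ ≥ 0` and `(i, ν) ∈ J_μ`. -/
def slopes (m : ℕ) (σ₀ : ℝ) {M : Finset (ℕ × ℕ)} (G : (Vars M → ℂ) → ℂ) : Set ℝ :=
  {y | ∃ μ : ℕ, ∃ q ∈ J G μ, y = (mNu σ₀ q.2 μ - m) / ((q.1 : ℝ) + (q.2.degree : ℝ) - 1)}

/-- `s_0 = 1 + max [0, sup_{μ ≥ 0} sup_{(i,ν) ∈ J_μ} (m_{ν,μ} - m) / (i + |ν| - 1)]`. (The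
supremum is over a nonempty set; it is bounded above since `σ_0 ≥ 1` and `M` is finite.) -/
def s0 (m : ℕ) (c : ℕ × ℕ → ℂ → ℂ) {M : Finset (ℕ × ℕ)} (G : (Vars M → ℂ) → ℂ) : ℝ :=
  1 + sSup (insert 0 (slopes m (sigma0 m c) G))

end TotChar

end

open scoped Nat Topology
open Finset.HasAntidiagonal (antidiagonal)

namespace TotChar

/-! ### Combinatorial weights -/

/-! At the coefficient of t^k x^l the equation reads: L(k,l) u_{k,l} = (terms in u_{k,n}, n < l) +
(the coefficient of a(x)t) + (a nonlinear term). The nonlinear term involves only u_{k',·} with k' <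
k, because G₂ has order at least two in (t, z) and u vanishes at t = 0. By (N) the system is
triangular for the lexicographic order of (k, l), which gives existence and uniqueness
(`existsUnique_of_triangular`).

The Gevrey estimate is an induction on (k, l) against `major`, and rests on three facts.

Lower bound (`exists_phi_le_norm_L`): |L(k,l)| ≥ δ φ(k,l), where φ is the sum of k^j (l+1)^α over
Λ_0. Otherwise L/φ tends to 0 along some ultrafilter. Bounded k and l contradict (N). If only l is
bounded, the term k^m dominates. If only k is bounded, its limit is a positive integer root of the
polynomial on Γ_p. If both are unbounded, either a single monomial dominates and cannot cancel, or k
~ y l^r with y > 0 a root on a side of slope -r; (GP) excludes both kinds of roots.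

Linear terms of positive order in x (`pow_mul_descFactorial_le_phi`, `norm_lowerPart_le`): a point
outside the polygon at vertical distance d loses (l+1)^d against φ. The definition of σ_0 says
exactly that the weight l!^(σ_0-1) regains this when the coefficient shifts l by its order of
vanishing. Shrinking the radius r in x makes these terms a small fraction of φ.

Nonlinear terms (`norm_cf_jetMonomial_le`): `Nat.multichoose E l` is the coefficient of x^l in
(1-x)^(-E), and E is taken proportional to k. An x-derivative then raises E by a bounded amount and
costs powers of k instead of powers of l. In a product only the factor of largest t-degree has to
pay, because k^(-N) makes the others summable; hence a monomial loses one power k^e with e =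
m_{ν,μ}. Since φ ≥ k^m, division by L recovers k^m. By the definition of s_0 the rest is at most
k^((s_0-1)(n-1)) with n = i + |ν|, which the drop of the factorial from k! to (k-(n-1))!
compensates. Finally, weighting t^k by ε^(2k) and u by ε makes terms of order n ≥ 2 of size ε^n, so
they are small against ε. -/

theorem succ_mul_multichoose_succ (E l : ℕ) :
    (l + 1) * Nat.multichoose E (l + 1) = E * Nat.multichoose (E + 1) l := by
  rw [Nat.multichoose_eq, Nat.multichoose_eq]
  rcases Nat.eq_zero_or_pos E with rfl | hE
  · simp
  have h1 : E + (l + 1) - 1 = E + l := by omega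
  have h2 : E + 1 + l - 1 = E + l := by omega
  rw [h1, h2, mul_comm, Nat.choose_succ_right_eq, mul_comm]
  congr 1
  omega

theorem add_mul_multichoose (E l : ℕ) :
    (E + l) * Nat.multichoose E l = E * Nat.multichoose (E + 1) l := by
  rcases l with _ | l
  · simp
  rw [Nat.multichoose_succ_succ, mul_add, ← succ_mul_multichoose_succ]
  ring

theorem multichoose_le_succ_left (E l : ℕ) :
    Nat.multichoose E l ≤ Nat.multichoose (E + 1) l := by
  rcases l with _ | l
  · simp
  rw [Nat.multichoose_succ_succ]
  omega

theorem multichoose_mono_left {E F : ℕ} (h : E ≤ F) (l : ℕ) :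
    Nat.multichoose E l ≤ Nat.multichoose F l :=
  monotone_nat_of_le_succ (fun E => multichoose_le_succ_left E l) h

theorem multichoose_mono_right {E : ℕ} (hE : 1 ≤ E) {l l' : ℕ} (h : l ≤ l') :
    Nat.multichoose E l ≤ Nat.multichoose E l' := by
  obtain ⟨E, rfl⟩ := Nat.exists_eq_add_of_le' hE
  refine monotone_nat_of_le_succ (fun l => ?_) h
  rw [Nat.multichoose_succ_succ]
  omega

theorem one_le_multichoose {E : ℕ} (hE : 1 ≤ E) (l : ℕ) : 1 ≤ Nat.multichoose E l := by
  simpa using multichoose_mono_right hE (Nat.zero_le l)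

theorem multichoose_le_two_pow (E l : ℕ) : Nat.multichoose E l ≤ 2 ^ (E + l) := by
  rw [Nat.multichoose_eq]
  exact (Nat.choose_le_two_pow _ _).trans (Nat.pow_le_pow_right (by norm_num) (by omega))

/-- This is the identity (1-x)^(-E) (1-x)^(-F) = (1-x)^(-(E+F)) on coefficients. -/
theorem sum_antidiagonal_multichoose (E F l : ℕ) :
    ∑ x ∈ antidiagonal l, Nat.multichoose E x.1 * Nat.multichoose F x.2 =
      Nat.multichoose (E + F) l := by
  induction F generalizing l with
  | zero =>
    rcases l with _ | l
    · simp
    rw [Finset.Nat.sum_antidiagonal_succ']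
    simp
  | succ F ih =>
    induction l with
    | zero => simp
    | succ l ihl =>
      rw [← add_assoc, Nat.multichoose_succ_succ, ← ih, add_assoc, ← ihl,
        Finset.Nat.sum_antidiagonal_succ', Finset.Nat.sum_antidiagonal_succ']
      simp only [Nat.multichoose_succ_succ, mul_add, Finset.sum_add_distrib,
        Nat.multichoose_zero_right]
      ring

/-- The shifted pairs form a part of the antidiagonal of l + μ, and the omitted terms are
nonnegative. -/
theorem sum_antidiagonal_multichoose_shift_le (E F l μ : ℕ) :
    ∑ x ∈ antidiagonal l, Nat.multichoose E (x.1 + μ) * Nat.multichoose F x.2 ≤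
      Nat.multichoose (E + F) (l + μ) := by
  rw [← sum_antidiagonal_multichoose]
  have hinj : Function.Injective (fun x : ℕ × ℕ => (x.1 + μ, x.2)) := by
    rintro ⟨a, b⟩ ⟨c, d⟩ h
    simpa using h
  refine (Finset.sum_map (antidiagonal l) ⟨_, hinj⟩
    (fun x => Nat.multichoose E x.1 * Nat.multichoose F x.2)).symm.trans_le ?_
  refine Finset.sum_le_sum_of_subset fun x hx => ?_
  obtain ⟨y, hy, rfl⟩ := Finset.mem_map.1 hx
  simp only [Finset.HasAntidiagonal.mem_antidiagonal, Function.Embedding.coeFn_mk] at hy ⊢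
  omega

/-! ### Factorials and sums of inverse squares. -/

/-- The gain of one unit over a! b! ≤ (a+b)! makes the weight (k+1-q)! multiplicative: (k₁+1-q₁) +
(k₂+1-q₂) - 1 = k+1-(q₁+q₂). -/
theorem factorial_mul_factorial_le {a b : ℕ} (ha : 1 ≤ a) (hb : 1 ≤ b) :
    a ! * b ! ≤ (a + b - 1)! := by
  obtain ⟨b, rfl⟩ := Nat.exists_eq_add_of_le' hb
  induction b with
  | zero => simp
  | succ b ih =>
    have := ih (by omega)
    have e : a + (b + 1 + 1) - 1 = (a + (b + 1) - 1) + 1 := by omega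
    rw [e, Nat.factorial_succ (b + 1), Nat.factorial_succ]
    calc a ! * ((b + 1 + 1) * (b + 1)!) = (b + 1 + 1) * (a ! * (b + 1)!) := by ring
      _ ≤ (a + (b + 1) - 1 + 1) * (a + (b + 1) - 1)! :=
        Nat.mul_le_mul (by omega) this

theorem factorial_mul_factorial_le_add (a b : ℕ) : a ! * b ! ≤ (a + b)! :=
  Nat.le_of_dvd (Nat.factorial_pos _) (Nat.factorial_mul_factorial_dvd_factorial_add a b)

/-- Lowering a factorial by q steps pays for k^q up to a geometric factor; each step costs at most a
factor e. -/
theorem pow_mul_factorial_sub_le {k q : ℕ} (h : q ≤ k) :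
    ((k : ℝ)) ^ q * ((k - q)! : ℝ) ≤ Real.exp 1 ^ q * (k ! : ℝ) := by
  induction q generalizing k with
  | zero => simp
  | succ q ih =>
    obtain ⟨k, rfl⟩ := Nat.exists_eq_add_of_le' (Nat.one_le_of_lt h)
    have hq : q ≤ k := by omega
    have e : k + 1 - (q + 1) = k - q := by omega
    -- (1 + 1/k)^q ≤ exp(q/k) ≤ e, because q ≤ k.
    have h1 : ((k + 1 : ℕ) : ℝ) ^ q ≤ Real.exp 1 * (k : ℝ) ^ q := by
      rcases Nat.eq_zero_or_pos k with rfl | hk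
      · have : q = 0 := by omega
        subst this
        simp
      have hk' : (0 : ℝ) < k := by exact_mod_cast hk
      have : ((k + 1 : ℕ) : ℝ) = (1 / (k : ℝ) + 1) * k := by
        push_cast; field_simp
        ring
      rw [this, mul_pow]
      refine mul_le_mul_of_nonneg_right ?_ (by positivity)
      calc (1 / (k : ℝ) + 1) ^ q ≤ (Real.exp (1 / k)) ^ q :=
            pow_le_pow_left₀ (by positivity) (Real.add_one_le_exp _) _
        _ = Real.exp (q * (1 / k)) := by rw [← Real.exp_nat_mul]
        _ ≤ Real.exp 1 := by
            apply Real.exp_le_exp.2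
            rw [mul_one_div, div_le_one hk']
            exact_mod_cast hq
    rw [e, pow_succ, Nat.factorial_succ, pow_succ]
    push_cast at h1 ⊢
    calc ((k : ℝ) + 1) ^ q * (k + 1) * ((k - q)! : ℝ)
        ≤ (Real.exp 1 * (k : ℝ) ^ q) * (k + 1) * ((k - q)! : ℝ) := by
          refine mul_le_mul_of_nonneg_right ?_ (by positivity)
          exact mul_le_mul_of_nonneg_right h1 (by positivity)
      _ = Real.exp 1 * (k + 1) * ((k : ℝ) ^ q * ((k - q)! : ℝ)) := by ring
      _ ≤ Real.exp 1 * (k + 1) * (Real.exp 1 ^ q * (k ! : ℝ)) :=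
          mul_le_mul_of_nonneg_left (ih hq) (by positivity)
      _ = _ := by ring

theorem sum_antidiagonal_inv_sq_le (k : ℕ) :
    ∑ x ∈ antidiagonal k, (((x.1 : ℝ) ^ 2)⁻¹ + ((x.2 : ℝ) ^ 2)⁻¹) ≤ 4 := by
  -- The term i = 0 contributes nothing, since `0⁻¹ = 0`; the others telescope through 1/n -
  -- 1/(n+1).
  have key : ∀ n : ℕ, ∑ i ∈ Finset.range (n + 1), ((i : ℝ) ^ 2)⁻¹ ≤ 2 - (n : ℝ)⁻¹ := by
    intro n
    induction n with
    | zero => simp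
    | succ n ih =>
      rw [Finset.sum_range_succ]
      rcases Nat.eq_zero_or_pos n with rfl | hn
      · norm_num
      have hn' : (0 : ℝ) < n := by exact_mod_cast hn
      have : (((n + 1 : ℕ) : ℝ) ^ 2)⁻¹ ≤ (n : ℝ)⁻¹ - ((n + 1 : ℕ) : ℝ)⁻¹ := by
        push_cast
        rw [inv_sub_inv (by positivity) (by positivity), inv_eq_one_div,
          div_le_div_iff₀ (by positivity) (by positivity)]
        nlinarith
      linarith
  have h2 : ∑ i ∈ Finset.range (k + 1), ((i : ℝ) ^ 2)⁻¹ ≤ 2 :=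
    (key k).trans (by have : (0 : ℝ) ≤ (k : ℝ)⁻¹ := by positivity
                      linarith)
  rw [Finset.sum_add_distrib, Finset.Nat.sum_antidiagonal_eq_sum_range_succ_mk,
    Finset.Nat.sum_antidiagonal_eq_sum_range_succ_mk]
  have h3 := Finset.sum_range_reflect (fun i : ℕ => ((i : ℝ) ^ 2)⁻¹) (k + 1)
  simp only [Nat.add_sub_cancel] at h3
  rw [h3]
  linarith

/-- Powers of the index are absorbed by raising the first parameter of `Nat.multichoose`. -/
theorem rpow_mul_multichoose_le {E Q : ℕ} (hE : 1 ≤ E) {q : ℝ} (hq : 0 ≤ q) (hQ : q ≤ Q) (l : ℕ) :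
    ((E + l : ℕ) : ℝ) ^ q * (Nat.multichoose E l : ℝ) ≤
      2 * ((E + Q : ℕ) : ℝ) ^ q * (Nat.multichoose (E + Q) l : ℝ) := by
  have hpow : ∀ P : ℕ, ((E + l : ℕ) : ℝ) ^ P * (Nat.multichoose E l : ℝ) ≤
      ((E + P : ℕ) : ℝ) ^ P * (Nat.multichoose (E + P) l : ℝ) := by
    intro P
    induction P with
    | zero => simp
    | succ P ih =>
      have h1 := add_mul_multichoose (E + P) l
      have h1' : ((E + P + l : ℕ) : ℝ) * (Nat.multichoose (E + P) l : ℝ) =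
        ((E + P : ℕ) : ℝ) * (Nat.multichoose (E + (P + 1)) l : ℝ) := by exact_mod_cast h1
      calc ((E + l : ℕ) : ℝ) ^ (P + 1) * (Nat.multichoose E l : ℝ)
          = ((E + l : ℕ) : ℝ) * (((E + l : ℕ) : ℝ) ^ P * (Nat.multichoose E l : ℝ)) := by ring
        _ ≤ ((E + P + l : ℕ) : ℝ) * (((E + P : ℕ) : ℝ) ^ P * (Nat.multichoose (E + P) l : ℝ)) := by
            gcongr
            omega
        _ = ((E + P : ℕ) : ℝ) ^ P * (((E + P + l : ℕ) : ℝ) * (Nat.multichoose (E + P) l : ℝ)) := by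
            ring
        _ = ((E + P : ℕ) : ℝ) ^ (P + 1) * (Nat.multichoose (E + (P + 1)) l : ℝ) := by
            rw [h1']; ring
        _ ≤ _ := by gcongr; omega
  have hEl : (0 : ℝ) < ((E + l : ℕ) : ℝ) := by exact_mod_cast (by omega : 0 < E + l)
  have hEQ : (0 : ℝ) < ((E + Q : ℕ) : ℝ) := by exact_mod_cast (by omega : 0 < E + Q)
  have hm : (Nat.multichoose E l : ℝ) ≤ (Nat.multichoose (E + Q) l : ℝ) := by
    exact_mod_cast multichoose_mono_left (by omega) l
  have hb : (0 : ℝ) ≤ (Nat.multichoose E l : ℝ) := by positivity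
  set X : ℝ := ((E + l : ℕ) : ℝ) / ((E + Q : ℕ) : ℝ) with hX
  have hX0 : 0 < X := by positivity
  have hXe : ((E + l : ℕ) : ℝ) = X * ((E + Q : ℕ) : ℝ) := by rw [hX]; field_simp
  -- A real exponent between 0 and Q is reduced to the integer exponents 0 and Q; this is the source
  -- of the constant 2.
  have h1 : X ^ q ≤ 1 + X ^ Q := by
    rcases le_total X 1 with h | h
    · have := Real.rpow_le_one hX0.le h hq
      have : 0 ≤ X ^ Q := by positivity
      linarith
    · have := Real.rpow_le_rpow_of_exponent_le h hQ
      rw [Real.rpow_natCast] at this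
      linarith
  have h2 : X ^ Q * (Nat.multichoose E l : ℝ) ≤ (Nat.multichoose (E + Q) l : ℝ) := by
    have := hpow Q
    rw [hXe, mul_pow] at this
    have hp : (0 : ℝ) < ((E + Q : ℕ) : ℝ) ^ Q := by positivity
    nlinarith [this]
  rw [hXe, Real.mul_rpow hX0.le hEQ.le]
  have hr : (0 : ℝ) ≤ ((E + Q : ℕ) : ℝ) ^ q := by positivity
  calc X ^ q * ((E + Q : ℕ) : ℝ) ^ q * (Nat.multichoose E l : ℝ)
      = ((E + Q : ℕ) : ℝ) ^ q * (X ^ q * (Nat.multichoose E l : ℝ)) := by ring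
    _ ≤ ((E + Q : ℕ) : ℝ) ^ q * ((1 + X ^ Q) * (Nat.multichoose E l : ℝ)) := by gcongr
    _ ≤ ((E + Q : ℕ) : ℝ) ^ q * (2 * (Nat.multichoose (E + Q) l : ℝ)) := by
        refine mul_le_mul_of_nonneg_left ?_ hr
        linarith
    _ = _ := by ring

/-- The effect of `γ` derivatives on the weight `Nat.multichoose`. -/
theorem descFactorial_mul_multichoose (E l γ : ℕ) :
    (l + γ).descFactorial γ * Nat.multichoose E (l + γ) =
      E.ascFactorial γ * Nat.multichoose (E + γ) l := by
  induction γ generalizing E with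
  | zero => simp
  | succ γ ih =>
    have h := succ_mul_multichoose_succ E (l + γ)
    have e : l + (γ + 1) = l + γ + 1 := by ring
    rw [e, Nat.succ_descFactorial_succ, mul_comm (l + γ + 1), mul_assoc, h, mul_left_comm, ih,
      ← mul_assoc, ← Nat.succ_eq_add_one E, Nat.succ_ascFactorial, Nat.ascFactorial_succ]
    congr 2
    omega

end TotChar

namespace TotChar

/-! ### Bounds for Taylor coefficients -/

/-- A finite set of exponents lies in a box, over which the sum factors into geometric sums. -/
theorem sum_pow_degree_le {ι : Type} [Fintype ι] {x : ℝ} (hx0 : 0 ≤ x) (hx1 : x < 1)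
    (S : Finset (ι →₀ ℕ)) :
    ∑ e ∈ S, x ^ e.degree ≤ ((1 - x)⁻¹) ^ Fintype.card ι := by
  classical
  set K := S.sup Finsupp.degree with hK
  have hsub : S.map ⟨fun e : ι →₀ ℕ => (e : ι → ℕ), DFunLike.coe_injective⟩ ⊆
      Fintype.piFinset fun _ : ι => Finset.range (K + 1) := by
    intro f hf
    obtain ⟨e, he, rfl⟩ := Finset.mem_map.1 hf
    simp only [Fintype.mem_piFinset, Finset.mem_range, Function.Embedding.coeFn_mk]
    intro i
    exact Nat.lt_succ_of_le ((Finsupp.le_degree i e).trans (Finset.le_sup he))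
  calc ∑ e ∈ S, x ^ e.degree = ∑ e ∈ S, ∏ i, x ^ e i := by
        refine Finset.sum_congr rfl fun e _ => ?_
        rw [Finsupp.degree_eq_sum, Finset.prod_pow_eq_pow_sum]
    _ = ∑ f ∈ S.map ⟨fun e : ι →₀ ℕ => (e : ι → ℕ), DFunLike.coe_injective⟩, ∏ i, x ^ f i := by
        rw [Finset.sum_map]; rfl
    _ ≤ ∑ f ∈ Fintype.piFinset fun _ : ι => Finset.range (K + 1), ∏ i, x ^ f i :=
        Finset.sum_le_sum_of_subset_of_nonneg hsub fun f _ _ =>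
          Finset.prod_nonneg fun i _ => pow_nonneg hx0 _
    _ = ∏ _i : ι, ∑ j ∈ Finset.range (K + 1), x ^ j := (Finset.prod_univ_sum _ _).symm
    _ ≤ ∏ _i : ι, (1 - x)⁻¹ := by
        refine Finset.prod_le_prod (fun i _ => Finset.sum_nonneg fun j _ => pow_nonneg hx0 _)
          fun i _ => ?_
        rw [← tsum_geometric_of_lt_one hx0 hx1]
        exact (summable_geometric_of_lt_one hx0 hx1).sum_le_tsum _ fun j _ => pow_nonneg hx0 _
    _ = _ := by simp

theorem summable_pow_degree {ι : Type} [Fintype ι] {x : ℝ} (hx0 : 0 ≤ x) (hx1 : x < 1) :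
    Summable fun e : ι →₀ ℕ => x ^ e.degree :=
  summable_of_sum_le (fun _ => pow_nonneg hx0 _) (sum_pow_degree_le hx0 hx1)

/-- The n-th derivative is the symmetrization, over n! permutations, of the n-th term of a power
series, whose norms grow at most geometrically. -/
theorem norm_iteratedFDeriv_apply_le {E : Type} [NormedAddCommGroup E] [NormedSpace ℂ E]
    {f : E → ℂ} {x : E} (hf : AnalyticAt ℂ f x) :
    ∃ H R : ℝ, 0 < H ∧ 0 < R ∧ ∀ (n : ℕ) (v : Fin n → E), (∀ i, ‖v i‖ ≤ 1) →
      ‖iteratedFDeriv ℂ n f x v‖ ≤ H * R ^ n * (n ! : ℝ) := by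
  obtain ⟨p, r, hp⟩ := hf
  obtain ⟨H, R, hH, hR, hpn⟩ := p.le_mul_pow_of_radius_pos (hp.r_pos.trans_le hp.r_le)
  refine ⟨H, R, hH, hR, fun n v hv => ?_⟩
  rw [hp.iteratedFDeriv_eq_sum_of_completeSpace]
  calc ‖∑ σ : Equiv.Perm (Fin n), p n fun i => v (σ i)‖
      ≤ ∑ σ : Equiv.Perm (Fin n), H * R ^ n := by
        refine norm_sum_le_of_le _ fun σ _ => ?_
        refine ((p n).le_opNorm _).trans ?_
        refine (mul_le_of_le_one_right (norm_nonneg _) ?_).trans (hpn n)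
        exact Finset.prod_le_one (fun i _ => norm_nonneg _) fun i _ => hv _
    _ = _ := by
        simp [Fintype.card_perm]; ring

/-- A multinomial coefficient is at most the sum of all of them, which is a power of the number of
variables. -/
theorem factorial_sum_le {ι : Type} [Fintype ι] (e : ι → ℕ) :
    (∑ i, e i)! ≤ Fintype.card ι ^ (∑ i, e i) * ∏ i, (e i)! := by
  classical
  rw [← Nat.multinomial_spec, mul_comm]
  refine Nat.mul_le_mul_right _ ?_
  have h := Finset.sum_pow_eq_sum_piAntidiag (R := ℕ) Finset.univ (fun _ : ι => 1) (∑ i, e i)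
  simp only [Finset.sum_const, smul_eq_mul, mul_one, one_pow, Finset.prod_const_one,
    Finset.card_univ] at h
  rw [h]
  refine Finset.single_le_sum (f := fun k => Nat.multinomial Finset.univ k)
    (fun _ _ => Nat.zero_le _) ?_
  simp

theorem norm_coeff_taylorSeries_le {ι : Type} [Fintype ι] [DecidableEq ι] {f : (ι → ℂ) → ℂ}
    (hf : AnalyticAt ℂ f 0) :
    ∃ H R : ℝ, 0 < H ∧ 0 < R ∧ ∀ e : ι →₀ ℕ,
      ‖MvPowerSeries.coeff e (taylorSeries f)‖ ≤ H * R ^ e.degree := by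
  obtain ⟨H, R, hH, hR, h⟩ := norm_iteratedFDeriv_apply_le hf
  -- The derivative bound has |e|! where the Taylor coefficient divides by e!; the quotient is
  -- geometric in |e|. The added 1 keeps the rate positive when there are no variables.
  refine ⟨H, R * (Fintype.card ι + 1), hH, by positivity, fun e => ?_⟩
  have hlen : (Finsupp.toMultiset e).toList.length = e.degree := by
    rw [Multiset.length_toList, Finsupp.card_toMultiset, Finsupp.degree_apply]
    rfl
  have hpos : (0 : ℝ) < ((∏ i, (e i)! : ℕ) : ℝ) := by
    exact_mod_cast Finset.prod_pos fun i _ => Nat.factorial_pos _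
  have h1 : ((e.degree)! : ℝ) ≤ ((Fintype.card ι : ℝ) + 1) ^ e.degree * ((∏ i, (e i)! : ℕ) : ℝ) := by
    have h2 : (((∑ i, e i)! : ℕ) : ℝ) ≤
        ((Fintype.card ι ^ (∑ i, e i) * ∏ i, (e i)! : ℕ) : ℝ) := Nat.cast_le.2 (factorial_sum_le e)
    rw [Finsupp.degree_eq_sum]
    refine h2.trans ?_
    rw [Nat.cast_mul, Nat.cast_pow]
    refine mul_le_mul_of_nonneg_right ?_ hpos.le
    exact pow_le_pow_left₀ (by positivity) (by linarith) _
  change ‖taylorSeries f e‖ ≤ _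
  rw [taylorSeries]
  rw [norm_div, Complex.norm_natCast, div_le_iff₀ hpos]
  refine (h _ _ fun i => ?_).trans ?_
  · rw [Pi.norm_single]; simp
  · rw [hlen, mul_pow]
    calc H * R ^ e.degree * (e.degree ! : ℝ)
        ≤ H * R ^ e.degree * (((Fintype.card ι : ℝ) + 1) ^ e.degree * ((∏ i, (e i)! : ℕ) : ℝ)) := by
          gcongr
      _ = _ := by ring

/-- The Taylor coefficients of an analytic function of several variables are absolutely summable
against a small geometric weight. -/
theorem exists_sum_norm_coeff_taylorSeries_le {ι : Type} [Fintype ι] [DecidableEq ι]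
    {f : (ι → ℂ) → ℂ} (hf : AnalyticAt ℂ f 0) :
    ∃ H ρ : ℝ, 0 < H ∧ 0 < ρ ∧ ∀ S : Finset (ι →₀ ℕ),
      ∑ e ∈ S, ‖MvPowerSeries.coeff e (taylorSeries f)‖ * ρ ^ e.degree ≤ H := by
  obtain ⟨H, R, hH, hR, h⟩ := norm_coeff_taylorSeries_le hf
  refine ⟨H * ((1 - 1 / 2)⁻¹) ^ Fintype.card ι, (2 * R)⁻¹, by positivity, by positivity,
    fun S => ?_⟩
  calc ∑ e ∈ S, ‖MvPowerSeries.coeff e (taylorSeries f)‖ * (2 * R)⁻¹ ^ e.degree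
      ≤ ∑ e ∈ S, H * (1 / 2) ^ e.degree := by
        refine Finset.sum_le_sum fun e _ => ?_
        calc _ ≤ H * R ^ e.degree * (2 * R)⁻¹ ^ e.degree := by gcongr; exact h e
          _ = _ := by
            rw [mul_assoc, ← mul_pow]
            congr 2
            field_simp
    _ ≤ _ := by
        rw [← Finset.mul_sum]
        exact mul_le_mul_of_nonneg_left (sum_pow_degree_le (by norm_num) (by norm_num) S) hH.le

/-- The Taylor coefficients at the origin of a function of one variable. -/
noncomputable def taylorCoeff (f : ℂ → ℂ) (n : ℕ) : ℂ := iteratedDeriv n f 0 / (n ! : ℂ)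

theorem norm_taylorCoeff_le {f : ℂ → ℂ} (hf : AnalyticAt ℂ f 0) :
    ∃ H R : ℝ, 0 < H ∧ 0 < R ∧ ∀ n : ℕ, ‖taylorCoeff f n‖ ≤ H * R ^ n := by
  obtain ⟨H, R, hH, hR, h⟩ := norm_iteratedFDeriv_apply_le hf
  refine ⟨H, R, hH, hR, fun n => ?_⟩
  have hpos : (0 : ℝ) < (n ! : ℝ) := by exact_mod_cast Nat.factorial_pos _
  rw [taylorCoeff, norm_div, Complex.norm_natCast, div_le_iff₀ hpos, iteratedDeriv_eq_iteratedFDeriv]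
  exact h _ _ fun i => by simp

theorem taylorCoeff_zero (f : ℂ → ℂ) : taylorCoeff f 0 = f 0 := by simp [taylorCoeff]

theorem analyticOrderNatAt_le_of_taylorCoeff_ne_zero {f : ℂ → ℂ} (hf : AnalyticAt ℂ f 0) {n : ℕ}
    (h : taylorCoeff f n ≠ 0) :
    analyticOrderAt f 0 ≠ ⊤ ∧ analyticOrderNatAt f 0 ≤ n := by
  have h1 : ¬ ((n + 1 : ℕ) : ℕ∞) ≤ analyticOrderAt f 0 := by
    intro hle
    have := (natCast_le_analyticOrderAt_iff_iteratedDeriv_eq_zero hf).1 hle n (Nat.lt_succ_self n)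
    exact h (by simp [taylorCoeff, this])
  have h2 : analyticOrderAt f 0 ≠ ⊤ := fun htop => h1 (by rw [htop]; exact le_top)
  refine ⟨h2, ?_⟩
  rw [← Nat.cast_analyticOrderNatAt h2, Nat.cast_le] at h1
  omega

end TotChar

namespace TotChar

/-! ### Coefficients of series in two variables -/

/-- The exponent of `t^k x^l`. -/
noncomputable def idx (k l : ℕ) : Fin 2 →₀ ℕ := Finsupp.single 0 k + Finsupp.single 1 l

@[simp] theorem idx_zero (k l : ℕ) : idx k l 0 = k := by simp [idx]

@[simp] theorem idx_one (k l : ℕ) : idx k l 1 = l := by simp [idx]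

theorem idx_eta (e : Fin 2 →₀ ℕ) : idx (e 0) (e 1) = e := by
  ext i
  fin_cases i <;> simp

theorem idx_add (k l k' l' : ℕ) : idx k l + idx k' l' = idx (k + k') (l + l') := by
  ext i
  fin_cases i <;> simp

theorem idx_inj {k l k' l' : ℕ} : idx k l = idx k' l' ↔ k = k' ∧ l = l' := by
  constructor
  · intro h
    exact ⟨by simpa using DFunLike.congr_fun h 0, by simpa using DFunLike.congr_fun h 1⟩
  · rintro ⟨rfl, rfl⟩
    rfl

/-- The coefficient of `t^k x^l`. -/
noncomputable def cf (f : FormalTX) (k l : ℕ) : ℂ := MvPowerSeries.coeff (idx k l) f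

theorem coeff_eq_cf (f : FormalTX) (e : Fin 2 →₀ ℕ) :
    MvPowerSeries.coeff e f = cf f (e 0) (e 1) := by rw [cf, idx_eta]

theorem cf_ext {f g : FormalTX} (h : ∀ k l, cf f k l = cf g k l) : f = g := by
  ext e
  rw [coeff_eq_cf, coeff_eq_cf, h]

@[simp] theorem cf_add (f g : FormalTX) (k l : ℕ) : cf (f + g) k l = cf f k l + cf g k l := by
  simp [cf]

@[simp] theorem cf_sub (f g : FormalTX) (k l : ℕ) : cf (f - g) k l = cf f k l - cf g k l := by
  simp [cf]

@[simp] theorem cf_smul (a : ℂ) (f : FormalTX) (k l : ℕ) : cf (a • f) k l = a * cf f k l := by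
  simp [cf]

theorem cf_sum {κ : Type*} (s : Finset κ) (f : κ → FormalTX) (k l : ℕ) :
    cf (∑ i ∈ s, f i) k l = ∑ i ∈ s, cf (f i) k l := by
  simp [cf]

theorem cf_one (k l : ℕ) : cf 1 k l = if k = 0 ∧ l = 0 then 1 else 0 := by
  classical
  rw [cf, MvPowerSeries.coeff_one]
  have : idx k l = 0 ↔ k = 0 ∧ l = 0 := by
    rw [← idx_inj (k' := 0) (l' := 0)]
    simp [idx]
  simp only [this]

theorem cf_mul (f g : FormalTX) (k l : ℕ) :
    cf (f * g) k l = ∑ x ∈ antidiagonal k, ∑ y ∈ antidiagonal l, cf f x.1 y.1 * cf g x.2 y.2 := by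
  classical
  rw [cf, MvPowerSeries.coeff_mul, ← Finset.sum_product']
  refine Finset.sum_nbij' (fun p => ((p.1 0, p.2 0), (p.1 1, p.2 1)))
    (fun q => (idx q.1.1 q.2.1, idx q.1.2 q.2.2)) ?_ ?_ ?_ ?_ ?_
  · intro p hp
    rw [Finset.HasAntidiagonal.mem_antidiagonal] at hp
    simp only [Finset.mem_product, Finset.HasAntidiagonal.mem_antidiagonal]
    exact ⟨by simpa using DFunLike.congr_fun hp 0, by simpa using DFunLike.congr_fun hp 1⟩
  · intro q hq
    simp only [Finset.mem_product, Finset.HasAntidiagonal.mem_antidiagonal] at hq ⊢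
    rw [idx_add, hq.1, hq.2]
  · intro p _
    simp [idx_eta]
  · intro q _
    simp
  · intro p _
    rw [coeff_eq_cf, coeff_eq_cf]

theorem cf_X_zero_mul (f : FormalTX) (k l : ℕ) :
    cf (MvPowerSeries.X 0 * f) k l = if 1 ≤ k then cf f (k - 1) l else 0 := by
  classical
  rw [cf, MvPowerSeries.X, MvPowerSeries.coeff_monomial_mul, one_mul]
  have : Finsupp.single 0 1 ≤ idx k l ↔ 1 ≤ k := by
    simp
  simp only [this]
  split_ifs with h
  · rw [coeff_eq_cf]; simp
  · rfl

theorem cf_X_one_mul (f : FormalTX) (k l : ℕ) :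
    cf (MvPowerSeries.X 1 * f) k l = if 1 ≤ l then cf f k (l - 1) else 0 := by
  classical
  rw [cf, MvPowerSeries.X, MvPowerSeries.coeff_monomial_mul, one_mul]
  have : Finsupp.single 1 1 ≤ idx k l ↔ 1 ≤ l := by
    simp
  simp only [this]
  split_ifs with h
  · rw [coeff_eq_cf]; simp
  · rfl

theorem cf_X_zero_pow_mul (f : FormalTX) (i k l : ℕ) :
    cf (MvPowerSeries.X 0 ^ i * f) k l = if i ≤ k then cf f (k - i) l else 0 := by
  induction i generalizing k with
  | zero => simp
  | succ i ih =>
    rw [pow_succ', mul_assoc, cf_X_zero_mul]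
    rcases k with _ | k
    · simp
    · simp [ih]

theorem cf_X_one_pow_mul (f : FormalTX) (μ k l : ℕ) :
    cf (MvPowerSeries.X 1 ^ μ * f) k l = if μ ≤ l then cf f k (l - μ) else 0 := by
  induction μ generalizing l with
  | zero => simp
  | succ μ ih =>
    rw [pow_succ', mul_assoc, cf_X_one_mul]
    rcases l with _ | l
    · simp
    · simp [ih]

theorem cf_dX (f : FormalTX) (k l : ℕ) : cf (dX f) k l = (l + 1) * cf f k (l + 1) := by
  change MvPowerSeries.coeff (idx k l) (MvPowerSeries.pderiv ℂ (1 : Fin 2) f) = _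
  rw [MvPowerSeries.coeff_pderiv, coeff_eq_cf]
  simp [mul_comm]

theorem cf_dX_pow (f : FormalTX) (α k l : ℕ) :
    cf ((dX ^ α) f) k l = ((l + α).descFactorial α : ℂ) * cf f k (l + α) := by
  induction α generalizing l with
  | zero => simp
  | succ α ih =>
    rw [pow_succ', Module.End.mul_apply, cf_dX, ih, ← mul_assoc]
    have e : l + 1 + α = l + (α + 1) := by ring
    rw [e, Nat.descFactorial_succ (l + (α + 1)) α]
    congr 1
    rw [show l + (α + 1) - α = l + 1 by omega]
    push_cast
    rfl

theorem cf_eulerT (f : FormalTX) (k l : ℕ) : cf (eulerT f) k l = k * cf f k l := by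
  change cf (MvPowerSeries.X 0 * MvPowerSeries.pderiv ℂ (0 : Fin 2) f) k l = _
  rw [cf_X_zero_mul]
  rcases k with _ | k
  · simp
  · rw [if_pos (by omega), cf, MvPowerSeries.coeff_pderiv, coeff_eq_cf]
    simp [mul_comm]

theorem cf_eulerT_pow (f : FormalTX) (j k l : ℕ) :
    cf ((eulerT ^ j) f) k l = (k : ℂ) ^ j * cf f k l := by
  induction j with
  | zero => simp
  | succ j ih => rw [pow_succ', Module.End.mul_apply, cf_eulerT, ih, pow_succ', mul_assoc]

theorem cf_eulerX (f : FormalTX) (k l : ℕ) : cf (eulerX f) k l = l * cf f k l := by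
  change cf (MvPowerSeries.X 1 * dX f) k l = _
  rw [cf_X_one_mul]
  rcases l with _ | l
  · simp
  · rw [if_pos (by omega), cf_dX]
    simp

theorem cf_aeval_eulerX (p : Polynomial ℂ) (f : FormalTX) (k l : ℕ) :
    cf (Polynomial.aeval eulerX p f) k l = p.eval (l : ℂ) * cf f k l := by
  induction p using Polynomial.induction_on' with
  | add p q hp hq => simp [hp, hq, add_mul]
  | monomial n a =>
    rw [Polynomial.aeval_monomial, Polynomial.eval_monomial, Module.End.mul_apply,
      Module.algebraMap_end_apply, cf_smul, mul_assoc]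
    congr 1
    induction n with
    | zero => simp
    | succ n ih => rw [pow_succ', Module.End.mul_apply, cf_eulerX, ih, pow_succ', mul_assoc]

theorem cf_taylorX (c : ℂ → ℂ) (k l : ℕ) :
    cf (taylorX c) k l = if k = 0 then taylorCoeff c l else 0 := by
  change taylorX c (idx k l) = _
  simp [taylorX, taylorCoeff]

theorem cf_taylorX_mul (c : ℂ → ℂ) (f : FormalTX) (k l : ℕ) :
    cf (taylorX c * f) k l = ∑ y ∈ antidiagonal l, taylorCoeff c y.1 * cf f k y.2 := by
  rw [cf_mul, Finset.sum_eq_single (0, k)]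
  · simp [cf_taylorX]
  · rintro ⟨a, b⟩ hab hne
    rw [Finset.HasAntidiagonal.mem_antidiagonal] at hab
    have : a ≠ 0 := by
      rintro rfl
      exact hne (by simpa using hab)
    simp [cf_taylorX, this]
  · intro h
    exact absurd (by simp) h

theorem cf_taylorX_mul_X_zero (a : ℂ → ℂ) (k l : ℕ) :
    cf (taylorX a * MvPowerSeries.X 0) k l = if k = 1 then taylorCoeff a l else 0 := by
  rw [mul_comm, cf_X_zero_mul, cf_taylorX]
  rcases k with _ | k <;> simp

/-! ### The linear operator on coefficients -/

/-- The contribution of the coefficients of `x^n`, `n ≥ 1`, of the `c_{j,α}` to `opC`. -/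
noncomputable def lowerPart (m : ℕ) (c : ℕ × ℕ → ℂ → ℂ) (k l : ℕ) (w : ℕ → ℂ) : ℂ :=
  ∑ n ∈ Finset.range l, ∑ p ∈ I m, taylorCoeff (c p) (l - n) *
    ((k : ℂ) ^ p.1 * ((n.descFactorial p.2 : ℕ) : ℂ) * w n)

/-- The Euler operators are diagonal on monomials and multiplication by a function of x only raises
the degree in x. Hence the operator preserves the t-degree and is triangular in l, with the values
c_{j,α}(0) on the diagonal. -/
theorem cf_opC (m : ℕ) (c : ℕ × ℕ → ℂ → ℂ) (u : FormalTX) (k l : ℕ) :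
    cf (opC m c u) k l = L m c k l * cf u k l - lowerPart m c k l (cf u k) := by
  have h1 : ∀ p ∈ I m, cf (taylorX (c p) *
      (eulerT ^ p.1) ((Polynomial.aeval eulerX (descPochhammer ℂ p.2)) u)) k l =
      c p 0 * (k : ℂ) ^ p.1 * (descPochhammer ℂ p.2).eval (l : ℂ) * cf u k l +
      ∑ n ∈ Finset.range l, taylorCoeff (c p) (l - n) *
        ((k : ℂ) ^ p.1 * ((n.descFactorial p.2 : ℕ) : ℂ) * cf u k n) := by
    intro p _
    rw [cf_taylorX_mul, ← Finset.Nat.sum_antidiagonal_swap,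
      Finset.Nat.sum_antidiagonal_eq_sum_range_succ_mk, Finset.sum_range_succ, add_comm]
    simp only [Prod.fst_swap, Prod.snd_swap, cf_eulerT_pow, cf_aeval_eulerX, Nat.sub_self,
      taylorCoeff_zero, descPochhammer_eval_eq_descFactorial]
    congr 1
    · ring
    · exact Finset.sum_congr rfl fun n _ => by ring
  rw [opC, cf_sub, cf_sum, Finset.sum_congr rfl h1, Finset.sum_add_distrib, cf_eulerT_pow,
    lowerPart, Finset.sum_comm, L, C, sub_mul, Finset.sum_mul]
  ring

end TotChar

namespace TotChar

/-! ### The composition -/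

/-- The series `(t ∂_t)^j ∂_x^α u`. -/
noncomputable def jet (u : FormalTX) (p : ℕ × ℕ) : FormalTX := (eulerT ^ p.1) ((dX ^ p.2) u)

theorem cf_jet (u : FormalTX) (p : ℕ × ℕ) (k l : ℕ) :
    cf (jet u p) k l =
      (k : ℂ) ^ p.1 * (((l + p.2).descFactorial p.2 : ℕ) : ℂ) * cf u k (l + p.2) := by
  rw [jet, cf_eulerT_pow, cf_dX_pow, mul_assoc]

theorem vanishesAtTZero_iff {u : FormalTX} : VanishesAtTZero u ↔ ∀ l, cf u 0 l = 0 := by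
  simp [VanishesAtTZero, cf, idx]

theorem X_zero_pow_dvd_iff {q : ℕ} {f : FormalTX} :
    MvPowerSeries.X 0 ^ q ∣ f ↔ ∀ k l, k < q → cf f k l = 0 := by
  rw [MvPowerSeries.X_pow_dvd_iff]
  constructor
  · intro h k l hk
    exact h _ (by simpa using hk)
  · intro h e he
    rw [coeff_eq_cf]
    exact h _ _ he

theorem X_zero_pow_dvd_jet_sub {u v : FormalTX} {K : ℕ}
    (h : ∀ k l, k < K → cf u k l = cf v k l) (p : ℕ × ℕ) :
    MvPowerSeries.X 0 ^ K ∣ jet u p - jet v p := by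
  rw [X_zero_pow_dvd_iff]
  intro k l hk
  rw [cf_sub, cf_jet, cf_jet, h _ _ hk, sub_self]

theorem X_zero_dvd_jet {u : FormalTX} (hu : VanishesAtTZero u) (p : ℕ × ℕ) :
    MvPowerSeries.X 0 ∣ jet u p := by
  rw [← pow_one (MvPowerSeries.X 0), X_zero_pow_dvd_iff]
  intro k l hk
  obtain rfl : k = 0 := by omega
  rw [cf_jet, vanishesAtTZero_iff.1 hu, mul_zero]

/-- The product of the `(t ∂_t)^j ∂_x^α u` over a multiset of indices `(j, α)`. -/
noncomputable def jetProd (u : FormalTX) (s : Multiset (ℕ × ℕ)) : FormalTX := (s.map (jet u)).prod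

theorem X_zero_pow_dvd_jetProd {u : FormalTX} (hu : VanishesAtTZero u) (s : Multiset (ℕ × ℕ)) :
    MvPowerSeries.X 0 ^ (Multiset.card s) ∣ jetProd u s := by
  induction s using Multiset.induction_on with
  | empty => simp
  | cons p s ih =>
    rw [jetProd, Multiset.map_cons, Multiset.prod_cons, Multiset.card_cons, pow_succ']
    exact mul_dvd_mul (X_zero_dvd_jet hu p) ih

/-- The difference of products telescopes into terms with one factor jet u - jet v of order K in t
and the remaining factors of order at least 1. The extra factor t avoids the truncated subtraction
in K + card - 1 and covers the empty product. -/
theorem X_zero_pow_dvd_jetProd_sub {u v : FormalTX} (hu : VanishesAtTZero u)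
    (hv : VanishesAtTZero v) {K : ℕ} (h : ∀ k l, k < K → cf u k l = cf v k l)
    (s : Multiset (ℕ × ℕ)) :
    (MvPowerSeries.X 0 : FormalTX) ^ (K + Multiset.card s) ∣
      MvPowerSeries.X 0 * (jetProd u s - jetProd v s) := by
  induction s using Multiset.induction_on with
  | empty => simp [jetProd]
  | cons p s ih =>
    have e : MvPowerSeries.X 0 * (jetProd u (p ::ₘ s) - jetProd v (p ::ₘ s)) =
        jet u p * (MvPowerSeries.X 0 * (jetProd u s - jetProd v s)) +
          MvPowerSeries.X 0 * ((jet u p - jet v p) * jetProd v s) := by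
      simp only [jetProd, Multiset.map_cons, Multiset.prod_cons]
      ring
    rw [e, Multiset.card_cons]
    refine dvd_add ?_ ?_
    · rw [← add_assoc, pow_succ']
      exact mul_dvd_mul (X_zero_dvd_jet hu p) ih
    · rw [← add_assoc, pow_succ', pow_add]
      exact mul_dvd_mul_left _
        (mul_dvd_mul (X_zero_pow_dvd_jet_sub h p) (X_zero_pow_dvd_jetProd hv s))

variable {M : Finset (ℕ × ℕ)}

/-- The multiset of the indices `(j, α)` occurring in `z^ν`. -/
noncomputable def indices (ν : M →₀ ℕ) : Multiset (ℕ × ℕ) :=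
  (Finsupp.toMultiset ν).map Subtype.val

theorem card_indices (ν : M →₀ ℕ) : Multiset.card (indices ν) = ν.degree := by
  rw [indices, Multiset.card_map, Finsupp.card_toMultiset, Finsupp.degree_apply]
  rfl

theorem mem_indices {ν : M →₀ ℕ} {p : ℕ × ℕ} (hp : p ∈ indices ν) : ∃ q : M, q.1 = p ∧ 0 < ν q := by
  obtain ⟨q, hq, rfl⟩ := Multiset.mem_map.1 hp
  refine ⟨q, rfl, ?_⟩
  rw [Finsupp.mem_toMultiset, Finsupp.mem_support_iff] at hq
  omega

/-- The substitution of `t`, `x` and the `(t ∂_t)^j ∂_x^α u` for the variables. -/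
noncomputable def jetSubst (M : Finset (ℕ × ℕ)) (u : FormalTX) : Vars M → FormalTX :=
  Sum.elim (fun k : Fin 2 => (MvPowerSeries.X k : FormalTX)) fun p : M => jet u p

theorem prod_expo (u : FormalTX) (i μ : ℕ) (ν : M →₀ ℕ) :
    ((expo i μ ν).prod fun s e => jetSubst M u s ^ e) =
      MvPowerSeries.X 0 ^ i * (MvPowerSeries.X 1 ^ μ * jetProd u (indices ν)) := by
  have h0 : ∀ s : Vars M, jetSubst M u s ^ 0 = 1 := fun s => pow_zero _
  have h1 : ∀ (s : Vars M) (a b : ℕ),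
      jetSubst M u s ^ (a + b) = jetSubst M u s ^ a * jetSubst M u s ^ b := fun s a b => pow_add _ _ _
  have h2 : ∀ (s : Vars M) (n : ℕ),
      ((Finsupp.single s n).prod fun s e => jetSubst M u s ^ e) = jetSubst M u s ^ n :=
    fun s n => Finsupp.prod_single_index (h0 s)
  rw [expo, Finsupp.prod_add_index' h0 h1, Finsupp.prod_add_index' h0 h1, h2, h2,
    Finsupp.prod_mapDomain_index h0 h1, mul_assoc]
  congr 2
  rw [jetProd, indices, Multiset.map_map, Finsupp.toMultiset_map, Finsupp.prod_toMultiset,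
    Finsupp.prod_mapDomain_index (fun _ => pow_zero _) (fun _ _ _ => pow_add _ _ _)]
  rfl

theorem exists_eq_expo (d : Vars M →₀ ℕ) :
    ∃ (i μ : ℕ) (ν : M →₀ ℕ), d = expo i μ ν := by
  refine ⟨d (Sum.inl 0), d (Sum.inl 1), d.comapDomain Sum.inr Sum.inr_injective.injOn, ?_⟩
  ext s
  rcases s with k | p
  · have : Finsupp.mapDomain (Sum.inr : M → Vars M)
        (d.comapDomain Sum.inr Sum.inr_injective.injOn) (Sum.inl k) = 0 :=
      Finsupp.mapDomain_of_notMem_range _ _ (by simp)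
    fin_cases k <;> simp_all [expo]
  · simp [expo, Finsupp.mapDomain_apply Sum.inr_injective]

theorem degree_expo (i μ : ℕ) (ν : M →₀ ℕ) : (expo i μ ν).degree = i + μ + ν.degree := by
  rw [expo, map_add, map_add, Finsupp.degree_single, Finsupp.degree_single, Finsupp.degree_mapDomain]

theorem hasSubst_jetSubst {u : FormalTX} (hu : VanishesAtTZero u) :
    MvPowerSeries.HasSubst (jetSubst M u) := by
  refine MvPowerSeries.hasSubst_of_constantCoeff_zero fun s => ?_
  rcases s with k | p
  · simp [jetSubst]
  · rw [← MvPowerSeries.coeff_zero_eq_constantCoeff_apply, coeff_eq_cf]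
    have := X_zero_pow_dvd_iff.1 ((pow_one (MvPowerSeries.X 0 : FormalTX)).symm ▸
      X_zero_dvd_jet hu p.1) 0 0 one_pos
    exact this

/-- The monomial `t^i x^μ z^ν`, with `(t ∂_t)^j ∂_x^α u` substituted for `z_{j,α}`. -/
noncomputable def jetMonomial (u : FormalTX) (d : Vars M →₀ ℕ) : FormalTX :=
  d.prod fun s e => jetSubst M u s ^ e

theorem cf_compose {G : (Vars M → ℂ) → ℂ} {u : FormalTX} (hu : VanishesAtTZero u) (k l : ℕ) :
    cf (compose G u) k l =
      ∑ᶠ d : Vars M →₀ ℕ, MvPowerSeries.coeff d (taylorSeries G) * cf (jetMonomial u d) k l := by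
  have := MvPowerSeries.coeff_subst (hasSubst_jetSubst (M := M) hu) (taylorSeries G) (idx k l)
  simp only [smul_eq_mul] at this
  exact this

/-- Each coefficient of the composition is a finite sum, but over a set of exponents that is not
controlled; a bound uniform over all finite sets suffices. -/
theorem norm_cf_compose_le {G : (Vars M → ℂ) → ℂ} {u : FormalTX} (hu : VanishesAtTZero u)
    {k l : ℕ} {B : (Vars M →₀ ℕ) → ℝ} {H : ℝ} (hB : ∀ d,
      ‖MvPowerSeries.coeff d (taylorSeries G) * cf (jetMonomial u d) k l‖ ≤ B d)
    (hH : ∀ S : Finset (Vars M →₀ ℕ), ∑ d ∈ S, B d ≤ H) :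
    ‖cf (compose G u) k l‖ ≤ H := by
  have hfin := MvPowerSeries.coeff_subst_finite (hasSubst_jetSubst (M := M) hu) (taylorSeries G)
    (idx k l)
  simp only [smul_eq_mul] at hfin
  replace hfin : Function.HasFiniteSupport fun d : Vars M →₀ ℕ =>
    MvPowerSeries.coeff d (taylorSeries G) * cf (jetMonomial u d) k l := hfin
  rw [cf_compose hu, finsum_eq_sum _ hfin]
  exact (norm_sum_le_of_le _ fun d _ => hB d).trans (hH _)

/-- The coefficients of `t^k` of the composition depend only on lower coefficients. -/
theorem cf_compose_congr {G : (Vars M → ℂ) → ℂ} (hG : OrderAtLeastTwo G) {u v : FormalTX}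
    (hu : VanishesAtTZero u) (hv : VanishesAtTZero v) {k : ℕ}
    (h : ∀ k' l, k' < k → cf u k' l = cf v k' l) (l : ℕ) :
    cf (compose G u) k l = cf (compose G v) k l := by
  rw [cf_compose hu, cf_compose hv]
  refine finsum_congr fun d => ?_
  obtain ⟨i, μ, ν, rfl⟩ := exists_eq_expo d
  by_cases hn : i + ν.degree < 2
  · have : MvPowerSeries.coeff (expo i μ ν) (taylorSeries G) = 0 := hG i ν hn μ
    rw [this, zero_mul, zero_mul]
  congr 1
  rw [← sub_eq_zero, ← cf_sub, jetMonomial, jetMonomial, prod_expo, prod_expo]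
  -- Here i + |ν| ≥ 2 enters: t times the difference has order at least k + i + |ν| ≥ k + 2, so the
  -- difference itself has no term in t^k.
  have h1 : (MvPowerSeries.X 0 : FormalTX) ^ (k + 2) ∣ MvPowerSeries.X 0 *
      (MvPowerSeries.X 0 ^ i * (MvPowerSeries.X 1 ^ μ * jetProd u (indices ν)) -
        MvPowerSeries.X 0 ^ i * (MvPowerSeries.X 1 ^ μ * jetProd v (indices ν))) := by
    have h2 := mul_dvd_mul (dvd_refl ((MvPowerSeries.X 0 : FormalTX) ^ i))
      (X_zero_pow_dvd_jetProd_sub hu hv h (indices ν))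
    rw [← pow_add, card_indices] at h2
    refine (pow_dvd_pow _ (by omega)).trans ((h2.mul_left (MvPowerSeries.X 1 ^ μ)).trans ?_)
    exact dvd_of_eq (by ring)
  have h3 := X_zero_pow_dvd_iff.1 h1 (k + 1) l (by omega)
  rw [cf_X_zero_mul, if_pos (by omega)] at h3
  simpa using h3

theorem cf_compose_zero {G : (Vars M → ℂ) → ℂ} (hG : OrderAtLeastTwo G) {u : FormalTX}
    (hu : VanishesAtTZero u) (l : ℕ) : cf (compose G u) 0 l = 0 := by
  rw [cf_compose hu]
  refine (finsum_congr fun d => ?_).trans finsum_zero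
  obtain ⟨i, μ, ν, rfl⟩ := exists_eq_expo d
  by_cases hn : i + ν.degree < 2
  · have : MvPowerSeries.coeff (expo i μ ν) (taylorSeries G) = 0 := hG i ν hn μ
    rw [this, zero_mul]
  rw [jetMonomial, prod_expo]
  have h1 : (MvPowerSeries.X 0 : FormalTX) ^ (i + ν.degree) ∣
      MvPowerSeries.X 0 ^ i * (MvPowerSeries.X 1 ^ μ * jetProd u (indices ν)) := by
    rw [pow_add, ← card_indices]
    exact mul_dvd_mul_left _ ((X_zero_pow_dvd_jetProd hu _).mul_left _)
  rw [X_zero_pow_dvd_iff.1 h1 0 l (by omega), mul_zero]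

/-! ### Formal solutions -/

/-- A system of equations that determines each coefficient from those preceding it in the
lexicographic order has a unique solution. -/
theorem existsUnique_of_triangular {E : Type*} [Zero E] (F : ℕ → ℕ → (ℕ → ℕ → E) → E)
    (hF : ∀ k l w w', (∀ k' l', k' < k → w k' l' = w' k' l') → (∀ l', l' < l → w k l' = w' k l') →
      F k l w = F k l w') :
    ∃! w : ℕ → ℕ → E, ∀ k l, w k l = F k l w := by
  classical
  let wf : WellFounded ((· < ·) : ℕ ×ₗ ℕ → ℕ ×ₗ ℕ → Prop) := wellFounded_lt
  -- Well-founded recursion on the lexicographic order. The entries not yet defined are set to 0,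
  -- which is harmless because F does not see them.
  let W : ℕ ×ₗ ℕ → E := wf.fix fun e rec =>
    F (ofLex e).1 (ofLex e).2 fun k l => if h : toLex (k, l) < e then rec _ h else 0
  have hW : ∀ e, W e = F (ofLex e).1 (ofLex e).2
      fun k l => if toLex (k, l) < e then W (toLex (k, l)) else 0 := by
    intro e
    exact wf.fix_eq _ _
  refine ⟨fun k l => W (toLex (k, l)), fun k l => ?_, fun w hw => ?_⟩
  · change W (toLex (k, l)) = _
    rw [hW]
    refine hF k l _ _ (fun k' l' hk => ?_) fun l' hl => ?_
    · exact if_pos (Prod.Lex.toLex_lt_toLex.2 (Or.inl hk))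
    · have hlt : toLex (k, l') < toLex (k, l) := Prod.Lex.toLex_lt_toLex.2 (Or.inr ⟨rfl, hl⟩)
      exact if_pos hlt
  · funext k l
    have key : ∀ e : ℕ ×ₗ ℕ, w (ofLex e).1 (ofLex e).2 = W e := by
      intro e
      induction e using wf.induction with
      | _ e ih =>
        rw [hW, hw]
        refine hF _ _ _ _ (fun k' l' hk => ?_) fun l' hl => ?_
        · have hlt : toLex (k', l') < e := Prod.Lex.toLex_lt_toLex.2 (Or.inl hk)
          rw [if_pos hlt]
          exact ih _ hlt
        · have hlt : toLex ((ofLex e).1, l') < e := Prod.Lex.toLex_lt_toLex.2 (Or.inr ⟨rfl, hl⟩)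
          rw [if_pos hlt]
          exact ih _ hlt
    exact key (toLex (k, l))

/-- The series with given coefficients, without the terms of `t`-degree `0` or at least `K`. -/
noncomputable def truncT (K : ℕ) (w : ℕ → ℕ → ℂ) : FormalTX := fun e =>
  if 1 ≤ e 0 ∧ e 0 < K then w (e 0) (e 1) else 0

theorem cf_truncT (K : ℕ) (w : ℕ → ℕ → ℂ) (k l : ℕ) :
    cf (truncT K w) k l = if 1 ≤ k ∧ k < K then w k l else 0 := by
  change truncT K w (idx k l) = _
  simp [truncT]

theorem vanishesAtTZero_truncT (K : ℕ) (w : ℕ → ℕ → ℂ) : VanishesAtTZero (truncT K w) := by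
  rw [vanishesAtTZero_iff]
  intro l
  simp [cf_truncT]

/-- The equation at the coefficient of `t^k x^l`, for `k ≥ 1`. -/
theorem isFormalSolution_iff {m : ℕ} {c : ℕ × ℕ → ℂ → ℂ} {a : ℂ → ℂ} {G : (Vars M → ℂ) → ℂ}
    (hG : OrderAtLeastTwo G) {u : FormalTX} :
    IsFormalSolution m c a G u ↔ (∀ l, cf u 0 l = 0) ∧ ∀ k l : ℕ, 1 ≤ k →
      L m c k l * cf u k l = lowerPart m c k l (cf u k) +
        ((if k = 1 then taylorCoeff a l else 0) + cf (compose G (truncT k (cf u))) k l) := by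
  rw [IsFormalSolution, vanishesAtTZero_iff]
  refine and_congr_right fun hu => ?_
  have hu' : VanishesAtTZero u := vanishesAtTZero_iff.2 hu
  -- Truncation is invisible at t^k. It makes the right side meaningful for an arbitrary array of
  -- coefficients, since a truncated series always vanishes at t = 0 and may be substituted.
  have hcomp : ∀ k l, cf (compose G (truncT k (cf u))) k l = cf (compose G u) k l := by
    intro k l
    refine cf_compose_congr hG (vanishesAtTZero_truncT _ _) hu' (fun k' l' hk' => ?_) l
    rw [cf_truncT]
    split_ifs with h
    · rfl
    · obtain rfl : k' = 0 := by omega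
      exact (hu l').symm
  constructor
  · intro h k l _
    have := congrArg (fun f => cf f k l) h
    simp only [cf_opC, cf_add, cf_taylorX_mul_X_zero] at this
    rw [hcomp, ← this]
    ring
  · intro h
    refine cf_ext fun k l => ?_
    rw [cf_opC, cf_add, cf_taylorX_mul_X_zero]
    rcases Nat.eq_zero_or_pos k with rfl | hk
    · rw [cf_compose_zero hG hu', hu]
      simp [lowerPart, hu]
    · rw [h k l hk, hcomp]
      ring

theorem existsUnique_isFormalSolution {m : ℕ} {c : ℕ × ℕ → ℂ → ℂ} (a : ℂ → ℂ)
    {G : (Vars M → ℂ) → ℂ} (hG : OrderAtLeastTwo G) (hN : NonResonant m c) :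
    ∃! u : FormalTX, IsFormalSolution m c a G u := by
  classical
  obtain ⟨w, hw, huniq⟩ := existsUnique_of_triangular
    (fun k l (w : ℕ → ℕ → ℂ) => if k = 0 then 0 else
      (lowerPart m c k l (w k) +
        ((if k = 1 then taylorCoeff a l else 0) + cf (compose G (truncT k w)) k l)) / L m c k l)
    (by
      intro k l w w' h1 h2
      have e1 : lowerPart m c k l (w k) = lowerPart m c k l (w' k) :=
        Finset.sum_congr rfl fun n hn => by rw [h2 n (Finset.mem_range.1 hn)]
      have e2 : truncT k w = truncT k w' := by
        refine cf_ext fun k' l' => ?_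
        rw [cf_truncT, cf_truncT]
        split_ifs with h
        · exact h1 _ _ h.2
        · rfl
      simp only [e1, e2])
  have hiff : ∀ u : FormalTX, IsFormalSolution m c a G u ↔ ∀ k l : ℕ, cf u k l = if k = 0 then 0 else
      (lowerPart m c k l (cf u k) +
        ((if k = 1 then taylorCoeff a l else 0) + cf (compose G (truncT k (cf u))) k l)) /
          L m c k l := by
    intro u
    rw [isFormalSolution_iff hG]
    constructor
    · rintro ⟨h0, h1⟩ k l
      by_cases hk : k = 0
      · rw [if_pos hk, hk, h0]
      · rw [if_neg hk, eq_div_iff (hN k l (by omega)), mul_comm]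
        exact h1 k l (by omega)
    · intro h
      refine ⟨fun l => by rw [h, if_pos rfl], fun k l hk => ?_⟩
      have := h k l
      rw [if_neg (by omega), eq_div_iff (hN k l hk), mul_comm] at this
      exact this
  have hcf : cf (fun e => w (e 0) (e 1)) = w := by
    funext k l
    change w (idx k l 0) (idx k l 1) = _
    simp
  refine ⟨fun e => w (e 0) (e 1), ?_, fun u hu => ?_⟩
  · refine (hiff _).2 ?_
    rw [hcf]
    exact hw
  · have := huniq (cf u) ((hiff u).1 hu)
    refine cf_ext fun k l => ?_
    rw [hcf, this]

end TotChar

namespace TotChar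

/-! ### The lower bound for the characteristic polynomial -/

open Filter

variable {m : ℕ} {c : ℕ × ℕ → ℂ → ℂ}

/-- The weight `k^j (l+1)^α`. -/
noncomputable def wt (p : ℕ × ℕ) (k l : ℕ) : ℝ := (k : ℝ) ^ p.1 * ((l : ℝ) + 1) ^ p.2

/-- The sum of the weights `k^j (l+1)^α` over `Λ_0`. -/
noncomputable def phi (m : ℕ) (c : ℕ × ℕ → ℂ → ℂ) (k l : ℕ) : ℝ := ∑ p ∈ Lam0 m c, wt p k l

theorem wt_nonneg (p : ℕ × ℕ) (k l : ℕ) : 0 ≤ wt p k l := by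
  unfold wt; positivity

theorem wt_pos (p : ℕ × ℕ) {k : ℕ} (hk : 1 ≤ k) (l : ℕ) : 0 < wt p k l := by
  have : (0 : ℝ) < k := by exact_mod_cast hk
  unfold wt; positivity

theorem mem_Lam0_self : (m, 0) ∈ Lam0 m c := by
  classical
  exact Finset.mem_insert_self _ _

theorem wt_le_phi {p : ℕ × ℕ} (hp : p ∈ Lam0 m c) (k l : ℕ) : wt p k l ≤ phi m c k l :=
  Finset.single_le_sum (f := fun p => wt p k l) (fun _ _ => wt_nonneg _ _ _) hp

theorem pow_le_phi (k l : ℕ) : (k : ℝ) ^ m ≤ phi m c k l := by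
  simpa [wt] using wt_le_phi (mem_Lam0_self (m := m) (c := c)) k l

theorem phi_pos {k : ℕ} (hk : 1 ≤ k) (l : ℕ) : 0 < phi m c k l :=
  (wt_pos _ hk l).trans_le (wt_le_phi mem_Lam0_self k l)

theorem wt_mono (p : ℕ × ℕ) (k : ℕ) {l l' : ℕ} (h : l ≤ l') : wt p k l ≤ wt p k l' := by
  unfold wt; gcongr

theorem phi_mono (k : ℕ) {l l' : ℕ} (h : l ≤ l') : phi m c k l ≤ phi m c k l' :=
  Finset.sum_le_sum fun p _ => wt_mono p k h

theorem c0_ne_zero {p : ℕ × ℕ} (hp : p ∈ Lam0 m c) : c0 m c p ≠ 0 := by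
  classical
  rw [Lam0, Finset.mem_insert, Finset.mem_filter] at hp
  unfold c0
  split_ifs with h
  · simp
  · exact (hp.resolve_left h).2

theorem mem_I {p : ℕ × ℕ} : p ∈ I m ↔ p.1 + p.2 ≤ m ∧ p.1 < m := by
  simp only [I, Finset.mem_filter, Finset.mem_product, Finset.mem_range]
  omega

theorem lt_of_mem_Lam0 {p : ℕ × ℕ} (hp : p ∈ Lam0 m c) (hne : p ≠ (m, 0)) : p.1 < m := by
  classical
  rw [Lam0, Finset.mem_insert, Finset.mem_filter] at hp
  exact (mem_I.1 (hp.resolve_left hne).1).2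

theorem L_eq (k l : ℕ) :
    L m c k l = -∑ p ∈ Lam0 m c, c0 m c p * ((k : ℂ) ^ p.1 * (l.descFactorial p.2 : ℂ)) := by
  classical
  have hnot : (m, 0) ∉ (I m).filter fun p => c p 0 ≠ 0 := by
    simp [mem_I]
  rw [Lam0, Finset.sum_insert hnot, L, C, Finset.sum_filter]
  have : ∀ p ∈ I m, c p 0 * (k : ℂ) ^ p.1 * (descPochhammer ℂ p.2).eval (l : ℂ) =
      if c p 0 ≠ 0 then c0 m c p * ((k : ℂ) ^ p.1 * (l.descFactorial p.2 : ℂ)) else 0 := by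
    intro p hp
    have hpm : p ≠ (m, 0) := by
      rintro rfl
      simp [mem_I] at hp
    rw [descPochhammer_eval_eq_descFactorial, c0, if_neg hpm]
    split_ifs with h
    · ring
    · rw [not_not.1 h]; ring
  rw [Finset.sum_congr rfl this]
  simp [c0]
  ring

/-! ### Supporting lines of the Newton polygon. -/

/-- A half-plane with nonnegative normal contains a quadrant as soon as it contains its corner, and
half-planes are convex. Linear inequalities on the polygon are thereby reduced to the points of Λ_0.
-/
theorem newton_subset_halfspace {r s M : ℝ} (hr : 0 ≤ r) (hs : 0 ≤ s)
    (h : ∀ p ∈ Lam0 m c, r * p.1 + s * p.2 ≤ M) :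
    newton m c ⊆ {q : ℝ × ℝ | r * q.1 + s * q.2 ≤ M} := by
  refine convexHull_min ?_ ?_
  · intro q hq
    simp only [Set.mem_iUnion] at hq
    obtain ⟨p, hp, h1, h2⟩ := hq
    refine le_trans ?_ (h p hp)
    gcongr
  · have hlin : IsLinearMap ℝ fun q : ℝ × ℝ => r * q.1 + s * q.2 :=
      ⟨fun x y => by simp; ring, fun a x => by simp; ring⟩
    exact convex_halfSpace_le hlin M

theorem mem_newton {p : ℕ × ℕ} (hp : p ∈ Lam0 m c) {q : ℝ × ℝ} (h1 : q.1 ≤ p.1) (h2 : q.2 ≤ p.2) :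
    q ∈ newton m c :=
  subset_convexHull ℝ _ (Set.mem_biUnion hp ⟨h1, h2⟩)

theorem mem_sidePts {r : ℝ} (hr : 0 ≤ r) {p : ℕ × ℕ} :
    p ∈ sidePts m c r ↔ p ∈ Lam0 m c ∧ ∀ q ∈ Lam0 m c, r * q.1 + q.2 ≤ r * p.1 + p.2 := by
  classical
  rw [sidePts, Finset.mem_filter]
  refine and_congr_right fun hp => ⟨fun h q hq => ?_, fun h => ⟨?_, fun q' hq' => ?_⟩⟩
  · exact h.2 (pt q) (mem_newton hq le_rfl le_rfl)
  · exact mem_newton hp le_rfl le_rfl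
  · have := newton_subset_halfspace hr zero_le_one (M := r * p.1 + p.2)
      (fun q hq => by simpa using h q hq) hq'
    simpa [pt] using this

/-- The logarithm of the left side is linear in (x, y) with nonnegative coefficients log k and
log(l+1), so it is bounded on the polygon by its largest value on Λ_0. -/
theorem rpow_mul_rpow_le_phi {k : ℕ} (hk : 1 ≤ k) (l : ℕ) {x y : ℝ} (h : (x, y) ∈ newton m c) :
    (k : ℝ) ^ x * ((l : ℝ) + 1) ^ y ≤ phi m c k l := by
  have hk0 : (1 : ℝ) ≤ k := by exact_mod_cast hk
  have hkp : (0 : ℝ) < k := by linarith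
  have hl0 : (0 : ℝ) < (l : ℝ) + 1 := by positivity
  have hl1 : (1 : ℝ) ≤ (l : ℝ) + 1 := by linarith [(l.cast_nonneg : (0 : ℝ) ≤ l)]
  have h1 := newton_subset_halfspace (Real.log_nonneg hk0) (Real.log_nonneg hl1)
    (M := Real.log (phi m c k l)) (fun p hp => by
      have := Real.log_le_log (wt_pos p hk l) (wt_le_phi hp k l)
      rw [wt, Real.log_mul (by positivity) (by positivity), Real.log_pow, Real.log_pow] at this
      linarith) h
  simp only [Set.mem_ofPred_eq] at h1
  rw [← Real.log_le_log_iff (by positivity) (phi_pos hk l),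
    Real.log_mul (by positivity) (by positivity), Real.log_rpow hkp, Real.log_rpow hl0]
  linarith

/-! ### Principal parts of the characteristic polynomial in the limit. -/

/-- If `L` is small compared to `phi` along a filter, then the sum of the limits of its terms
vanishes. -/
theorem sum_limit_eq_zero {F : Filter ℕ} [F.NeBot] (hF : F ≤ atTop) {κ ℓ : ℕ → ℕ}
    (hL : ∀ n, ‖L m c (κ n) (ℓ n)‖ ≤ 1 / ((n : ℝ) + 1) * phi m c (κ n) (ℓ n)) {D : ℕ → ℝ}
    (hD : ∀ n, 0 < D n) {w θ : ℕ × ℕ → ℝ}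
    (hw : ∀ p ∈ Lam0 m c, Tendsto (fun n => wt p (κ n) (ℓ n) / D n) F (𝓝 (w p)))
    (hθ : ∀ p ∈ Lam0 m c, Tendsto (fun n => ((ℓ n).descFactorial p.2 : ℝ) / ((ℓ n : ℝ) + 1) ^ p.2) F
      (𝓝 (θ p))) :
    ∑ p ∈ Lam0 m c, c0 m c p * ((w p * θ p : ℝ) : ℂ) = 0 := by
  have h1 : Tendsto (fun n => L m c (κ n) (ℓ n) / (D n : ℂ)) F
      (𝓝 (-∑ p ∈ Lam0 m c, c0 m c p * ((w p * θ p : ℝ) : ℂ))) := by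
    have h2 : (fun n => L m c (κ n) (ℓ n) / (D n : ℂ)) = fun n => -∑ p ∈ Lam0 m c, c0 m c p *
        (((wt p (κ n) (ℓ n) / D n) * (((ℓ n).descFactorial p.2 : ℝ) / ((ℓ n : ℝ) + 1) ^ p.2) : ℝ) : ℂ) := by
      funext n
      rw [L_eq, neg_div, Finset.sum_div]
      congr 1
      refine Finset.sum_congr rfl fun p _ => ?_
      have : ((wt p (κ n) (ℓ n) / D n) * (((ℓ n).descFactorial p.2 : ℝ) / ((ℓ n : ℝ) + 1) ^ p.2)) =
          (κ n : ℝ) ^ p.1 * ((ℓ n).descFactorial p.2 : ℝ) / D n := by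
        have : ((ℓ n : ℝ) + 1) ^ p.2 ≠ 0 := by positivity
        have := (hD n).ne'
        unfold wt
        field_simp
      rw [this, mul_div_assoc]
      push_cast
      ring
    rw [h2]
    refine (tendsto_finsetSum _ fun p hp => ?_).neg
    refine tendsto_const_nhds.mul ?_
    exact (Complex.continuous_ofReal.tendsto _).comp ((hw p hp).mul (hθ p hp))
  -- The quotient of phi by D converges, while the factor 1/(n+1) tends to 0.
  have h3 : Tendsto (fun n => L m c (κ n) (ℓ n) / (D n : ℂ)) F (𝓝 0) := by
    have h4 : Tendsto (fun n : ℕ => 1 / ((n : ℝ) + 1) * ∑ p ∈ Lam0 m c, wt p (κ n) (ℓ n) / D n) F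
        (𝓝 (0 * ∑ p ∈ Lam0 m c, w p)) :=
      (tendsto_one_div_add_atTop_nhds_zero_nat.mono_left hF).mul (tendsto_finsetSum _ hw)
    rw [zero_mul] at h4
    refine squeeze_zero_norm (fun n => ?_) h4
    rw [norm_div, Complex.norm_real, Real.norm_of_nonneg (hD n).le, ← Finset.sum_div,
      ← mul_div_assoc]
    exact div_le_div_of_nonneg_right (hL n) (hD n).le
  have := tendsto_nhds_unique h1 h3
  simpa using this

theorem tendsto_descFactorial_div {F : Filter ℕ} {ℓ : ℕ → ℕ} (hℓ : Tendsto ℓ F atTop) (α : ℕ) :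
    Tendsto (fun n => ((ℓ n).descFactorial α : ℝ) / ((ℓ n : ℝ) + 1) ^ α) F (𝓝 1) := by
  have h : Tendsto (fun l : ℕ => (l.descFactorial α : ℝ) / ((l : ℝ) + 1) ^ α) atTop (𝓝 1) := by
    induction α with
    | zero => simp
    | succ α ih =>
      have h1 : Tendsto (fun l : ℕ => ((l - α : ℕ) : ℝ) / ((l : ℝ) + 1)) atTop (𝓝 1) := by
        have h2 : Tendsto (fun l : ℕ => 1 - (α + 1 : ℝ) * (1 / ((l : ℝ) + 1))) atTop
            (𝓝 (1 - (α + 1 : ℝ) * 0)) :=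
          tendsto_const_nhds.sub (tendsto_const_nhds.mul tendsto_one_div_add_atTop_nhds_zero_nat)
        rw [mul_zero, sub_zero] at h2
        refine h2.congr' ?_
        filter_upwards [eventually_ge_atTop α] with l hl
        have : (l : ℝ) + 1 ≠ 0 := by positivity
        rw [Nat.cast_sub hl]
        field_simp
        ring
      have := h1.mul ih
      rw [one_mul] at this
      refine this.congr fun l => ?_
      rw [Nat.descFactorial_succ, pow_succ]
      push_cast
      rw [div_mul_div_comm, mul_comm (((l : ℝ) + 1) ^ α)]
  exact h.comp hℓ

theorem wt_div_rpow_eq (p : ℕ × ℕ) (k l : ℕ) (r ρ : ℝ) :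
    wt p k l / ((l : ℝ) + 1) ^ ρ =
      ((k : ℝ) / ((l : ℝ) + 1) ^ r) ^ p.1 * ((l : ℝ) + 1) ^ (r * p.1 + p.2 - ρ) := by
  have hpos : (0 : ℝ) < (l : ℝ) + 1 := by positivity
  rw [Real.rpow_sub hpos, Real.rpow_add hpos, Real.rpow_mul hpos.le,
    Real.rpow_natCast, Real.rpow_natCast, div_pow, wt]
  have h1 : (((l : ℝ) + 1) ^ r) ^ p.1 ≠ 0 := (pow_pos (Real.rpow_pos_of_pos hpos _) _).ne'
  have h2 : ((l : ℝ) + 1) ^ ρ ≠ 0 := (Real.rpow_pos_of_pos hpos _).ne'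
  generalize (((l : ℝ) + 1) ^ r) ^ p.1 = A at *
  generalize ((l : ℝ) + 1) ^ ρ = B at *
  field_simp

/-- With k ~ y l^r, the monomial k^j l^α grows like y^j l^(rj+α). After division by l^ρ only the
points on the line rj + α = ρ survive. -/
theorem tendsto_wt_div {F : Filter ℕ} {κ ℓ : ℕ → ℕ} (hℓ : Tendsto ℓ F atTop) {r y ρ : ℝ}
    (hy : Tendsto (fun n => (κ n : ℝ) / ((ℓ n : ℝ) + 1) ^ r) F (𝓝 y)) {p : ℕ × ℕ}
    (hp : r * p.1 + p.2 ≤ ρ) :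
    Tendsto (fun n => wt p (κ n) (ℓ n) / ((ℓ n : ℝ) + 1) ^ ρ) F
      (𝓝 (if r * p.1 + p.2 = ρ then y ^ p.1 else 0)) := by
  have hinf : Tendsto (fun n => (ℓ n : ℝ) + 1) F atTop :=
    tendsto_atTop_add_const_right _ _ (tendsto_natCast_atTop_atTop.comp hℓ)
  simp only [wt_div_rpow_eq p _ _ r]
  split_ifs with hs
  · simpa [hs] using hy.pow p.1
  · have hlt : 0 < ρ - (r * p.1 + p.2) := by
      have := lt_of_le_of_ne hp hs
      linarith
    have := (hy.pow p.1).mul ((tendsto_rpow_neg_atTop hlt).comp hinf)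
    rw [mul_zero] at this
    simpa [Function.comp_def] using this

open Classical in
/-- If `k ~ y l^r` along a filter, the principal part of `L` on the side of slope `-r` vanishes
at `y`. -/
theorem sum_sidePts_eq_zero {F : Filter ℕ} [F.NeBot] (hF : F ≤ atTop) {κ ℓ : ℕ → ℕ}
    (hL : ∀ n, ‖L m c (κ n) (ℓ n)‖ ≤ 1 / ((n : ℝ) + 1) * phi m c (κ n) (ℓ n))
    (hℓ : Tendsto ℓ F atTop) {r y : ℝ} (hr : 0 ≤ r)
    (hy : Tendsto (fun n => (κ n : ℝ) / ((ℓ n : ℝ) + 1) ^ r) F (𝓝 y)) :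
    ∑ p ∈ sidePts m c r, c0 m c p * (y : ℂ) ^ p.1 = 0 := by
  obtain ⟨p₀, hp₀, hmax⟩ := Finset.exists_max_image (Lam0 m c) (fun p => r * p.1 + p.2)
    ⟨_, mem_Lam0_self⟩
  set ρ : ℝ := r * p₀.1 + p₀.2 with hρ
  have hmem : ∀ p ∈ Lam0 m c, (p ∈ sidePts m c r ↔ r * p.1 + p.2 = ρ) := by
    intro p hp
    rw [mem_sidePts hr]
    exact ⟨fun h => le_antisymm (hmax p hp) (h.2 _ hp₀),
      fun h => ⟨hp, fun q hq => (hmax q hq).trans_eq h.symm⟩⟩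
  have hpos : ∀ n, (0 : ℝ) < (ℓ n : ℝ) + 1 := fun n => by positivity
  have hlim := sum_limit_eq_zero hF hL (D := fun n => ((ℓ n : ℝ) + 1) ^ ρ)
    (fun n => Real.rpow_pos_of_pos (hpos n) _)
    (w := fun p => if p ∈ sidePts m c r then y ^ p.1 else 0) (θ := fun _ => 1) ?_
    (fun p _ => tendsto_descFactorial_div hℓ p.2)
  · rw [← Finset.sum_filter_add_sum_filter_not _ (fun p => p ∈ sidePts m c r)] at hlim
    have e : (Lam0 m c).filter (fun p => p ∈ sidePts m c r) = sidePts m c r := by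
      ext p
      rw [Finset.mem_filter, mem_sidePts hr]
      tauto
    rw [e, Finset.sum_eq_zero (s := (Lam0 m c).filter fun p => p ∉ sidePts m c r), add_zero] at hlim
    · rw [← hlim]
      refine Finset.sum_congr rfl fun p hp => ?_
      simp [hp]
    · intro p hp
      simp [(Finset.mem_filter.1 hp).2]
  · intro p hp
    simp only [hmem p hp]
    exact tendsto_wt_div hℓ hy (hmax p hp)

/-- If an ultrafilter contains no fibre of κ, it contains all their complements, and the values can
be discarded one by one. -/
theorem ultrafilter_eventually_eq_or_tendsto (F : Ultrafilter ℕ) (κ : ℕ → ℕ) :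
    (∃ k, ∀ᶠ n in F, κ n = k) ∨ Tendsto κ F atTop := by
  by_contra! h
  obtain ⟨h1, h2⟩ := h
  apply h2
  rw [tendsto_atTop]
  intro b
  induction b with
  | zero => simp
  | succ b ih =>
    filter_upwards [ih, h1 b] with n hn1 hn2
    omega

theorem sum_sidePts_eq_charPoly (r : ℝ) (y : ℂ) :
    ∑ p ∈ sidePts m c r, c0 m c p * y ^ p.1 = y ^ leftEnd m c r * (charPoly m c r).eval y := by
  rw [charPoly, Polynomial.eval_finsetSum, Finset.mul_sum]
  refine Finset.sum_congr rfl fun p hp => ?_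
  have hle : leftEnd m c r ≤ p.1 := Nat.sInf_le ⟨p, hp, rfl⟩
  simp only [Polynomial.eval_mul, Polynomial.eval_C, Polynomial.eval_pow, Polynomial.eval_X]
  rw [mul_left_comm, ← pow_add, Nat.add_sub_cancel' hle]

/-- If two distinct monomials are both comparable to phi while k and l tend to infinity, their ratio
has a positive limit. This forces k ~ y l^r with r, y > 0 and puts both points on the side of slope
-r, where y is then a positive root of the characteristic polynomial, against (GP). -/
theorem not_tendsto_wt_of_ne {F : Filter ℕ} [F.NeBot] (hF : F ≤ atTop) {κ ℓ : ℕ → ℕ}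
    (hκ1 : ∀ n, 1 ≤ κ n) (hκ : Tendsto κ F atTop) (hℓ : Tendsto ℓ F atTop)
    (hL : ∀ n, ‖L m c (κ n) (ℓ n)‖ ≤ 1 / ((n : ℝ) + 1) * phi m c (κ n) (ℓ n))
    (hGP : GenPoincare m c) {p q : ℕ × ℕ} (hp : p ∈ Lam0 m c) (hq : q ∈ Lam0 m c) (hne : p ≠ q)
    (hle : p.1 ≤ q.1) {a b : ℝ} (ha : 0 < a) (hb : 0 < b)
    (hwp : Tendsto (fun n => wt p (κ n) (ℓ n) / phi m c (κ n) (ℓ n)) F (𝓝 a))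
    (hwq : Tendsto (fun n => wt q (κ n) (ℓ n) / phi m c (κ n) (ℓ n)) F (𝓝 b)) : False := by
  have hκR : Tendsto (fun n => (κ n : ℝ)) F atTop := tendsto_natCast_atTop_atTop.comp hκ
  have hℓR : Tendsto (fun n => (ℓ n : ℝ) + 1) F atTop :=
    tendsto_atTop_add_const_right _ _ (tendsto_natCast_atTop_atTop.comp hℓ)
  have hκp : ∀ n, (1 : ℝ) ≤ κ n := fun n => by exact_mod_cast hκ1 n
  have hℓp : ∀ n, (1 : ℝ) ≤ (ℓ n : ℝ) + 1 := fun n => by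
    linarith [((ℓ n).cast_nonneg : (0 : ℝ) ≤ ℓ n)]
  have hdiv : ∀ x y : ℕ × ℕ, ∀ n, wt x (κ n) (ℓ n) / phi m c (κ n) (ℓ n) /
      (wt y (κ n) (ℓ n) / phi m c (κ n) (ℓ n)) = wt x (κ n) (ℓ n) / wt y (κ n) (ℓ n) :=
    fun x y n => div_div_div_cancel_right₀ (phi_pos (hκ1 n) _).ne' _ _
  have hqp : Tendsto (fun n => wt q (κ n) (ℓ n) / wt p (κ n) (ℓ n)) F (𝓝 (b / a)) :=
    (hwq.div hwp ha.ne').congr (hdiv q p)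
  have hpq : Tendsto (fun n => wt p (κ n) (ℓ n) / wt q (κ n) (ℓ n)) F (𝓝 (a / b)) :=
    (hwp.div hwq hb.ne').congr (hdiv p q)
  rcases le_or_gt p.2 q.2 with h2 | h2
  -- When q dominates p in both coordinates, the ratio is a nontrivial monomial and tends to
  -- infinity.
  · have e : ∀ n, wt q (κ n) (ℓ n) / wt p (κ n) (ℓ n) =
        (κ n : ℝ) ^ (q.1 - p.1) * ((ℓ n : ℝ) + 1) ^ (q.2 - p.2) := by
      intro n
      rw [div_eq_iff (wt_pos p (hκ1 n) _).ne', wt, wt, mul_mul_mul_comm, ← pow_add, ← pow_add,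
        Nat.sub_add_cancel hle, Nat.sub_add_cancel h2]
    rcases Nat.eq_zero_or_pos (q.1 - p.1) with h0 | h0
    · have h1 : q.2 - p.2 ≠ 0 := fun h => hne (Prod.ext (by omega) (by omega))
      refine not_tendsto_nhds_of_tendsto_atTop (tendsto_atTop_mono (fun n => ?_) hℓR) _ hqp
      rw [e, h0, pow_zero, one_mul]
      exact le_self_pow₀ (hℓp n) h1
    · refine not_tendsto_nhds_of_tendsto_atTop (tendsto_atTop_mono (fun n => ?_) hκR) _ hqp
      rw [e]
      exact (le_self_pow₀ (hκp n) h0.ne').trans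
        (le_mul_of_one_le_right (by positivity) (one_le_pow₀ (hℓp n)))
  rcases hle.eq_or_lt with h1 | h1
  · refine not_tendsto_nhds_of_tendsto_atTop (tendsto_atTop_mono (fun n => ?_) hℓR) _ hpq
    have e : wt p (κ n) (ℓ n) / wt q (κ n) (ℓ n) = ((ℓ n : ℝ) + 1) ^ (p.2 - q.2) := by
      rw [div_eq_iff (wt_pos q (hκ1 n) _).ne', wt, wt, h1, mul_left_comm, ← pow_add,
        Nat.sub_add_cancel h2.le]
    rw [e]
    exact le_self_pow₀ (hℓp n) (by omega)
  set Δ := q.1 - p.1 with hΔ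
  have hΔ0 : Δ ≠ 0 := by omega
  have hΔR : (0 : ℝ) < (Δ : ℝ) := by exact_mod_cast Nat.pos_of_ne_zero hΔ0
  -- The line through p and q has slope -r, and the ratio of the weights is the Δ-th power of
  -- k/(l+1)^r; this determines y below.
  set r : ℝ := ((p.2 - q.2 : ℕ) : ℝ) / (Δ : ℝ) with hr
  have hr0 : 0 < r := div_pos (by exact_mod_cast Nat.sub_pos_of_lt h2) hΔR
  set y : ℝ := (b / a) ^ (1 / (Δ : ℝ)) with hy
  have hy0 : 0 < y := Real.rpow_pos_of_pos (div_pos hb ha) _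
  have hlim : Tendsto (fun n => (κ n : ℝ) / ((ℓ n : ℝ) + 1) ^ r) F (𝓝 y) := by
    refine (hqp.rpow_const (p := 1 / (Δ : ℝ)) (Or.inr (by positivity))).congr fun n => ?_
    have hx : 0 < (κ n : ℝ) / ((ℓ n : ℝ) + 1) ^ r :=
      div_pos (by linarith [hκp n]) (Real.rpow_pos_of_pos (by linarith [hℓp n]) _)
    have e : wt q (κ n) (ℓ n) / wt p (κ n) (ℓ n) = ((κ n : ℝ) / ((ℓ n : ℝ) + 1) ^ r) ^ Δ := by
      rw [div_pow, ← Real.rpow_natCast (((ℓ n : ℝ) + 1) ^ r), ← Real.rpow_mul (by linarith [hℓp n]),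
        hr, div_mul_cancel₀ _ hΔR.ne', Real.rpow_natCast,
        div_eq_div_iff (wt_pos p (hκ1 n) _).ne' (by positivity), wt, wt]
      have e1 : (κ n : ℝ) ^ q.1 = (κ n : ℝ) ^ Δ * (κ n : ℝ) ^ p.1 := by
        rw [← pow_add, Nat.sub_add_cancel hle]
      have e2 : ((ℓ n : ℝ) + 1) ^ p.2 = ((ℓ n : ℝ) + 1) ^ (p.2 - q.2) * ((ℓ n : ℝ) + 1) ^ q.2 := by
        rw [← pow_add, Nat.sub_add_cancel h2.le]
      rw [e1, e2]
      ring
    rw [e, ← Real.rpow_natCast, ← Real.rpow_mul hx.le, mul_one_div, div_self hΔR.ne', Real.rpow_one]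
  -- A point of Λ_0 strictly above the line of slope -r through x would have a weight of larger
  -- order, and x would be negligible against phi.
  have hside : ∀ x ∈ Lam0 m c, ∀ d : ℝ, 0 < d →
      Tendsto (fun n => wt x (κ n) (ℓ n) / phi m c (κ n) (ℓ n)) F (𝓝 d) → x ∈ sidePts m c r := by
    intro x hx d hd hwx
    rw [mem_sidePts hr0.le]
    refine ⟨hx, fun x' hx' => le_of_not_gt fun hlt => ?_⟩
    have t1 := tendsto_wt_div hℓ hlim hlt.le
    have t2 := tendsto_wt_div hℓ hlim (le_refl (r * x'.1 + x'.2))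
    rw [if_neg hlt.ne] at t1
    rw [if_pos rfl] at t2
    have t3 := t1.div t2 (pow_pos hy0 _).ne'
    rw [zero_div] at t3
    have : d ≤ 0 := by
      refine le_of_tendsto_of_tendsto' hwx t3 fun n => ?_
      rw [Pi.div_apply, div_div_div_cancel_right₀ (Real.rpow_pos_of_pos (by linarith [hℓp n]) _).ne']
      exact div_le_div_of_nonneg_left (wt_nonneg _ _ _) (wt_pos _ (hκ1 n) _) (wt_le_phi hx' _ _)
    linarith
  classical
  have hps := hside p hp a ha hwp
  have hqs := hside q hq b hb hwq
  have hnt : (side m c r).Nontrivial := by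
    refine ⟨pt p, (Finset.mem_filter.1 hps).2, pt q, (Finset.mem_filter.1 hqs).2, fun h => ?_⟩
    rw [pt, pt, Prod.mk.injEq, Nat.cast_inj, Nat.cast_inj] at h
    exact hne (Prod.ext h.1 h.2)
  have h0 := sum_sidePts_eq_zero hF hL hℓ hr0.le hlim
  rw [sum_sidePts_eq_charPoly] at h0
  have hyc : (y : ℂ) ^ leftEnd m c r ≠ 0 := pow_ne_zero _ (by exact_mod_cast hy0.ne')
  exact hGP.1 r hr0 hnt y ((mul_eq_zero.1 h0).resolve_left hyc) y hy0.le rfl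

/-- Under the conditions (N) and (GP), `|L(k,l)|` is bounded below by a multiple of `phi`. -/
theorem exists_phi_le_norm_L (hN : NonResonant m c) (hGP : GenPoincare m c) :
    ∃ δ : ℝ, 0 < δ ∧ ∀ k l : ℕ, 1 ≤ k → δ * phi m c k l ≤ ‖L m c k l‖ := by
  classical
  by_contra! h
  choose κ ℓ hκ1 hlt using fun n : ℕ => h (1 / ((n : ℝ) + 1)) (by positivity)
  have hL := fun n => (hlt n).le
  -- A nonprincipal ultrafilter replaces successive extractions of subsequences: every bounded real
  -- sequence converges along it.
  set F : Ultrafilter ℕ := hyperfilter ℕ with hFdef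
  have hF : (F : Filter ℕ) ≤ atTop := Nat.hyperfilter_le_atTop
  rcases ultrafilter_eventually_eq_or_tendsto F ℓ with ⟨l, hl⟩ | hℓ
  · rcases ultrafilter_eventually_eq_or_tendsto F κ with ⟨k, hk⟩ | hκ
    · have t : Tendsto (fun n : ℕ => 1 / ((n : ℝ) + 1) * phi m c k l) F (𝓝 (0 * phi m c k l)) :=
        (tendsto_one_div_add_atTop_nhds_zero_nat.mono_left hF).mul tendsto_const_nhds
      have hle : ‖L m c k l‖ ≤ 0 * phi m c k l := by
        refine ge_of_tendsto t ?_
        filter_upwards [hl, hk] with n hn1 hn2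
        rw [← hn1, ← hn2]
        exact hL n
      obtain ⟨n, hn⟩ := hk.exists
      have hk1 : 1 ≤ k := hn ▸ hκ1 n
      rw [zero_mul] at hle
      exact hN k l hk1 (norm_le_zero_iff.1 hle)
    · have hκR : Tendsto (fun n => (κ n : ℝ)) F atTop := tendsto_natCast_atTop_atTop.comp hκ
      have hpos : ∀ n, (0 : ℝ) < κ n := fun n => by exact_mod_cast hκ1 n
      -- Here l is constant and k tends to infinity: only (m, 0) survives division by k^m, and its
      -- coefficient is -1.
      have h0 := sum_limit_eq_zero (F := F) hF hL (D := fun n => (κ n : ℝ) ^ m)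
        (fun n => pow_pos (hpos n) _) (w := fun p => if p = (m, 0) then 1 else 0)
        (θ := fun p => (l.descFactorial p.2 : ℝ) / ((l : ℝ) + 1) ^ p.2) ?_ ?_
      · rw [Finset.sum_eq_single_of_mem (m, 0) mem_Lam0_self] at h0
        · simp [c0] at h0
        · intro p _ hne
          simp [hne]
      · intro p hp
        by_cases hne : p = (m, 0)
        · subst hne
          refine tendsto_const_nhds.congr fun n => ?_
          rw [if_pos rfl, wt]
          simp [(hpos n).ne']
        · have hpm := lt_of_mem_Lam0 hp hne
          have t : Tendsto (fun n => ((l : ℝ) + 1) ^ p.2 * ((κ n : ℝ) ^ (m - p.1))⁻¹) F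
              (𝓝 (((l : ℝ) + 1) ^ p.2 * 0)) :=
            tendsto_const_nhds.mul (tendsto_inv_atTop_zero.comp
              ((tendsto_pow_atTop (by omega)).comp hκR))
          rw [mul_zero] at t
          rw [if_neg hne]
          refine t.congr' ?_
          filter_upwards [hl] with n hn
          have e : (κ n : ℝ) ^ m = (κ n : ℝ) ^ (m - p.1) * (κ n : ℝ) ^ p.1 := by
            rw [← pow_add, Nat.sub_add_cancel hpm.le]
          have := hpos n
          rw [wt, hn, e]
          field_simp
      · intro p _
        refine tendsto_const_nhds.congr' ?_
        filter_upwards [hl] with n hn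
        rw [hn]
  · rcases ultrafilter_eventually_eq_or_tendsto F κ with ⟨k, hk⟩ | hκ
    -- Here k is constant and l tends to infinity: slope 0 selects the horizontal half line, on
    -- which the integer k would be a root.
    · have h0 := sum_sidePts_eq_zero (F := F) hF hL hℓ le_rfl (y := k) (by
        refine tendsto_const_nhds.congr' ?_
        filter_upwards [hk] with n hn
        rw [hn, Real.rpow_zero, div_one])
      obtain ⟨n, hn⟩ := hk.exists
      have hk1 : 1 ≤ k := hn ▸ hκ1 n
      refine hGP.2 k ?_ k hk1 rfl
      rw [Polynomial.IsRoot, charPolyLast, Polynomial.eval_finsetSum, ← h0]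
      simp
    -- Both tend to infinity. The shares of the monomials in phi have limits of sum 1; if exactly
    -- one limit is nonzero, the limit of L/phi is a nonzero multiple of a nonzero coefficient.
    · have hex : ∀ p : ℕ × ℕ, ∃ w : ℝ, p ∈ Lam0 m c → 0 ≤ w ∧
          Tendsto (fun n => wt p (κ n) (ℓ n) / phi m c (κ n) (ℓ n)) F (𝓝 w) := by
        intro p
        by_cases hp : p ∈ Lam0 m c
        · obtain ⟨w, hw, hlim⟩ := (isCompact_Icc (a := (0 : ℝ)) (b := 1)).ultrafilter_le_nhds
            (F.map fun n : ℕ => wt p (κ n) (ℓ n) / phi m c (κ n) (ℓ n)) (by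
              rw [le_principal_iff]
              refine Ultrafilter.mem_map.2 (Filter.univ_mem' fun n => ?_)
              exact ⟨div_nonneg (wt_nonneg _ _ _) (phi_pos (hκ1 n) _).le,
                div_le_one_of_le₀ (wt_le_phi hp _ _) (phi_pos (hκ1 n) _).le⟩)
          exact ⟨w, fun _ => ⟨hw.1, hlim⟩⟩
        · exact ⟨0, fun h => absurd h hp⟩
      choose w hw using hex
      have hsum : ∑ p ∈ Lam0 m c, w p = 1 := by
        refine tendsto_nhds_unique (tendsto_finsetSum _ fun p hp => (hw p hp).2)
          (tendsto_const_nhds.congr fun n : ℕ => ?_)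
        rw [← Finset.sum_div]
        exact (div_self (phi_pos (hκ1 n) _).ne').symm
      have h0 := sum_limit_eq_zero (F := F) hF hL
        (D := fun n => phi m c (κ n) (ℓ n)) (fun n => phi_pos (hκ1 n) _)
        (fun p hp => (hw p hp).2) (fun p _ => tendsto_descFactorial_div hℓ p.2)
      obtain ⟨p, hp, hwp⟩ : ∃ p ∈ Lam0 m c, w p ≠ 0 :=
        Finset.exists_ne_zero_of_sum_ne_zero (by rw [hsum]; exact one_ne_zero)
      have hwp' : 0 < w p := lt_of_le_of_ne (hw p hp).1 hwp.symm
      have huniq : ∀ q ∈ Lam0 m c, q ≠ p → w q = 0 := by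
        intro q hq hne
        by_contra hwq
        have hwq' : 0 < w q := lt_of_le_of_ne (hw q hq).1 (Ne.symm hwq)
        rcases le_total p.1 q.1 with hle | hle
        · exact not_tendsto_wt_of_ne hF hκ1 hκ hℓ hL hGP hp hq hne.symm hle hwp' hwq'
            (hw p hp).2 (hw q hq).2
        · exact not_tendsto_wt_of_ne hF hκ1 hκ hℓ hL hGP hq hp hne hle hwq' hwp'
            (hw q hq).2 (hw p hp).2
      rw [Finset.sum_eq_single_of_mem p hp] at h0
      · rw [mul_one] at h0
        rcases mul_eq_zero.1 h0 with h1 | h1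
        · exact c0_ne_zero hp h1
        · exact hwp (by exact_mod_cast h1)
      · intro q hq hne
        rw [huniq q hq hne]
        simp

end TotChar

namespace TotChar

open Filter

variable {m : ℕ} {c : ℕ × ℕ → ℂ → ℂ}

/-! ### The irregularity -/

theorem bddAbove_sigma0_set : BddAbove (insert 1
    ((fun p => ((analyticOrderNatAt (c p) 0 : ℝ) + dist m c p) /
      (analyticOrderNatAt (c p) 0 : ℝ)) '' Lam1 m c)) := by
  have hfin : (Lam1 m c).Finite := (I m).finite_toSet.subset fun p hp => hp.1
  exact ((hfin.image _).insert 1).bddAbove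

theorem one_le_sigma0 : 1 ≤ sigma0 m c :=
  le_csSup bddAbove_sigma0_set (Set.mem_insert _ _)

/-- The definition of σ_0 solved for d_{j,α}; the order of vanishing is positive because c_{j,α}(0)
= 0. -/
theorem dist_le {p : ℕ × ℕ} (hp : p ∈ Lam1 m c) (hc : AnalyticAt ℂ (c p) 0) :
    dist m c p ≤ analyticOrderNatAt (c p) 0 * (sigma0 m c - 1) := by
  have hpos : 0 < analyticOrderNatAt (c p) 0 := by
    rw [Nat.pos_iff_ne_zero]
    intro h0
    have := Nat.cast_analyticOrderNatAt hp.2.2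
    rw [h0, Nat.cast_zero] at this
    exact hc.analyticOrderAt_eq_zero.1 this.symm hp.2.1
  have hpos' : (0 : ℝ) < analyticOrderNatAt (c p) 0 := by exact_mod_cast hpos
  have h := le_csSup (bddAbove_sigma0_set (m := m) (c := c))
    (Set.mem_insert_of_mem _ (Set.mem_image_of_mem _ hp))
  change _ ≤ sigma0 m c at h
  rw [div_le_iff₀ hpos'] at h
  linarith

theorem rpow_sub_dist_le_phi {p : ℕ × ℕ} (hp : p ∈ I m) {k : ℕ} (hk : 1 ≤ k) (l : ℕ) :
    (k : ℝ) ^ p.1 * ((l : ℝ) + 1) ^ ((p.2 : ℝ) - dist m c p) ≤ phi m c k l := by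
  have hk0 : (0 : ℝ) < k := by exact_mod_cast hk
  have hl0 : (0 : ℝ) < (l : ℝ) + 1 := by positivity
  have hl1 : (1 : ℝ) ≤ (l : ℝ) + 1 := by linarith [(l.cast_nonneg : (0 : ℝ) ≤ l)]
  have hne : {y : ℝ | ((p.1 : ℝ), (p.2 : ℝ) - y) ∈ newton m c}.Nonempty := by
    refine ⟨p.2, mem_newton mem_Lam0_self ?_ ?_⟩
    · simpa using (mem_I.1 hp).2.le
    · simp
  -- Letting ε tend to 0 avoids showing that the infimum defining the distance is attained.
  have key : ∀ ε : ℝ, 0 < ε →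
      (k : ℝ) ^ p.1 * ((l : ℝ) + 1) ^ ((p.2 : ℝ) - dist m c p - ε) ≤ phi m c k l := by
    intro ε hε
    obtain ⟨y, hy, hlt⟩ := exists_lt_of_csInf_lt hne (lt_add_of_pos_right (dist m c p) hε)
    refine le_trans ?_ (rpow_mul_rpow_le_phi hk l hy)
    rw [Real.rpow_natCast]
    refine mul_le_mul_of_nonneg_left ?_ (by positivity)
    exact Real.rpow_le_rpow_of_exponent_le hl1 (by linarith)
  have hcont : Continuous fun ε : ℝ =>
      (k : ℝ) ^ p.1 * ((l : ℝ) + 1) ^ ((p.2 : ℝ) - dist m c p - ε) :=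
    continuous_const.mul (Continuous.rpow continuous_const (by fun_prop) fun _ => Or.inl hl0.ne')
  have t := (hcont.tendsto 0).mono_left (nhdsWithin_le_nhds (s := Set.Ioi 0))
  rw [sub_zero] at t
  refine le_of_tendsto t ?_
  filter_upwards [self_mem_nhdsWithin] with ε hε using key ε hε

/-- The terms of positive order in `x` of the coefficients are dominated by `phi`, up to the
Gevrey weight of order `sigma0`. -/
theorem pow_mul_descFactorial_le_phi {p : ℕ × ℕ} (hp : p ∈ I m) (hc : AnalyticAt ℂ (c p) 0)
    {n : ℕ} (hn : taylorCoeff (c p) n ≠ 0) {k : ℕ} (hk : 1 ≤ k) (l : ℕ) :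
    (k : ℝ) ^ p.1 * (l.descFactorial p.2 : ℝ) * (l ! : ℝ) ^ (sigma0 m c - 1) ≤
      phi m c k (l + n) * ((l + n)! : ℝ) ^ (sigma0 m c - 1) := by
  classical
  have hσ : 0 ≤ sigma0 m c - 1 := sub_nonneg.2 one_le_sigma0
  have hl0 : (0 : ℝ) < (l : ℝ) + 1 := by positivity
  have hl1 : (1 : ℝ) ≤ (l : ℝ) + 1 := by linarith [(l.cast_nonneg : (0 : ℝ) ≤ l)]
  -- Passing from l to l + n the Gevrey weight gains (l+1)^(n(σ_0-1)), which covers the distance to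
  -- the polygon because n is at least the order of vanishing.
  have hfac : ((l : ℝ) + 1) ^ (n * (sigma0 m c - 1)) * (l ! : ℝ) ^ (sigma0 m c - 1) ≤
      ((l + n)! : ℝ) ^ (sigma0 m c - 1) := by
    rw [Real.rpow_mul hl0.le, Real.rpow_natCast, ← Real.mul_rpow (by positivity) (by positivity)]
    refine Real.rpow_le_rpow (by positivity) ?_ hσ
    rw [mul_comm]
    exact_mod_cast Nat.factorial_mul_pow_le_factorial
  have hdesc : (k : ℝ) ^ p.1 * (l.descFactorial p.2 : ℝ) ≤ wt p k l := by
    unfold wt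
    refine mul_le_mul_of_nonneg_left ?_ (by positivity)
    calc (l.descFactorial p.2 : ℝ) ≤ (l : ℝ) ^ p.2 := by exact_mod_cast Nat.descFactorial_le_pow _ _
      _ ≤ _ := by gcongr; linarith
  have hwt : wt p k l ≤ phi m c k l * ((l : ℝ) + 1) ^ (n * (sigma0 m c - 1)) := by
    by_cases h0 : c p 0 = 0
    · obtain ⟨htop, hle⟩ := analyticOrderNatAt_le_of_taylorCoeff_ne_zero hc hn
      have hd := dist_le (m := m) (c := c) ⟨hp, h0, htop⟩ hc
      have hd' : dist m c p ≤ n * (sigma0 m c - 1) := by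
        refine hd.trans ?_
        gcongr
      have e : wt p k l = (k : ℝ) ^ p.1 * ((l : ℝ) + 1) ^ ((p.2 : ℝ) - dist m c p) *
          ((l : ℝ) + 1) ^ dist m c p := by
        rw [mul_assoc, ← Real.rpow_add hl0, sub_add_cancel, Real.rpow_natCast, wt]
      rw [e]
      exact mul_le_mul (rpow_sub_dist_le_phi hp hk l)
        (Real.rpow_le_rpow_of_exponent_le hl1 hd') (Real.rpow_nonneg hl0.le _) (phi_pos hk l).le
    · have hmem : p ∈ Lam0 m c := Finset.mem_insert_of_mem (Finset.mem_filter.2 ⟨hp, h0⟩)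
      refine (wt_le_phi hmem k l).trans (le_mul_of_one_le_right (phi_pos hk l).le ?_)
      exact Real.one_le_rpow hl1 (by positivity)
  calc (k : ℝ) ^ p.1 * (l.descFactorial p.2 : ℝ) * (l ! : ℝ) ^ (sigma0 m c - 1)
      ≤ (phi m c k l * ((l : ℝ) + 1) ^ (n * (sigma0 m c - 1))) * (l ! : ℝ) ^ (sigma0 m c - 1) := by
        exact mul_le_mul_of_nonneg_right (hdesc.trans hwt) (by positivity)
    _ = phi m c k l * (((l : ℝ) + 1) ^ (n * (sigma0 m c - 1)) * (l ! : ℝ) ^ (sigma0 m c - 1)) := by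
        ring
    _ ≤ phi m c k (l + n) * ((l + n)! : ℝ) ^ (sigma0 m c - 1) := by
        refine mul_le_mul (phi_mono k (Nat.le_add_right _ _)) hfac (by positivity)
          (phi_pos hk _).le

end TotChar

namespace TotChar

/-! ### Bounds for products -/

/-- A bound for the coefficients of a series divisible by `t^q`; `μ` is the number of factors `x`
by which the series may be multiplied, and `θ μ` the resulting loss of powers of `k`. -/
def SeriesBound (D N : ℕ) (τ η r β : ℝ) (θ : ℕ → ℝ) (K : ℝ) (q : ℕ) (f : FormalTX) : Prop :=
  (∀ k l, k < q → cf f k l = 0) ∧ ∀ k l μ, q ≤ k →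
    ‖cf f k l‖ * r ^ l * β ^ k ≤ K * (k : ℝ) ^ (θ μ - N) * ((k + 1 - q)! : ℝ) ^ τ *
      ((l + μ)! : ℝ) ^ η * (Nat.multichoose (D * (4 * k - q)) (l + μ) : ℝ)

theorem sum_antidiagonal_mul_le {η A₁ A₂ : ℝ} (hη : 0 ≤ η) (hA₁ : 0 ≤ A₁) (hA₂ : 0 ≤ A₂)
    {E₁ E₂ μ : ℕ} {F₁ F₂ : ℕ → ℝ} (hF₂ : ∀ l, 0 ≤ F₂ l)
    (h₁ : ∀ l, F₁ l ≤ A₁ * ((l + μ)! : ℝ) ^ η * (Nat.multichoose E₁ (l + μ) : ℝ))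
    (h₂ : ∀ l, F₂ l ≤ A₂ * (l ! : ℝ) ^ η * (Nat.multichoose E₂ l : ℝ)) (l : ℕ) :
    ∑ y ∈ antidiagonal l, F₁ y.1 * F₂ y.2 ≤
      A₁ * A₂ * ((l + μ)! : ℝ) ^ η * (Nat.multichoose (E₁ + E₂) (l + μ) : ℝ) := by
  calc ∑ y ∈ antidiagonal l, F₁ y.1 * F₂ y.2
      ≤ ∑ y ∈ antidiagonal l, A₁ * A₂ * ((l + μ)! : ℝ) ^ η *
          ((Nat.multichoose E₁ (y.1 + μ) * Nat.multichoose E₂ y.2 : ℕ) : ℝ) := by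
        refine Finset.sum_le_sum fun y hy => ?_
        rw [Finset.HasAntidiagonal.mem_antidiagonal] at hy
        have hfac : ((y.1 + μ)! : ℝ) ^ η * (y.2 ! : ℝ) ^ η ≤ ((l + μ)! : ℝ) ^ η := by
          rw [← Real.mul_rpow (by positivity) (by positivity)]
          refine Real.rpow_le_rpow (by positivity) ?_ hη
          have := factorial_mul_factorial_le_add (y.1 + μ) y.2
          rw [show y.1 + μ + y.2 = l + μ by omega] at this
          exact_mod_cast this
        calc F₁ y.1 * F₂ y.2
            ≤ (A₁ * ((y.1 + μ)! : ℝ) ^ η * (Nat.multichoose E₁ (y.1 + μ) : ℝ)) *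
              (A₂ * (y.2 ! : ℝ) ^ η * (Nat.multichoose E₂ y.2 : ℝ)) :=
              mul_le_mul (h₁ _) (h₂ _) (hF₂ _) (by positivity)
          _ = A₁ * A₂ * (((y.1 + μ)! : ℝ) ^ η * (y.2 ! : ℝ) ^ η) *
              ((Nat.multichoose E₁ (y.1 + μ) * Nat.multichoose E₂ y.2 : ℕ) : ℝ) := by
              push_cast; ring
          _ ≤ _ := by gcongr
    _ ≤ _ := by
        rw [← Finset.mul_sum, ← Nat.cast_sum]
        refine mul_le_mul_of_nonneg_left ?_ (by positivity)
        exact_mod_cast sum_antidiagonal_multichoose_shift_le E₁ E₂ l μ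

/-- The larger index is at least half the sum and carries the power; the smaller one leaves a
summable inverse square. The exponent N is chosen for this purpose. -/
theorem rpow_mul_rpow_le {k₁ k₂ : ℕ} (h1 : 1 ≤ k₁) (h2 : 1 ≤ k₂) (hle : k₂ ≤ k₁) {N : ℕ} {a b : ℝ}
    (ha : 0 ≤ a) (haN : a ≤ N) (hb : b + 2 ≤ N) :
    (k₁ : ℝ) ^ (a - N) * (k₂ : ℝ) ^ (b - N) ≤
      2 ^ N * ((k₁ + k₂ : ℕ) : ℝ) ^ (a - N) * ((k₂ : ℝ) ^ 2)⁻¹ := by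
  have p1 : (1 : ℝ) ≤ k₁ := by exact_mod_cast h1
  have p2 : (1 : ℝ) ≤ k₂ := by exact_mod_cast h2
  have hle' : (k₂ : ℝ) ≤ k₁ := by exact_mod_cast hle
  have e1 : (k₁ : ℝ) ^ (a - N) ≤ 2 ^ N * ((k₁ + k₂ : ℕ) : ℝ) ^ (a - N) := by
    have hs : ((k₁ + k₂ : ℕ) : ℝ) / 2 ≤ k₁ := by push_cast; linarith
    have hs0 : (0 : ℝ) < ((k₁ + k₂ : ℕ) : ℝ) / 2 := by push_cast; linarith
    calc (k₁ : ℝ) ^ (a - N) ≤ (((k₁ + k₂ : ℕ) : ℝ) / 2) ^ (a - N) :=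
          Real.rpow_le_rpow_of_nonpos hs0 hs (by linarith)
      _ = (2 : ℝ) ^ (N - a) * ((k₁ + k₂ : ℕ) : ℝ) ^ (a - N) := by
          rw [Real.div_rpow (by positivity) (by norm_num), div_eq_mul_inv,
            ← Real.rpow_neg (by norm_num), neg_sub, mul_comm]
      _ ≤ _ := by
          refine mul_le_mul_of_nonneg_right ?_ (by positivity)
          rw [← Real.rpow_natCast]
          exact Real.rpow_le_rpow_of_exponent_le (by norm_num) (by linarith)
  have e2 : (k₂ : ℝ) ^ (b - N) ≤ ((k₂ : ℝ) ^ 2)⁻¹ := by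
    rw [← Real.rpow_natCast, ← Real.rpow_neg (by positivity)]
    refine Real.rpow_le_rpow_of_exponent_le p2 ?_
    push_cast
    linarith
  exact mul_le_mul e1 e2 (by positivity) (by positivity)

section

variable {D N : ℕ} {τ η r β : ℝ} {θ : ℕ → ℝ}

/-- In each term of the Cauchy product the factor of larger t-degree receives all of the shift μ and
the other is estimated with μ = 0. Hence the exponent θ μ is paid once and does not add up. The
constant is 2^N from comparing the indices times 4 from the inverse squares. -/
theorem SeriesBound.mul (hτ : 0 ≤ τ) (hη : 0 ≤ η) (hr : 0 ≤ r) (hβ : 0 ≤ β)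
    (hθ : ∀ μ, 0 ≤ θ μ) (hθN : ∀ μ, θ μ + 2 ≤ N) {K₁ K₂ : ℝ} (hK₁ : 0 ≤ K₁) (hK₂ : 0 ≤ K₂)
    {q₁ q₂ : ℕ} (hq₁ : 1 ≤ q₁) (hq₂ : 1 ≤ q₂) {f g : FormalTX}
    (hf : SeriesBound D N τ η r β θ K₁ q₁ f) (hg : SeriesBound D N τ η r β θ K₂ q₂ g) :
    SeriesBound D N τ η r β θ (K₁ * K₂ * 2 ^ (N + 2)) (q₁ + q₂) (f * g) := by
  have hzero : ∀ k₁ k₂ l₁ l₂, k₁ < q₁ ∨ k₂ < q₂ → cf f k₁ l₁ * cf g k₂ l₂ = 0 := by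
    rintro k₁ k₂ l₁ l₂ (h | h)
    · rw [hf.1 _ _ h, zero_mul]
    · rw [hg.1 _ _ h, mul_zero]
  refine ⟨fun k l hk => ?_, fun k l μ hk => ?_⟩
  · rw [cf_mul]
    refine Finset.sum_eq_zero fun x hx => Finset.sum_eq_zero fun y _ => hzero _ _ _ _ ?_
    rw [Finset.HasAntidiagonal.mem_antidiagonal] at hx
    omega
  set T : ℝ := ((k + 1 - (q₁ + q₂))! : ℝ) ^ τ * ((l + μ)! : ℝ) ^ η *
    (Nat.multichoose (D * (4 * k - (q₁ + q₂))) (l + μ) : ℝ) with hT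
  have hT0 : 0 ≤ T := by positivity
  have hN : ∀ μ, θ μ ≤ N := fun μ => by linarith [hθN μ]
  have main : ∀ x ∈ antidiagonal k,
      ∑ y ∈ antidiagonal l, ‖cf f x.1 y.1 * cf g x.2 y.2‖ * r ^ l * β ^ k ≤
        K₁ * K₂ * 2 ^ N * (k : ℝ) ^ (θ μ - N) * T *
          (((x.1 : ℝ) ^ 2)⁻¹ + ((x.2 : ℝ) ^ 2)⁻¹) := by
    rintro ⟨k₁, k₂⟩ hx
    rw [Finset.HasAntidiagonal.mem_antidiagonal] at hx
    simp only at hx ⊢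
    by_cases hsmall : k₁ < q₁ ∨ k₂ < q₂
    · rw [Finset.sum_eq_zero fun y _ => by rw [hzero _ _ _ _ hsmall]; simp]
      positivity
    push Not at hsmall
    obtain ⟨h1, h2⟩ := hsmall
    have hfac : ((k₁ + 1 - q₁)! : ℝ) ^ τ * ((k₂ + 1 - q₂)! : ℝ) ^ τ ≤
        ((k + 1 - (q₁ + q₂))! : ℝ) ^ τ := by
      rw [← Real.mul_rpow (by positivity) (by positivity)]
      refine Real.rpow_le_rpow (by positivity) ?_ hτ
      have := factorial_mul_factorial_le (a := k₁ + 1 - q₁) (b := k₂ + 1 - q₂) (by omega) (by omega)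
      rw [show k₁ + 1 - q₁ + (k₂ + 1 - q₂) - 1 = k + 1 - (q₁ + q₂) by omega] at this
      exact_mod_cast this
    have hE : D * (4 * k₁ - q₁) + D * (4 * k₂ - q₂) = D * (4 * k - (q₁ + q₂)) := by
      rw [← mul_add]
      congr 1
      omega
    have hinv1 : (0 : ℝ) ≤ ((k₁ : ℝ) ^ 2)⁻¹ := by positivity
    have hinv2 : (0 : ℝ) ≤ ((k₂ : ℝ) ^ 2)⁻¹ := by positivity
    rcases le_total k₂ k₁ with hle | hle
    · have hs := sum_antidiagonal_mul_le hη (A₁ := K₁ * (k₁ : ℝ) ^ (θ μ - N) * ((k₁ + 1 - q₁)! : ℝ) ^ τ)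
        (A₂ := K₂ * (k₂ : ℝ) ^ (θ 0 - N) * ((k₂ + 1 - q₂)! : ℝ) ^ τ) (by positivity) (by positivity)
        (E₁ := D * (4 * k₁ - q₁)) (E₂ := D * (4 * k₂ - q₂)) (μ := μ)
        (F₁ := fun l => ‖cf f k₁ l‖ * r ^ l * β ^ k₁) (F₂ := fun l => ‖cf g k₂ l‖ * r ^ l * β ^ k₂)
        (fun l => by positivity) (fun l => hf.2 k₁ l μ h1) (fun l => hg.2 k₂ l 0 h2) l
      have hpow := rpow_mul_rpow_le (by omega) (by omega) hle (hθ μ) (hN μ) (hθN 0)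
      rw [hx] at hpow
      calc ∑ y ∈ antidiagonal l, ‖cf f k₁ y.1 * cf g k₂ y.2‖ * r ^ l * β ^ k
          = ∑ y ∈ antidiagonal l, (‖cf f k₁ y.1‖ * r ^ y.1 * β ^ k₁) *
              (‖cf g k₂ y.2‖ * r ^ y.2 * β ^ k₂) := by
            refine Finset.sum_congr rfl fun y hy => ?_
            rw [Finset.HasAntidiagonal.mem_antidiagonal] at hy
            rw [← hx, ← hy, norm_mul, pow_add, pow_add]
            ring
        _ ≤ _ := hs
        _ = K₁ * K₂ * ((k₁ : ℝ) ^ (θ μ - N) * (k₂ : ℝ) ^ (θ 0 - N)) *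
            ((((k₁ + 1 - q₁)! : ℝ) ^ τ * ((k₂ + 1 - q₂)! : ℝ) ^ τ) * ((l + μ)! : ℝ) ^ η *
            (Nat.multichoose (D * (4 * k - (q₁ + q₂))) (l + μ) : ℝ)) := by rw [hE]; ring
        _ ≤ K₁ * K₂ * (2 ^ N * (k : ℝ) ^ (θ μ - N) * ((k₂ : ℝ) ^ 2)⁻¹) * T := by
            rw [hT]; gcongr
        _ = K₁ * K₂ * 2 ^ N * (k : ℝ) ^ (θ μ - N) * T * ((k₂ : ℝ) ^ 2)⁻¹ := by ring
        _ ≤ _ := by gcongr; linarith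
    · have hs := sum_antidiagonal_mul_le hη (A₁ := K₂ * (k₂ : ℝ) ^ (θ μ - N) * ((k₂ + 1 - q₂)! : ℝ) ^ τ)
        (A₂ := K₁ * (k₁ : ℝ) ^ (θ 0 - N) * ((k₁ + 1 - q₁)! : ℝ) ^ τ) (by positivity) (by positivity)
        (E₁ := D * (4 * k₂ - q₂)) (E₂ := D * (4 * k₁ - q₁)) (μ := μ)
        (F₁ := fun l => ‖cf g k₂ l‖ * r ^ l * β ^ k₂) (F₂ := fun l => ‖cf f k₁ l‖ * r ^ l * β ^ k₁)
        (fun l => by positivity) (fun l => hg.2 k₂ l μ h2) (fun l => hf.2 k₁ l 0 h1) l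
      have hpow := rpow_mul_rpow_le (by omega) (by omega) hle (hθ μ) (hN μ) (hθN 0)
      rw [add_comm, hx] at hpow
      calc ∑ y ∈ antidiagonal l, ‖cf f k₁ y.1 * cf g k₂ y.2‖ * r ^ l * β ^ k
          = ∑ y ∈ antidiagonal l, (‖cf g k₂ y.1‖ * r ^ y.1 * β ^ k₂) *
              (‖cf f k₁ y.2‖ * r ^ y.2 * β ^ k₁) := by
            rw [← Finset.Nat.sum_antidiagonal_swap]
            refine Finset.sum_congr rfl fun y hy => ?_
            rw [Finset.HasAntidiagonal.mem_antidiagonal] at hy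
            rw [← hx, ← hy, Prod.fst_swap, Prod.snd_swap, norm_mul, pow_add, pow_add]
            ring
        _ ≤ _ := hs
        _ = K₁ * K₂ * ((k₂ : ℝ) ^ (θ μ - N) * (k₁ : ℝ) ^ (θ 0 - N)) *
            ((((k₁ + 1 - q₁)! : ℝ) ^ τ * ((k₂ + 1 - q₂)! : ℝ) ^ τ) * ((l + μ)! : ℝ) ^ η *
            (Nat.multichoose (D * (4 * k - (q₁ + q₂))) (l + μ) : ℝ)) := by
            rw [add_comm (D * (4 * k₂ - q₂)), hE]; ring
        _ ≤ K₁ * K₂ * (2 ^ N * (k : ℝ) ^ (θ μ - N) * ((k₁ : ℝ) ^ 2)⁻¹) * T := by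
            rw [hT]; gcongr
        _ = K₁ * K₂ * 2 ^ N * (k : ℝ) ^ (θ μ - N) * T * ((k₁ : ℝ) ^ 2)⁻¹ := by ring
        _ ≤ _ := by gcongr; linarith
  calc ‖cf (f * g) k l‖ * r ^ l * β ^ k
      ≤ (∑ x ∈ antidiagonal k, ∑ y ∈ antidiagonal l, ‖cf f x.1 y.1 * cf g x.2 y.2‖) *
          r ^ l * β ^ k := by
        rw [cf_mul]
        gcongr
        exact norm_sum_le_of_le _ fun x _ => norm_sum_le _ _
    _ = ∑ x ∈ antidiagonal k, ∑ y ∈ antidiagonal l,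
          ‖cf f x.1 y.1 * cf g x.2 y.2‖ * r ^ l * β ^ k := by
        simp only [Finset.sum_mul]
    _ ≤ ∑ x ∈ antidiagonal k, K₁ * K₂ * 2 ^ N * (k : ℝ) ^ (θ μ - N) * T *
          (((x.1 : ℝ) ^ 2)⁻¹ + ((x.2 : ℝ) ^ 2)⁻¹) := Finset.sum_le_sum main
    _ ≤ K₁ * K₂ * 2 ^ N * (k : ℝ) ^ (θ μ - N) * T * 4 := by
        rw [← Finset.mul_sum]
        refine mul_le_mul_of_nonneg_left (sum_antidiagonal_inv_sq_le k) (by positivity)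
    _ = _ := by rw [hT]; ring

/-- The normalization by 2^(N+2) cancels the constant of each multiplication, so the bounds multiply
exactly. -/
theorem seriesBound_jetProd (hτ : 0 ≤ τ) (hη : 0 ≤ η) (hr : 0 ≤ r) (hβ : 0 ≤ β)
    (hθ : ∀ μ, 0 ≤ θ μ) (hθN : ∀ μ, θ μ + 2 ≤ N) {Q : ℝ} (hQ : 0 ≤ Q) {u : FormalTX}
    {s : Multiset (ℕ × ℕ)} (hs : s ≠ 0)
    (h : ∀ p ∈ s, SeriesBound D N τ η r β θ ((2 ^ (N + 2))⁻¹ * Q) 1 (jet u p)) :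
    SeriesBound D N τ η r β θ ((2 ^ (N + 2))⁻¹ * Q ^ Multiset.card s) (Multiset.card s)
      (jetProd u s) := by
  induction s using Multiset.induction_on with
  | empty => exact absurd rfl hs
  | cons p s ih =>
    by_cases hs0 : s = 0
    · subst hs0
      simpa [jetProd] using h p (Multiset.mem_cons_self _ _)
    have h1 := h p (Multiset.mem_cons_self _ _)
    have h2 := ih hs0 fun p' hp' => h p' (Multiset.mem_cons_of_mem hp')
    have h3 := SeriesBound.mul hτ hη hr hβ hθ hθN (by positivity) (by positivity) le_rfl
      (Multiset.card_pos.2 hs0) h1 h2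
    have e : ∀ S : ℝ, S ≠ 0 → S⁻¹ * Q * (S⁻¹ * Q ^ Multiset.card s) * S =
        S⁻¹ * Q ^ (1 + Multiset.card s) := by
      intro S hS
      rw [pow_add, pow_one]
      field_simp
    rw [e _ (by positivity)] at h3
    rw [jetProd, Multiset.map_cons, Multiset.prod_cons, Multiset.card_cons,
      add_comm (Multiset.card s)]
    exact h3

end

/-! ### Derivatives -/

theorem descFactorial_add_mul (l γ μ : ℕ) :
    (l + μ + γ).descFactorial (γ + μ) = (l + μ + γ).descFactorial γ * (l + μ).descFactorial μ := by
  rw [mul_comm, ← Nat.descFactorial_mul_descFactorial (Nat.le_add_right γ μ)]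
  congr 2 <;> omega

/-- The γ derivatives raise the parameter E by γ at the cost E^γ. What they take from the Gevrey
factorial, together with the other μ derivatives, is at most the power γη + μ of the index, absorbed
by raising the parameter further. The total rise is D, and since E is of order k every cost is a
power of k. -/
theorem descFactorial_weight_le {D : ℕ} {η : ℝ} (hη : 0 ≤ η) {γ μ l k : ℕ} (hk : 1 ≤ k)
    (hD : γ * (1 + η) + μ ≤ D) (hD1 : 1 ≤ D) :
    ((l + μ + γ).descFactorial (γ + μ) : ℝ) * ((l + μ + γ)! : ℝ) ^ η *
        (Nat.multichoose (D * (4 * k - 2)) (l + μ + γ) : ℝ) ≤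
      (D ! * 2 * (4 * D) ^ D : ℝ) * (k : ℝ) ^ (γ * (1 + η) + μ) * ((l + μ)! : ℝ) ^ η *
        (Nat.multichoose (D * (4 * k - 1)) (l + μ) : ℝ) := by
  set l' := l + μ with hl'
  set E := D * (4 * k - 2) with hE
  set q : ℝ := γ * η + μ with hq
  have hq0 : 0 ≤ q := by positivity
  have hγD : γ ≤ D := by
    have h1 : (γ : ℝ) ≤ γ * (1 + η) + μ := by
      have : 0 ≤ (γ : ℝ) * η := by positivity
      have : (0 : ℝ) ≤ μ := by positivity
      linarith
    exact_mod_cast h1.trans hD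
  have hE1 : 1 ≤ E := Nat.mul_pos hD1 (by omega)
  have hED : E + D = D * (4 * k - 1) := by
    rw [hE, ← Nat.mul_succ]
    congr 1
    omega
  have hEk : ((E + D : ℕ) : ℝ) ≤ 4 * D * k := by
    have : E + D ≤ 4 * D * k := by
      rw [hED, mul_comm 4 D, mul_assoc]
      exact Nat.mul_le_mul_left _ (by omega)
    exact_mod_cast this
  have hk1 : (1 : ℝ) ≤ k := by exact_mod_cast hk
  have hD1' : (1 : ℝ) ≤ D := by exact_mod_cast hD1
  have hQ : q ≤ ((D - γ : ℕ) : ℝ) := by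
    rw [Nat.cast_sub hγD]
    linarith
  have hbase : (0 : ℝ) ≤ ((l' + γ : ℕ) : ℝ) := by positivity
  have h1 : ((l' + γ).descFactorial (γ + μ) : ℝ) ≤
      ((l' + γ).descFactorial γ : ℝ) * ((l' + γ : ℕ) : ℝ) ^ μ := by
    rw [hl', descFactorial_add_mul, ← hl']
    have : (l'.descFactorial μ : ℝ) ≤ ((l' + γ : ℕ) : ℝ) ^ μ := by
      exact_mod_cast (Nat.descFactorial_le_pow _ _).trans
        (Nat.pow_le_pow_left (Nat.le_add_right _ _) _)
    push_cast at this ⊢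
    gcongr
  have h2 : ((l' + γ)! : ℝ) ^ η ≤ (l' ! : ℝ) ^ η * (((l' + γ : ℕ) : ℝ) ^ γ) ^ η := by
    rw [← Real.mul_rpow (by positivity) (by positivity)]
    refine Real.rpow_le_rpow (by positivity) ?_ hη
    have := Nat.factorial_mul_descFactorial (n := l' + γ) (k := γ) (Nat.le_add_left _ _)
    rw [Nat.add_sub_cancel] at this
    rw [← this]
    exact_mod_cast Nat.mul_le_mul_left _ (Nat.descFactorial_le_pow _ _)
  have h3 : (((l' + γ : ℕ) : ℝ) ^ γ) ^ η * ((l' + γ : ℕ) : ℝ) ^ μ ≤ ((E + γ + l' : ℕ) : ℝ) ^ q := by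
    have hpos : (0 : ℝ) < ((E + γ + l' : ℕ) : ℝ) := by exact_mod_cast (by omega)
    have hle : ((l' + γ : ℕ) : ℝ) ≤ ((E + γ + l' : ℕ) : ℝ) := by exact_mod_cast (by omega)
    rw [hq, Real.rpow_add hpos, Real.rpow_mul hpos.le, Real.rpow_natCast, Real.rpow_natCast]
    gcongr
  have h4 := descFactorial_mul_multichoose E l' γ
  have h4' : ((l' + γ).descFactorial γ : ℝ) * (Nat.multichoose E (l' + γ) : ℝ) ≤
      (D ! : ℝ) * (4 * D * k : ℝ) ^ γ * (Nat.multichoose (E + γ) l' : ℝ) := by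
    have : ((l' + γ).descFactorial γ : ℝ) * (Nat.multichoose E (l' + γ) : ℝ) =
        (E.ascFactorial γ : ℝ) * (Nat.multichoose (E + γ) l' : ℝ) := by exact_mod_cast h4
    rw [this]
    refine mul_le_mul_of_nonneg_right ?_ (by positivity)
    calc (E.ascFactorial γ : ℝ) ≤ (γ ! : ℝ) * (E : ℝ) ^ γ := by
          exact_mod_cast Nat.ascFactorial_le_factorial_mul_pow E γ
      _ ≤ (D ! : ℝ) * (4 * D * k : ℝ) ^ γ := by
          have hfac : (γ ! : ℝ) ≤ (D ! : ℝ) := by exact_mod_cast Nat.factorial_le hγD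
          have hEle : (E : ℝ) ≤ 4 * D * k := le_trans (by exact_mod_cast Nat.le_add_right E D) hEk
          gcongr
  have h5 := rpow_mul_multichoose_le (E := E + γ) (Q := D - γ) (by omega) hq0 hQ l'
  rw [show E + γ + (D - γ) = E + D by omega] at h5
  have h6 : ((E + D : ℕ) : ℝ) ^ q ≤ (4 * D * k : ℝ) ^ q := Real.rpow_le_rpow (by positivity) hEk hq0
  have h7 : (4 * D * k : ℝ) ^ γ * (4 * D * k : ℝ) ^ q ≤
      (4 * D : ℝ) ^ D * (k : ℝ) ^ (γ * (1 + η) + μ) := by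
    have h4D : (1 : ℝ) ≤ 4 * D := by linarith
    have hpos : (0 : ℝ) < 4 * D * k := by positivity
    rw [← Real.rpow_natCast, ← Real.rpow_add hpos, show (γ : ℝ) + q = γ * (1 + η) + μ by
      rw [hq]; ring, Real.mul_rpow (by positivity) (by positivity)]
    refine mul_le_mul_of_nonneg_right ?_ (by positivity)
    rw [← Real.rpow_natCast]
    exact Real.rpow_le_rpow_of_exponent_le h4D hD
  calc ((l' + γ).descFactorial (γ + μ) : ℝ) * ((l' + γ)! : ℝ) ^ η * (Nat.multichoose E (l' + γ) : ℝ)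
      ≤ (((l' + γ).descFactorial γ : ℝ) * ((l' + γ : ℕ) : ℝ) ^ μ) *
        ((l' ! : ℝ) ^ η * (((l' + γ : ℕ) : ℝ) ^ γ) ^ η) * (Nat.multichoose E (l' + γ) : ℝ) := by
        gcongr
    _ = (l' ! : ℝ) ^ η * ((((l' + γ : ℕ) : ℝ) ^ γ) ^ η * ((l' + γ : ℕ) : ℝ) ^ μ) *
        (((l' + γ).descFactorial γ : ℝ) * (Nat.multichoose E (l' + γ) : ℝ)) := by ring
    _ ≤ (l' ! : ℝ) ^ η * ((E + γ + l' : ℕ) : ℝ) ^ q *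
        ((D ! : ℝ) * (4 * D * k : ℝ) ^ γ * (Nat.multichoose (E + γ) l' : ℝ)) := by gcongr
    _ = (l' ! : ℝ) ^ η * (D ! : ℝ) * (4 * D * k : ℝ) ^ γ *
        (((E + γ + l' : ℕ) : ℝ) ^ q * (Nat.multichoose (E + γ) l' : ℝ)) := by ring
    _ ≤ (l' ! : ℝ) ^ η * (D ! : ℝ) * (4 * D * k : ℝ) ^ γ *
        (2 * (4 * D * k : ℝ) ^ q * (Nat.multichoose (E + D) l' : ℝ)) := by
        refine mul_le_mul_of_nonneg_left (h5.trans ?_) (by positivity)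
        gcongr
    _ = (D ! : ℝ) * 2 * ((4 * D * k : ℝ) ^ γ * (4 * D * k : ℝ) ^ q) * (l' ! : ℝ) ^ η *
        (Nat.multichoose (E + D) l' : ℝ) := by ring
    _ ≤ (D ! : ℝ) * 2 * ((4 * D : ℝ) ^ D * (k : ℝ) ^ (γ * (1 + η) + μ)) * (l' ! : ℝ) ^ η *
        (Nat.multichoose (E + D) l' : ℝ) := by gcongr
    _ = _ := by rw [hED]; ring

/-- The loss caused by `∂_x^α` on Gevrey weights, after multiplication by `x^μ`. -/
theorem descFactorial_weight_shift_le {D : ℕ} {η : ℝ} (hη : 0 ≤ η) {α l k : ℕ} (μ : ℕ) (hk : 1 ≤ k)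
    (hD : α * (1 + η) ≤ D) (hD1 : 1 ≤ D) :
    ((l + α).descFactorial α : ℝ) * ((l + α)! : ℝ) ^ η *
        (Nat.multichoose (D * (4 * k - 2)) (l + α) : ℝ) ≤
      (D ! * 2 * (4 * D) ^ D : ℝ) * (k : ℝ) ^ max (α : ℝ) (μ + (1 + η) * ((α : ℝ) - μ)) *
        ((l + μ)! : ℝ) ^ η * (Nat.multichoose (D * (4 * k - 1)) (l + μ) : ℝ) := by
  have hk1 : (1 : ℝ) ≤ k := by exact_mod_cast hk
  have hα : (0 : ℝ) ≤ α * η := by positivity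
  rcases le_total μ α with h | h
  -- Multiplication by x^μ undoes the index shift of μ derivatives, so only γ = α - μ of them pay
  -- the Gevrey rate 1 + η.
  · obtain ⟨γ, rfl⟩ := Nat.exists_eq_add_of_le h
    have hμ : (0 : ℝ) ≤ μ * η := by positivity
    push_cast at hD
    have h1 := descFactorial_weight_le hη (l := l) (γ := γ) (μ := μ) hk (D := D) (by linarith) hD1
    rw [show l + (μ + γ) = l + μ + γ by ring, add_comm μ γ]
    refine h1.trans ?_
    gcongr
    refine le_trans (le_of_eq ?_) (le_max_right _ _)
    push_cast
    ring
  -- For α ≤ μ no derivative touches the Gevrey factorial and the loss is k^α.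
  · have h1 := descFactorial_weight_le hη (l := l) (γ := 0) (μ := α) hk (D := D)
      (by push_cast; linarith) hD1
    simp only [add_zero, zero_add, Nat.cast_zero, zero_mul] at h1
    refine h1.trans ?_
    have hE : 1 ≤ D * (4 * k - 1) := Nat.mul_pos hD1 (by omega)
    have hm : (Nat.multichoose (D * (4 * k - 1)) (l + α) : ℝ) ≤
        (Nat.multichoose (D * (4 * k - 1)) (l + μ) : ℝ) := by
      exact_mod_cast multichoose_mono_right hE (by omega)
    have hf : ((l + α)! : ℝ) ≤ ((l + μ)! : ℝ) := by exact_mod_cast Nat.factorial_le (by omega)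
    gcongr
    exact le_max_left _ _

/-- The majorant for the coefficients of the solution. -/
noncomputable def major (D N : ℕ) (τ η : ℝ) (k l : ℕ) : ℝ :=
  ((k : ℝ) ^ N)⁻¹ * (k ! : ℝ) ^ τ * (l ! : ℝ) ^ η * (Nat.multichoose (D * (4 * k - 2)) l : ℝ)

/-- Differentiation moves the parameter from D(4k-2) to D(4k-1), the value for q = 1 in
`SeriesBound`. The factor r^(-D) covers the shift of the x-degree. -/
theorem seriesBound_jet {D N : ℕ} {τ η r β A : ℝ} {θ : ℕ → ℝ} (hη : 0 ≤ η) (hr : 0 < r)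
    (hr1 : r ≤ 1) (hβ : 0 ≤ β) (hA : 0 ≤ A) (hD1 : 1 ≤ D) {u : FormalTX} (hu0 : ∀ l, cf u 0 l = 0)
    (hu : ∀ k l, 1 ≤ k → ‖cf u k l‖ * r ^ l * β ^ k ≤ A * major D N τ η k l) {p : ℕ × ℕ}
    (hD : p.2 * (1 + η) ≤ D)
    (hθ : ∀ μ : ℕ, (p.1 : ℝ) + max (p.2 : ℝ) (μ + (1 + η) * ((p.2 : ℝ) - μ)) ≤ θ μ) :
    SeriesBound D N τ η r β θ (A * ((D ! * 2 * (4 * D) ^ D : ℝ) * (r ^ D)⁻¹)) 1 (jet u p) := by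
  refine ⟨fun k l hk => ?_, fun k l μ hk => ?_⟩
  · obtain rfl : k = 0 := by omega
    rw [cf_jet, hu0, mul_zero]
  have hk1 : (1 : ℝ) ≤ k := by exact_mod_cast hk
  have hk0 : (0 : ℝ) < k := by linarith
  have h1 := hu k (l + p.2) hk
  have h2 := descFactorial_weight_shift_le hη (l := l) μ hk hD hD1
  have hpD : p.2 ≤ D := by
    have : (p.2 : ℝ) ≤ p.2 * (1 + η) := le_mul_of_one_le_right (by positivity) (by linarith)
    exact_mod_cast this.trans hD
  have hrD : (r ^ p.2)⁻¹ ≤ (r ^ D)⁻¹ := by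
    gcongr 1
    exact pow_le_pow_of_le_one hr.le hr1 hpD
  set e : ℝ := max (p.2 : ℝ) (μ + (1 + η) * ((p.2 : ℝ) - μ)) with he
  set b : ℝ := (Nat.multichoose (D * (4 * k - 1)) (l + μ) : ℝ) with hb
  have hkpow : (k : ℝ) ^ p.1 * ((k : ℝ) ^ N)⁻¹ * (k : ℝ) ^ e ≤ (k : ℝ) ^ (θ μ - N) := by
    rw [← Real.rpow_natCast, ← Real.rpow_natCast, ← Real.rpow_neg hk0.le, ← Real.rpow_add hk0,
      ← Real.rpow_add hk0]
    exact Real.rpow_le_rpow_of_exponent_le hk1 (by linarith [hθ μ])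
  have hrr : r ^ l = r ^ (l + p.2) * (r ^ p.2)⁻¹ := by
    rw [pow_add, mul_assoc, mul_inv_cancel₀ (pow_pos hr _).ne', mul_one]
  rw [cf_jet, norm_mul, norm_mul, norm_pow, Complex.norm_natCast, Complex.norm_natCast, hrr]
  calc (k : ℝ) ^ p.1 * ((l + p.2).descFactorial p.2 : ℝ) * ‖cf u k (l + p.2)‖ *
        (r ^ (l + p.2) * (r ^ p.2)⁻¹) * β ^ k
      = (k : ℝ) ^ p.1 * ((l + p.2).descFactorial p.2 : ℝ) * (r ^ p.2)⁻¹ *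
        (‖cf u k (l + p.2)‖ * r ^ (l + p.2) * β ^ k) := by ring
    _ ≤ (k : ℝ) ^ p.1 * ((l + p.2).descFactorial p.2 : ℝ) * (r ^ D)⁻¹ *
        (A * major D N τ η k (l + p.2)) := by gcongr
    _ = A * (r ^ D)⁻¹ * (k : ℝ) ^ p.1 * ((k : ℝ) ^ N)⁻¹ * (k ! : ℝ) ^ τ *
        (((l + p.2).descFactorial p.2 : ℝ) * ((l + p.2)! : ℝ) ^ η *
        (Nat.multichoose (D * (4 * k - 2)) (l + p.2) : ℝ)) := by rw [major]; ring
    _ ≤ A * (r ^ D)⁻¹ * (k : ℝ) ^ p.1 * ((k : ℝ) ^ N)⁻¹ * (k ! : ℝ) ^ τ *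
        ((D ! * 2 * (4 * D) ^ D : ℝ) * (k : ℝ) ^ e * ((l + μ)! : ℝ) ^ η * b) := by gcongr
    _ = A * ((D ! * 2 * (4 * D) ^ D : ℝ) * (r ^ D)⁻¹) *
        ((k : ℝ) ^ p.1 * ((k : ℝ) ^ N)⁻¹ * (k : ℝ) ^ e) * (k ! : ℝ) ^ τ * ((l + μ)! : ℝ) ^ η * b := by
        ring
    _ ≤ A * ((D ! * 2 * (4 * D) ^ D : ℝ) * (r ^ D)⁻¹) *
        (k : ℝ) ^ (θ μ - N) * (k ! : ℝ) ^ τ * ((l + μ)! : ℝ) ^ η * b := by gcongr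
    _ = _ := by rw [Nat.add_sub_cancel]

end TotChar

namespace TotChar

/-! ### Bounds for the composition -/

variable {M : Finset (ℕ × ℕ)}

theorem le_mNu {σ : ℝ} {ν : M →₀ ℕ} {q : M} (hq : 0 < ν q) (μ : ℕ) :
    (q.1.1 : ℝ) + max (q.1.2 : ℝ) (μ + σ * ((q.1.2 : ℝ) - μ)) ≤ mNu σ ν μ :=
  le_csSup (Set.toFinite _).bddAbove ⟨q, hq, rfl⟩

theorem mNu_le {σ B : ℝ} (hσ : 1 ≤ σ) {ν : M →₀ ℕ} (hν : ν ≠ 0) (μ : ℕ)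
    (hB : ∀ p ∈ M, (p.1 : ℝ) + σ * p.2 ≤ B) : mNu σ ν μ ≤ B := by
  obtain ⟨q, hq⟩ := DFunLike.ne_iff.1 hν
  refine csSup_le ⟨_, q, Nat.pos_of_ne_zero hq, rfl⟩ ?_
  rintro _ ⟨p, _, rfl⟩
  refine le_trans ?_ (hB p p.2)
  have h1 : (0 : ℝ) ≤ p.1.2 := by positivity
  have h2 : (0 : ℝ) ≤ μ := by positivity
  have : max (p.1.2 : ℝ) (μ + σ * ((p.1.2 : ℝ) - μ)) ≤ σ * p.1.2 :=
    max_le (by nlinarith) (by nlinarith)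
  simp only
  linarith

theorem mNu_nonneg {σ : ℝ} {ν : M →₀ ℕ} (hν : ν ≠ 0) (μ : ℕ) : 0 ≤ mNu σ ν μ := by
  obtain ⟨q, hq⟩ := DFunLike.ne_iff.1 hν
  refine le_trans ?_ (le_mNu (Nat.pos_of_ne_zero hq) μ)
  have h1 : (0 : ℝ) ≤ q.1.2 := by positivity
  have := h1.trans (le_max_left (q.1.2 : ℝ) (μ + σ * ((q.1.2 : ℝ) - μ)))
  positivity

theorem pow_le_factorial_mul_exp (k N : ℕ) : (k : ℝ) ^ N ≤ N ! * Real.exp k := by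
  have := Real.pow_div_factorial_le_exp (x := k) (by positivity) N
  rwa [div_le_iff₀ (by positivity), mul_comm] at this

theorem major_nonneg (D N : ℕ) (τ η : ℝ) (k l : ℕ) : 0 ≤ major D N τ η k l := by
  unfold major; positivity

theorem inv_pow_le_major {D N : ℕ} {τ η : ℝ} (hτ : 0 ≤ τ) (hη : 0 ≤ η) (hD : 1 ≤ D) {k : ℕ}
    (hk : 1 ≤ k) (l : ℕ) : ((k : ℝ) ^ N)⁻¹ ≤ major D N τ η k l := by
  have h1 : (1 : ℝ) ≤ (k ! : ℝ) ^ τ :=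
    Real.one_le_rpow (by exact_mod_cast Nat.factorial_pos k) hτ
  have h2 : (1 : ℝ) ≤ (l ! : ℝ) ^ η :=
    Real.one_le_rpow (by exact_mod_cast Nat.factorial_pos l) hη
  have h3 : (1 : ℝ) ≤ (Nat.multichoose (D * (4 * k - 2)) l : ℝ) := by
    exact_mod_cast one_le_multichoose (Nat.mul_pos hD (by omega)) l
  have h0 : (0 : ℝ) ≤ ((k : ℝ) ^ N)⁻¹ := by positivity
  unfold major
  calc ((k : ℝ) ^ N)⁻¹ = ((k : ℝ) ^ N)⁻¹ * 1 * 1 * 1 := by ring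
    _ ≤ _ := by gcongr

/-- The loss of a power `k^e` with `e - m ≤ τ (n - 1)` is compensated by the Gevrey weights. -/
theorem rpow_mul_factorial_le {k n m : ℕ} {τ e : ℝ} (hτ : 0 ≤ τ) (hk : 1 ≤ k) (hn : 1 ≤ n)
    (hnk : n ≤ k) (he : e - m ≤ τ * ((n : ℝ) - 1)) :
    (k : ℝ) ^ e * ((k - (n - 1))! : ℝ) ^ τ ≤ (k : ℝ) ^ m * (k ! : ℝ) ^ τ * Real.exp τ ^ n := by
  have hk1 : (1 : ℝ) ≤ k := by exact_mod_cast hk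
  have hk0 : (0 : ℝ) < k := by linarith
  have h1 : (k : ℝ) ^ e ≤ (k : ℝ) ^ m * ((k : ℝ) ^ (n - 1)) ^ τ := by
    rw [← Real.rpow_natCast, ← Real.rpow_natCast (k : ℝ) (n - 1), ← Real.rpow_mul hk0.le,
      ← Real.rpow_add hk0, Nat.cast_sub hn]
    refine Real.rpow_le_rpow_of_exponent_le hk1 ?_
    push_cast
    linarith
  have h2 := pow_mul_factorial_sub_le (k := k) (q := n - 1) (by omega)
  have h3 : ((k : ℝ) ^ (n - 1)) ^ τ * ((k - (n - 1))! : ℝ) ^ τ ≤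
      Real.exp τ ^ n * (k ! : ℝ) ^ τ := by
    rw [← Real.mul_rpow (by positivity) (by positivity)]
    refine (Real.rpow_le_rpow (by positivity) h2 hτ).trans ?_
    rw [Real.mul_rpow (by positivity) (by positivity)]
    refine mul_le_mul_of_nonneg_right ?_ (by positivity)
    rw [← Real.exp_nat_mul, ← Real.exp_mul, ← Real.exp_nat_mul]
    refine Real.exp_le_exp.2 ?_
    have : ((n - 1 : ℕ) : ℝ) ≤ n := by exact_mod_cast Nat.sub_le _ _
    nlinarith
  calc (k : ℝ) ^ e * ((k - (n - 1))! : ℝ) ^ τ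
      ≤ ((k : ℝ) ^ m * ((k : ℝ) ^ (n - 1)) ^ τ) * ((k - (n - 1))! : ℝ) ^ τ := by gcongr
    _ = (k : ℝ) ^ m * (((k : ℝ) ^ (n - 1)) ^ τ * ((k - (n - 1))! : ℝ) ^ τ) := by ring
    _ ≤ (k : ℝ) ^ m * (Real.exp τ ^ n * (k ! : ℝ) ^ τ) := by gcongr
    _ = _ := by ring

/-- Since k' + i ≤ (1+i) k', replacing k' by k' + i under a nonpositive exponent costs at most
(1+i)^N; bounding this by an exponential makes it geometric in i. -/
theorem rpow_sub_le_of_add {k' i N : ℕ} (hk' : 1 ≤ k') {e : ℝ} (he0 : 0 ≤ e) (heN : e ≤ N) :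
    (k' : ℝ) ^ (e - N) ≤ N ! * Real.exp (1 + i) * ((k' + i : ℕ) : ℝ) ^ (e - N) := by
  have p1 : (1 : ℝ) ≤ k' := by exact_mod_cast hk'
  have hi : (0 : ℝ) ≤ i := by positivity
  have hpos : (0 : ℝ) < ((k' + i : ℕ) : ℝ) / (1 + i : ℝ) := by push_cast; positivity
  have hle : ((k' + i : ℕ) : ℝ) / (1 + i : ℝ) ≤ k' := by
    rw [div_le_iff₀ (by positivity)]
    push_cast
    nlinarith
  calc (k' : ℝ) ^ (e - N) ≤ (((k' + i : ℕ) : ℝ) / (1 + i : ℝ)) ^ (e - N) :=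
        Real.rpow_le_rpow_of_nonpos hpos hle (by linarith)
    _ = (1 + i : ℝ) ^ (N - e) * ((k' + i : ℕ) : ℝ) ^ (e - N) := by
        rw [Real.div_rpow (by positivity) (by positivity), div_eq_mul_inv,
          ← Real.rpow_neg (by positivity), neg_sub, mul_comm]
    _ ≤ _ := by
        refine mul_le_mul_of_nonneg_right ?_ (by positivity)
        have h1 : (1 + i : ℝ) ^ (N - e) ≤ (1 + i : ℝ) ^ N := by
          rw [← Real.rpow_natCast]
          exact Real.rpow_le_rpow_of_exponent_le (by linarith) (by linarith)
        refine h1.trans ?_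
        have := pow_le_factorial_mul_exp (1 + i) N
        push_cast at this
        exact this

/-- The growth constant in the bound for the monomials. -/
noncomputable def growth (D N : ℕ) (τ r : ℝ) : ℝ :=
  (2 ^ (N + 2) * ((D ! * 2 * (4 * D) ^ D : ℝ) * (r ^ D)⁻¹)) * (N ! * Real.exp 2 * Real.exp τ)

theorem one_le_growthFactor (N : ℕ) {D : ℕ} {r : ℝ} (hD : 1 ≤ D) (hr : 0 < r) (hr1 : r ≤ 1) :
    1 ≤ 2 ^ (N + 2) * ((D ! * 2 * (4 * D) ^ D : ℝ) * (r ^ D)⁻¹) := by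
  have hD' : (1 : ℝ) ≤ D := by exact_mod_cast hD
  refine one_le_mul_of_one_le_of_one_le (one_le_pow₀ (by norm_num)) ?_
  refine one_le_mul_of_one_le_of_one_le ?_ ((one_le_inv₀ (pow_pos hr _)).2 (pow_le_one₀ hr.le hr1))
  refine one_le_mul_of_one_le_of_one_le ?_ (one_le_pow₀ (by linarith))
  have : (1 : ℝ) ≤ D ! := by exact_mod_cast Nat.factorial_pos D
  linarith

theorem growth_pos (N : ℕ) {D : ℕ} {τ r : ℝ} (hD : 1 ≤ D) (hr : 0 < r) (hr1 : r ≤ 1) :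
    0 < growth D N τ r := by
  have := one_le_growthFactor N hD hr hr1
  unfold growth
  positivity

/-- With n = i + |ν|, the t-shift by i and the product of |ν| jets leave the factorial (k-(n-1))!,
whose deficit pays for the part of k^e, e = m_{ν,μ}, exceeding k^m. The parameter returns to D(4k-2)
because 4i + |ν| ≥ 2. The powers of ε combine to at most ε^n, each t counting ε² and each jet ε. -/
theorem norm_cf_jetMonomial_le {m D N : ℕ} {τ η r ε : ℝ} (hτ : 0 ≤ τ) (hη : 0 ≤ η) (hr : 0 < r)
    (hr1 : r ≤ 1) (hε : 0 < ε) (hε1 : ε ≤ 1) (hD1 : 1 ≤ D)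
    (hD : ∀ p ∈ M, (p.2 : ℝ) * (1 + η) ≤ D) (hN : ∀ p ∈ M, (p.1 : ℝ) + (1 + η) * p.2 + 2 ≤ N)
    {u : FormalTX} (hu0 : ∀ l, cf u 0 l = 0)
    (hu : ∀ k l, 1 ≤ k → ‖cf u k l‖ * r ^ l * (ε ^ 2) ^ k ≤ ε * major D N τ η k l)
    {i μ : ℕ} {ν : M →₀ ℕ} (hn : 2 ≤ i + ν.degree)
    (hτν : 1 ≤ ν.degree → mNu (1 + η) ν μ - m ≤ τ * ((i : ℝ) + (ν.degree : ℝ) - 1)) {k l : ℕ}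
    (hk : 1 ≤ k) :
    ‖cf (jetMonomial u (expo i μ ν)) k l‖ * r ^ l * (ε ^ 2) ^ k ≤
      (growth D N τ r * ε) ^ (i + ν.degree) * r ^ μ * ((k : ℝ) ^ m * major D N τ η k l) := by
  have hgrow := growth_pos (τ := τ) N hD1 hr hr1
  have hmaj := major_nonneg D N τ η k l
  have hrhs : 0 ≤ (growth D N τ r * ε) ^ (i + ν.degree) * r ^ μ *
      ((k : ℝ) ^ m * major D N τ η k l) := by positivity
  have hk1 : (1 : ℝ) ≤ k := by exact_mod_cast hk
  rw [jetMonomial, prod_expo, cf_X_zero_pow_mul, cf_X_one_pow_mul]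
  split_ifs with hik hμl
  rotate_left
  · simpa using hrhs
  · simpa using hrhs
  obtain ⟨k', rfl⟩ := Nat.exists_eq_add_of_le' hik
  obtain ⟨l', rfl⟩ := Nat.exists_eq_add_of_le' hμl
  rw [Nat.add_sub_cancel, Nat.add_sub_cancel]
  set q := ν.degree with hq
  set Q₀ : ℝ := 2 ^ (N + 2) * ((D ! * 2 * (4 * D) ^ D : ℝ) * (r ^ D)⁻¹) with hQ₀
  have hQ₀1 : 1 ≤ Q₀ := one_le_growthFactor N hD1 hr hr1
  have hfacN : (1 : ℝ) ≤ N ! := by exact_mod_cast Nat.factorial_pos N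
  have hconst : ∀ x : ℝ, x ≤ 2 * ((i + q : ℕ) : ℝ) → ∀ j, j ≤ i + q →
      ε ^ q * Q₀ ^ q * (N ! * Real.exp x) * Real.exp τ ^ j * (ε ^ 2) ^ i ≤
        (growth D N τ r * ε) ^ (i + q) := by
    intro x hx j hj
    have e1 : ε ^ q * (ε ^ 2) ^ i ≤ ε ^ (i + q) := by
      rw [← pow_mul, ← pow_add]
      exact pow_le_pow_of_le_one hε.le hε1 (by omega)
    have e2 : Q₀ ^ q ≤ Q₀ ^ (i + q) := pow_le_pow_right₀ hQ₀1 (by omega)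
    have e3 : (N ! : ℝ) ≤ (N ! : ℝ) ^ (i + q) := le_self_pow₀ hfacN (by omega)
    have e4 : Real.exp x ≤ Real.exp 2 ^ (i + q) := by
      rw [← Real.exp_nat_mul]
      exact Real.exp_le_exp.2 (by linarith)
    have e5 : Real.exp τ ^ j ≤ Real.exp τ ^ (i + q) := pow_le_pow_right₀ (Real.one_le_exp hτ) hj
    calc ε ^ q * Q₀ ^ q * (N ! * Real.exp x) * Real.exp τ ^ j * (ε ^ 2) ^ i
        = (ε ^ q * (ε ^ 2) ^ i) * Q₀ ^ q * (N ! * Real.exp x) * Real.exp τ ^ j := by ring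
      _ ≤ ε ^ (i + q) * Q₀ ^ (i + q) * ((N ! : ℝ) ^ (i + q) * Real.exp 2 ^ (i + q)) *
          Real.exp τ ^ (i + q) := by gcongr
      _ = _ := by rw [growth, ← hQ₀]; simp only [mul_pow]; ring
  -- The bare monomial t^i x^μ has a single coefficient, and the majorant is at least k^(-N) there.
  by_cases hν : ν = 0
  · have hq0 : q = 0 := by rw [hq, hν, map_zero]
    have hprod : jetProd u (indices ν) = 1 := by rw [hν]; simp [jetProd, indices]
    rw [hprod, cf_one]
    split_ifs with h0
    swap
    · simpa using hrhs
    obtain ⟨rfl, rfl⟩ := h0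
    have h1 := inv_pow_le_major (N := N) hτ hη hD1 hk (0 + μ)
    have h2 := pow_le_factorial_mul_exp (0 + i) N
    have h3 := hconst ((0 + i : ℕ) : ℝ) (by rw [hq0]; push_cast; linarith [(i.cast_nonneg : (0:ℝ) ≤ i)])
      0 (Nat.zero_le _)
    have hkN : (0 : ℝ) < ((0 + i : ℕ) : ℝ) ^ N := by positivity
    have hkm : (1 : ℝ) ≤ ((0 + i : ℕ) : ℝ) ^ m := one_le_pow₀ hk1
    rw [hq0] at h3 ⊢
    simp only [pow_zero, mul_one, one_mul, norm_one] at h3 ⊢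
    have h4 : (ε ^ 2) ^ i ≤ (growth D N τ r * ε) ^ (i + 0) * (((0 + i : ℕ) : ℝ) ^ N)⁻¹ := by
      rw [← div_eq_mul_inv, le_div_iff₀ hkN]
      refine le_trans ?_ h3
      rw [mul_comm]
      gcongr
    rw [zero_add] at h4 ⊢
    simp only [zero_add] at h1 h4 hkm ⊢
    calc r ^ μ * (ε ^ 2) ^ i
        ≤ r ^ μ * ((growth D N τ r * ε) ^ (i + 0) * ((i : ℝ) ^ N)⁻¹) := by gcongr
      _ ≤ r ^ μ * ((growth D N τ r * ε) ^ (i + 0) * (1 * major D N τ η i μ)) := by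
          rw [one_mul]
          gcongr
      _ ≤ r ^ μ * ((growth D N τ r * ε) ^ (i + 0) * ((i : ℝ) ^ m * major D N τ η i μ)) := by
          simp only [zero_add] at hmaj
          gcongr
      _ = _ := by ring
  have hq1 : 1 ≤ q := by
    rw [hq, Nat.one_le_iff_ne_zero]
    exact fun h => hν ((Finsupp.degree_eq_zero_iff ν).1 h)
  have hσ : (1 : ℝ) ≤ 1 + η := by linarith
  have hθN : ∀ μ, mNu (1 + η) ν μ + 2 ≤ N := fun μ => by
    have := mNu_le (B := N - 2) hσ hν μ fun p hp => by linarith [hN p hp]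
    linarith
  have hind : indices ν ≠ 0 := by
    rw [← Multiset.card_pos, card_indices]
    exact hq1
  have hSB := seriesBound_jetProd (D := D) (r := r) (β := ε ^ 2) hτ hη hr.le (by positivity)
    (fun μ => mNu_nonneg (σ := 1 + η) hν μ) hθN (Q := ε * Q₀) (by positivity) (u := u) hind (by
      intro p hp
      obtain ⟨p', rfl, hp'⟩ := mem_indices hp
      have := seriesBound_jet (τ := τ) (θ := mNu (1 + η) ν) hη hr hr1 (by positivity) hε.le hD1 hu0
        hu (hD p' p'.2) fun μ => le_mNu hp' μ
      have e : (2 ^ (N + 2))⁻¹ * (ε * Q₀) = ε * ((D ! * 2 * (4 * D) ^ D : ℝ) * (r ^ D)⁻¹) := by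
        have h2 : (2 : ℝ) ^ (N + 2) ≠ 0 := by positivity
        rw [hQ₀]
        generalize (2 : ℝ) ^ (N + 2) = S at *
        field_simp
      rw [e]
      exact this)
  rw [card_indices, ← hq] at hSB
  by_cases hqk : k' < q
  · rw [hSB.1 _ _ hqk]
    simpa using hrhs
  push Not at hqk
  have h1 := hSB.2 k' l' μ hqk
  set e : ℝ := mNu (1 + η) ν μ with he
  have ha := rpow_sub_le_of_add (k' := k') (i := i) (N := N) (by omega) (mNu_nonneg hν μ)
    (e := e) (by linarith [hθN μ])
  have hb : ((k' + i : ℕ) : ℝ) ^ (e - N) * ((k' + 1 - q)! : ℝ) ^ τ ≤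
      (((k' + i : ℕ) : ℝ) ^ N)⁻¹ * (((k' + i : ℕ) : ℝ) ^ m * ((k' + i)! : ℝ) ^ τ *
        Real.exp τ ^ (i + q)) := by
    have := rpow_mul_factorial_le (k := k' + i) (n := i + q) (m := m) (e := e) hτ (by omega) (by omega)
      (by omega) (by push_cast; exact hτν hq1)
    rw [show k' + i - (i + q - 1) = k' + 1 - q by omega] at this
    rw [Real.rpow_sub (by linarith), Real.rpow_natCast, div_eq_inv_mul, mul_assoc]
    gcongr
  have hc : (Nat.multichoose (D * (4 * k' - q)) (l' + μ) : ℝ) ≤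
      (Nat.multichoose (D * (4 * (k' + i) - 2)) (l' + μ) : ℝ) := by
    exact_mod_cast multichoose_mono_left (Nat.mul_le_mul_left _ (by omega)) _
  have hS : (2 ^ (N + 2) : ℝ)⁻¹ * (ε * Q₀) ^ q ≤ ε ^ q * Q₀ ^ q := by
    rw [mul_pow]
    exact mul_le_of_le_one_left (by positivity) (inv_le_one_of_one_le₀ (one_le_pow₀ (by norm_num)))
  have h3 := hconst (1 + i) (by
    have : 1 + i ≤ 2 * (i + q) := by omega
    exact_mod_cast this) (i + q) le_rfl
  calc ‖cf (jetProd u (indices ν)) k' l'‖ * r ^ (l' + μ) * (ε ^ 2) ^ (k' + i)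
      = (‖cf (jetProd u (indices ν)) k' l'‖ * r ^ l' * (ε ^ 2) ^ k') * (r ^ μ * (ε ^ 2) ^ i) := by
        rw [pow_add, pow_add]; ring
    _ ≤ (((2 ^ (N + 2))⁻¹ * (ε * Q₀) ^ q) * (k' : ℝ) ^ (e - N) * ((k' + 1 - q)! : ℝ) ^ τ *
          ((l' + μ)! : ℝ) ^ η * (Nat.multichoose (D * (4 * k' - q)) (l' + μ) : ℝ)) *
          (r ^ μ * (ε ^ 2) ^ i) := by gcongr
    _ ≤ ((ε ^ q * Q₀ ^ q) * (N ! * Real.exp (1 + i) * ((k' + i : ℕ) : ℝ) ^ (e - N)) *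
          ((k' + 1 - q)! : ℝ) ^ τ * ((l' + μ)! : ℝ) ^ η *
          (Nat.multichoose (D * (4 * (k' + i) - 2)) (l' + μ) : ℝ)) * (r ^ μ * (ε ^ 2) ^ i) := by
        gcongr
    _ = (ε ^ q * Q₀ ^ q * (N ! * Real.exp (1 + i))) *
          (((k' + i : ℕ) : ℝ) ^ (e - N) * ((k' + 1 - q)! : ℝ) ^ τ) * ((l' + μ)! : ℝ) ^ η *
          (Nat.multichoose (D * (4 * (k' + i) - 2)) (l' + μ) : ℝ) * (r ^ μ * (ε ^ 2) ^ i) := by ring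
    _ ≤ (ε ^ q * Q₀ ^ q * (N ! * Real.exp (1 + i))) *
          ((((k' + i : ℕ) : ℝ) ^ N)⁻¹ * (((k' + i : ℕ) : ℝ) ^ m * ((k' + i)! : ℝ) ^ τ *
          Real.exp τ ^ (i + q))) * ((l' + μ)! : ℝ) ^ η *
          (Nat.multichoose (D * (4 * (k' + i) - 2)) (l' + μ) : ℝ) * (r ^ μ * (ε ^ 2) ^ i) := by
        gcongr
    _ = (ε ^ q * Q₀ ^ q * (N ! * Real.exp (1 + i)) * Real.exp τ ^ (i + q) * (ε ^ 2) ^ i) * r ^ μ *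
          (((k' + i : ℕ) : ℝ) ^ m * major D N τ η (k' + i) (l' + μ)) := by rw [major]; ring
    _ ≤ _ := by gcongr

end TotChar

namespace TotChar

open Filter

variable {M : Finset (ℕ × ℕ)}

/-- Every monomial has order at least two in (t, z), so its bound contains ε²: one factor ε matches
the majorant and the other supplies the small constant δ. -/
theorem norm_cf_compose_le_major {m D N : ℕ} {τ η r ε ρ H δ : ℝ} (hτ : 0 ≤ τ) (hη : 0 ≤ η)
    (hr : 0 < r) (hr1 : r ≤ 1) (hε : 0 < ε) (hε1 : ε ≤ 1) (hD1 : 1 ≤ D) (hδ : 0 ≤ δ)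
    (hD : ∀ p ∈ M, (p.2 : ℝ) * (1 + η) ≤ D) (hN : ∀ p ∈ M, (p.1 : ℝ) + (1 + η) * p.2 + 2 ≤ N)
    {G : (Vars M → ℂ) → ℂ} (hG : OrderAtLeastTwo G)
    (hH : ∀ S : Finset (Vars M →₀ ℕ),
      ∑ d ∈ S, ‖MvPowerSeries.coeff d (taylorSeries G)‖ * ρ ^ d.degree ≤ H)
    (hrρ : r ≤ ρ) (hε2 : growth D N τ r * ε ≤ ρ) (hε3 : growth D N τ r ^ 2 * ε ≤ δ * ρ ^ 2)
    (hslope : ∀ (i μ : ℕ) (ν : M →₀ ℕ), gCoeff G i ν μ ≠ 0 → 2 ≤ i + ν.degree → 1 ≤ ν.degree →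
      mNu (1 + η) ν μ - m ≤ τ * ((i : ℝ) + (ν.degree : ℝ) - 1))
    {u : FormalTX} (hu0 : ∀ l, cf u 0 l = 0)
    (hu : ∀ k l, 1 ≤ k → ‖cf u k l‖ * r ^ l * (ε ^ 2) ^ k ≤ ε * major D N τ η k l) {k : ℕ}
    (hk : 1 ≤ k) (l : ℕ) :
    ‖cf (compose G u) k l‖ * r ^ l * (ε ^ 2) ^ k ≤
      H * (δ * ε * ((k : ℝ) ^ m * major D N τ η k l)) := by
  have hgrow := growth_pos (τ := τ) N hD1 hr hr1
  set V : ℝ := (k : ℝ) ^ m * major D N τ η k l with hV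
  have hV0 : 0 ≤ V := mul_nonneg (by positivity) (major_nonneg _ _ _ _ _ _)
  set w : ℝ := r ^ l * (ε ^ 2) ^ k with hw
  have hw0 : 0 < w := by positivity
  have hρ : 0 < ρ := hr.trans_le hrρ
  have key : ∀ d : Vars M →₀ ℕ,
      ‖MvPowerSeries.coeff d (taylorSeries G) * cf (jetMonomial u d) k l‖ ≤
        ‖MvPowerSeries.coeff d (taylorSeries G)‖ * ρ ^ d.degree * (δ * ε * V / w) := by
    intro d
    obtain ⟨i, μ, ν, rfl⟩ := exists_eq_expo d
    by_cases h0 : MvPowerSeries.coeff (expo i μ ν) (taylorSeries G) = 0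
    · rw [h0]; simp
    have hn : 2 ≤ i + ν.degree := by
      by_contra hlt
      exact h0 (hG i ν (by omega) μ)
    have h1 := norm_cf_jetMonomial_le (m := m) hτ hη hr hr1 hε hε1 hD1 hD hN hu0 hu hn
      (hslope i μ ν h0 hn) (l := l) hk
    have h2 : (growth D N τ r * ε) ^ (i + ν.degree) ≤ δ * ε * ρ ^ (i + ν.degree) := by
      obtain ⟨n, hn'⟩ := Nat.exists_eq_add_of_le hn
      rw [hn', pow_add, pow_add]
      calc (growth D N τ r * ε) ^ 2 * (growth D N τ r * ε) ^ n
          = (growth D N τ r ^ 2 * ε) * ε * (growth D N τ r * ε) ^ n := by ring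
        _ ≤ (δ * ρ ^ 2) * ε * ρ ^ n := by gcongr
        _ = _ := by ring
    have h3 : r ^ μ ≤ ρ ^ μ := pow_le_pow_left₀ hr.le hrρ _
    rw [norm_mul, mul_assoc]
    refine mul_le_mul_of_nonneg_left ?_ (norm_nonneg _)
    rw [← mul_div_assoc, le_div_iff₀ hw0, hw, ← mul_assoc]
    refine h1.trans ?_
    rw [degree_expo]
    calc (growth D N τ r * ε) ^ (i + ν.degree) * r ^ μ * V
        ≤ (δ * ε * ρ ^ (i + ν.degree)) * ρ ^ μ * V := by gcongr
      _ = _ := by rw [show i + μ + ν.degree = i + ν.degree + μ by ring, pow_add]; ring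
  have hX : 0 ≤ δ * ε * V / w := by positivity
  have := norm_cf_compose_le (vanishesAtTZero_iff.2 hu0) key (H := H * (δ * ε * V / w)) fun S => by
    rw [← Finset.sum_mul]
    exact mul_le_mul_of_nonneg_right (hH S) hX
  rw [mul_assoc, ← hw]
  calc ‖cf (compose G u) k l‖ * w ≤ H * (δ * ε * V / w) * w := by gcongr
    _ = _ := by field_simp

/-! ### The linear part -/

theorem exists_sum_norm_taylorCoeff_le {c : ℕ × ℕ → ℂ → ℂ} (s : Finset (ℕ × ℕ))
    (hc : ∀ p ∈ s, AnalyticAt ℂ (c p) 0) :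
    ∃ H R : ℝ, 0 ≤ H ∧ 0 ≤ R ∧ ∀ n, ∑ p ∈ s, ‖taylorCoeff (c p) n‖ ≤ H * R ^ n := by
  classical
  induction s using Finset.induction_on with
  | empty => exact ⟨0, 0, le_rfl, le_rfl, by simp⟩
  | insert p s hp ih =>
    obtain ⟨H, R, hH, hR, h⟩ := ih fun q hq => hc q (Finset.mem_insert_of_mem hq)
    obtain ⟨H', R', hH', hR', h'⟩ := norm_taylorCoeff_le (hc p (Finset.mem_insert_self _ _))
    refine ⟨H' + H, max R' R, by positivity, le_max_of_le_left hR'.le, fun n => ?_⟩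
    rw [Finset.sum_insert hp, add_mul]
    refine add_le_add ((h' n).trans ?_) ((h n).trans ?_)
    · gcongr; exact le_max_left _ _
    · gcongr; exact le_max_right _ _

theorem sum_range_pow_sub_le {x : ℝ} (hx0 : 0 ≤ x) (hx : x ≤ 1 / 2) (l : ℕ) :
    ∑ n ∈ Finset.range l, x ^ (l - n) ≤ 2 * x := by
  induction l with
  | zero => simpa using hx0
  | succ l ih =>
    rw [Finset.sum_range_succ]
    have : ∑ n ∈ Finset.range l, x ^ (l + 1 - n) = x * ∑ n ∈ Finset.range l, x ^ (l - n) := by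
      rw [Finset.mul_sum]
      refine Finset.sum_congr rfl fun n hn => ?_
      rw [← pow_succ', Nat.sub_add_comm (Finset.mem_range.1 hn).le]
    rw [this, Nat.add_sub_cancel_left, pow_one]
    nlinarith

/-- The Taylor coefficient of x^(l-n) brings (Rr)^(l-n) with l - n ≥ 1, and these sum to at most
2Rr. So the contribution is a fraction of phi as small as desired, on choosing r. -/
theorem norm_lowerPart_le {m : ℕ} {c : ℕ × ℕ → ℂ → ℂ} (hc : ∀ p ∈ I m, AnalyticAt ℂ (c p) 0)
    {H R r κ B : ℝ} (hH0 : 0 ≤ H) (hR : 0 ≤ R) (hH : ∀ n, ∑ p ∈ I m, ‖taylorCoeff (c p) n‖ ≤ H * R ^ n)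
    (hr : 0 < r) (hRr : R * r ≤ 1 / 2) (hκ : 0 ≤ κ) (hB : 0 ≤ B) {E k l : ℕ} (hE : 1 ≤ E)
    (hk : 1 ≤ k) {w : ℕ → ℂ}
    (hw : ∀ n < l, ‖w n‖ * r ^ n * κ ≤ B * (n ! : ℝ) ^ (sigma0 m c - 1) * Nat.multichoose E n) :
    ‖lowerPart m c k l w‖ * r ^ l * κ ≤ H * (2 * (R * r)) *
      (phi m c k l * (B * (l ! : ℝ) ^ (sigma0 m c - 1) * Nat.multichoose E l)) := by
  set X : ℝ := phi m c k l * (B * (l ! : ℝ) ^ (sigma0 m c - 1) * Nat.multichoose E l) with hX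
  have hX0 : 0 ≤ X := mul_nonneg (phi_pos hk l).le (by positivity)
  have hterm : ∀ n ∈ Finset.range l, ∀ p ∈ I m,
      ‖taylorCoeff (c p) (l - n) * ((k : ℂ) ^ p.1 * ((n.descFactorial p.2 : ℕ) : ℂ) * w n)‖ *
        (r ^ l * κ) ≤ ‖taylorCoeff (c p) (l - n)‖ * (r ^ (l - n) * X) := by
    intro n hn p hp
    have hnl := Finset.mem_range.1 hn
    by_cases h0 : taylorCoeff (c p) (l - n) = 0
    · simp [h0]
    have h1 := pow_mul_descFactorial_le_phi hp (hc p hp) h0 hk n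
    rw [Nat.add_sub_cancel' hnl.le] at h1
    have hb : (Nat.multichoose E n : ℝ) ≤ Nat.multichoose E l := by
      exact_mod_cast multichoose_mono_right hE hnl.le
    rw [norm_mul, norm_mul, norm_mul, norm_pow, Complex.norm_natCast, Complex.norm_natCast, mul_assoc]
    refine mul_le_mul_of_nonneg_left ?_ (norm_nonneg _)
    have hrl : r ^ l = r ^ (l - n) * r ^ n := by rw [← pow_add, Nat.sub_add_cancel hnl.le]
    calc (k : ℝ) ^ p.1 * (n.descFactorial p.2 : ℝ) * ‖w n‖ * (r ^ l * κ)
        = r ^ (l - n) * ((k : ℝ) ^ p.1 * (n.descFactorial p.2 : ℝ)) * (‖w n‖ * r ^ n * κ) := by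
          rw [hrl]; ring
      _ ≤ r ^ (l - n) * ((k : ℝ) ^ p.1 * (n.descFactorial p.2 : ℝ)) *
          (B * (n ! : ℝ) ^ (sigma0 m c - 1) * Nat.multichoose E n) :=
          mul_le_mul_of_nonneg_left (hw n hnl) (by positivity)
      _ = r ^ (l - n) * (((k : ℝ) ^ p.1 * (n.descFactorial p.2 : ℝ) *
          (n ! : ℝ) ^ (sigma0 m c - 1)) * (B * Nat.multichoose E n)) := by ring
      _ ≤ r ^ (l - n) * ((phi m c k l * (l ! : ℝ) ^ (sigma0 m c - 1)) *
          (B * Nat.multichoose E l)) := by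
          refine mul_le_mul_of_nonneg_left ?_ (by positivity)
          have := (phi_pos (m := m) (c := c) hk l).le
          exact mul_le_mul h1 (mul_le_mul_of_nonneg_left hb hB) (by positivity) (by positivity)
      _ = _ := by rw [hX]; ring
  calc ‖lowerPart m c k l w‖ * r ^ l * κ
      ≤ (∑ n ∈ Finset.range l, ∑ p ∈ I m,
          ‖taylorCoeff (c p) (l - n) * ((k : ℂ) ^ p.1 * ((n.descFactorial p.2 : ℕ) : ℂ) * w n)‖) *
          (r ^ l * κ) := by
        rw [mul_assoc]
        refine mul_le_mul_of_nonneg_right ?_ (by positivity)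
        exact norm_sum_le_of_le _ fun n _ => norm_sum_le _ _
    _ = ∑ n ∈ Finset.range l, ∑ p ∈ I m,
          ‖taylorCoeff (c p) (l - n) * ((k : ℂ) ^ p.1 * ((n.descFactorial p.2 : ℕ) : ℂ) * w n)‖ *
          (r ^ l * κ) := by simp only [Finset.sum_mul]
    _ ≤ ∑ n ∈ Finset.range l, ∑ p ∈ I m, ‖taylorCoeff (c p) (l - n)‖ * (r ^ (l - n) * X) :=
        Finset.sum_le_sum fun n hn => Finset.sum_le_sum fun p hp => hterm n hn p hp
    _ ≤ ∑ n ∈ Finset.range l, H * X * (R * r) ^ (l - n) := by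
        refine Finset.sum_le_sum fun n _ => ?_
        rw [← Finset.sum_mul]
        refine (mul_le_mul_of_nonneg_right (hH _) (by positivity)).trans_eq ?_
        rw [mul_pow]; ring
    _ = H * X * ∑ n ∈ Finset.range l, (R * r) ^ (l - n) := by rw [Finset.mul_sum]
    _ ≤ H * X * (2 * (R * r)) :=
        mul_le_mul_of_nonneg_left (sum_range_pow_sub_le (by positivity) hRr l) (by positivity)
    _ = _ := by ring

/-! ### The Gevrey index in `t` -/

theorem exists_nat_forall_le (s : Finset (ℕ × ℕ)) (f : ℕ × ℕ → ℝ) :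
    ∃ n : ℕ, 1 ≤ n ∧ ∀ p ∈ s, f p ≤ n := by
  classical
  obtain ⟨B, hB⟩ := (s.image f).exists_le
  obtain ⟨n, hn⟩ := exists_nat_ge B
  refine ⟨n + 1, by omega, fun p hp => ?_⟩
  have := hB _ (Finset.mem_image_of_mem f hp)
  push_cast
  linarith

/-- The m_{ν,μ} are bounded uniformly in μ because σ ≥ 1, and the denominators are at least 1.
Without boundedness the real supremum would be a default value and carry no information. -/
theorem bddAbove_s0_set {m : ℕ} {σ : ℝ} (hσ : 1 ≤ σ) (G : (Vars M → ℂ) → ℂ) :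
    BddAbove (insert 0 (slopes m σ G)) := by
  obtain ⟨B, -, hB⟩ := exists_nat_forall_le M fun p => (p.1 : ℝ) + σ * p.2
  refine ⟨B, ?_⟩
  rintro y (rfl | ⟨μ, q, ⟨h1, h2, -⟩, rfl⟩)
  · positivity
  have hν : q.2 ≠ 0 := by
    intro h
    rw [h, map_zero] at h2
    omega
  have h3 := mNu_le hσ hν μ hB
  have h4 : (2 : ℝ) ≤ (q.1 : ℝ) + (q.2.degree : ℝ) := by exact_mod_cast h1
  rw [div_le_iff₀ (by linarith)]
  have : (0 : ℝ) ≤ m := by positivity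
  have : (0 : ℝ) ≤ B := by positivity
  nlinarith

theorem one_le_s0 (m : ℕ) (c : ℕ × ℕ → ℂ → ℂ) (G : (Vars M → ℂ) → ℂ) : 1 ≤ s0 m c G :=
  le_add_of_nonneg_right (le_csSup (bddAbove_s0_set one_le_sigma0 G) (Set.mem_insert _ _))

theorem mNu_sub_le {m : ℕ} {c : ℕ × ℕ → ℂ → ℂ} {G : (Vars M → ℂ) → ℂ} {i μ : ℕ} {ν : M →₀ ℕ}
    (hg : gCoeff G i ν μ ≠ 0) (h2 : 2 ≤ i + ν.degree) (h1 : 1 ≤ ν.degree) :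
    mNu (sigma0 m c) ν μ - m ≤ (s0 m c G - 1) * ((i : ℝ) + (ν.degree : ℝ) - 1) := by
  have h3 : (2 : ℝ) ≤ (i : ℝ) + (ν.degree : ℝ) := by exact_mod_cast h2
  have hmem : (mNu (sigma0 m c) ν μ - m) / ((i : ℝ) + (ν.degree : ℝ) - 1) ∈
      slopes m (sigma0 m c) G := ⟨μ, (i, ν), ⟨h2, h1, hg⟩, rfl⟩
  have := le_csSup (bddAbove_s0_set (m := m) (one_le_sigma0 (m := m) (c := c)) G)
    (Set.mem_insert_of_mem 0 hmem)
  rw [div_le_iff₀ (by linarith)] at this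
  rw [s0, add_sub_cancel_left]
  exact this

/-! ### The estimate of the solution -/

theorem eventually_mul_le (a : ℝ) {b : ℝ} (hb : 0 < b) : ∀ᶠ x in 𝓝[>] (0 : ℝ), a * x ≤ b := by
  have : Tendsto (fun x : ℝ => a * x) (𝓝[>] 0) (𝓝 (a * 0)) :=
    (tendsto_const_nhds.mul tendsto_id).mono_left nhdsWithin_le_nhds
  rw [mul_zero] at this
  exact this.eventually_le_const hb

/-- Induction on k and, inside it, on l. Dividing by L gains 1/(δ phi), and the three sources on the
right are given the shares δ/2, δ/4 and δ/4. -/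
theorem exists_major_bound {m : ℕ} {c : ℕ × ℕ → ℂ → ℂ} (hc : ∀ p ∈ I m, AnalyticAt ℂ (c p) 0)
    {a : ℂ → ℂ} (ha : AnalyticAt ℂ a 0) {G : (Vars M → ℂ) → ℂ} (hG : AnalyticAt ℂ G 0)
    (hG₂ : OrderAtLeastTwo G) (hN : NonResonant m c) (hGP : GenPoincare m c) {u : FormalTX}
    (hu : IsFormalSolution m c a G u) :
    ∃ (D N : ℕ) (r ε : ℝ), 0 < r ∧ 0 < ε ∧ ∀ k l, 1 ≤ k →
      ‖cf u k l‖ * r ^ l * (ε ^ 2) ^ k ≤ ε * major D N (s0 m c G - 1) (sigma0 m c - 1) k l := by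
  obtain ⟨δ, hδ, hL⟩ := exists_phi_le_norm_L hN hGP
  obtain ⟨H₁, R₁, hH₁, hR₁, hlin⟩ := exists_sum_norm_taylorCoeff_le (I m) hc
  obtain ⟨Ha, Ra, hHa, hRa, haa⟩ := norm_taylorCoeff_le ha
  obtain ⟨Hg, ρ, hHg, hρ, hg⟩ := exists_sum_norm_coeff_taylorSeries_le hG
  set η : ℝ := sigma0 m c - 1 with hη'
  set τ : ℝ := s0 m c G - 1 with hτ'
  have hη : 0 ≤ η := sub_nonneg.2 one_le_sigma0
  have hτ : 0 ≤ τ := sub_nonneg.2 (one_le_s0 m c G)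
  have hση : 1 + η = sigma0 m c := add_sub_cancel _ _
  obtain ⟨D, hD1, hD⟩ := exists_nat_forall_le M fun p => (p.2 : ℝ) * (1 + η)
  obtain ⟨N, -, hNN⟩ := exists_nat_forall_le M fun p => (p.1 : ℝ) + (1 + η) * p.2 + 2
  obtain ⟨r, ⟨hr1, hrρ, hrR, hrδ, hra⟩, hr⟩ := ((((eventually_mul_le 1 one_pos).and
    ((eventually_mul_le 1 hρ).and ((eventually_mul_le R₁ (b := 1 / 2) (by norm_num)).and
    ((eventually_mul_le (H₁ * 2 * R₁) (half_pos hδ)).and (eventually_mul_le Ra one_pos))))).and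
    self_mem_nhdsWithin).exists)
  rw [one_mul] at hr1 hrρ
  replace hr : 0 < r := hr
  set δ' : ℝ := δ / (4 * Hg) with hδ'
  have hδ'0 : 0 < δ' := by positivity
  -- The growth constant contains r^(-D), so ε is chosen after r.
  obtain ⟨ε, ⟨hε1, hε2, hε3, hεa⟩, hε⟩ := ((((eventually_mul_le 1 one_pos).and
    ((eventually_mul_le (growth D N τ r) hρ).and
    ((eventually_mul_le (growth D N τ r ^ 2) (b := δ' * ρ ^ 2) (by positivity)).and
    (eventually_mul_le Ha (b := δ / 4) (by positivity))))).and
    self_mem_nhdsWithin).exists)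
  rw [one_mul] at hε1
  replace hε : 0 < ε := hε
  refine ⟨D, N, r, ε, hr, hε, fun k => ?_⟩
  obtain ⟨hu0, heq⟩ := (isFormalSolution_iff hG₂).1 hu
  induction k using Nat.strong_induction_on with
  | _ k ihk =>
    intro l
    induction l using Nat.strong_induction_on with
    | _ l ihl =>
      intro hk
      have hk1 : (1 : ℝ) ≤ k := by exact_mod_cast hk
      have hphi := phi_pos (m := m) (c := c) hk l
      have hmaj := major_nonneg D N τ η k l
      have hE : 1 ≤ D * (4 * k - 2) := Nat.mul_pos hD1 (by omega)
      set U : ℝ := phi m c k l * (ε * major D N τ η k l) with hU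
      have hU0 : 0 ≤ U := by positivity
      set w : ℝ := r ^ l * (ε ^ 2) ^ k with hw
      have hw0 : 0 < w := by positivity
      have h1 : ‖lowerPart m c k l (cf u k)‖ * w ≤ δ / 2 * U := by
        have := norm_lowerPart_le hc hH₁ hR₁ hlin hr hrR (κ := (ε ^ 2) ^ k)
          (B := ε * (((k : ℝ) ^ N)⁻¹ * (k ! : ℝ) ^ τ)) (by positivity) (by positivity) hE hk (l := l)
          (w := cf u k) (fun n hn => (ihl n hn hk).trans_eq (by rw [major]; ring))
        rw [mul_assoc, ← hw] at this
        refine this.trans ?_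
        calc _ = (H₁ * 2 * R₁ * r) * U := by rw [hU, major]; ring
          _ ≤ _ := by gcongr
      have h2 : ‖(if k = 1 then taylorCoeff a l else 0)‖ * w ≤ δ / 4 * U := by
        split_ifs with hk'
        · have hphi1 : 1 ≤ phi m c k l := (one_le_pow₀ hk1).trans (pow_le_phi k l)
          have hmaj1 := inv_pow_le_major (N := N) hτ hη hD1 hk l
          rw [hk', Nat.cast_one, one_pow, inv_one, ← hk'] at hmaj1
          have hU1 : ε ≤ U := by
            rw [hU]
            calc ε = 1 * (ε * 1) := by ring
              _ ≤ _ := by gcongr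
          have hpow : (Ra * r) ^ l ≤ 1 := pow_le_one₀ (by positivity) hra
          -- For k = 1 the weight contains ε²: one factor makes the term small, the other is at most
          -- U.
          calc ‖taylorCoeff a l‖ * w ≤ Ha * Ra ^ l * w := by gcongr; exact haa l
            _ = (Ha * ε) * ((Ra * r) ^ l) * ε := by rw [hw, hk', mul_pow]; ring
            _ ≤ (δ / 4) * 1 * U := by gcongr
            _ = _ := by ring
        · rw [norm_zero, zero_mul]
          positivity
      have h3 : ‖cf (compose G (truncT k (cf u))) k l‖ * w ≤ δ / 4 * U := by
        have := norm_cf_compose_le_major (m := m) hτ hη hr hr1 hε hε1 hD1 hδ'0.le hD hNN hG₂ hg hrρ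
          hε2 hε3 (fun i μ ν h h' h'' => by rw [hση]; exact mNu_sub_le h h' h'')
          (u := truncT k (cf u)) (fun l => by simp [cf_truncT]) (fun k' l' hk' => by
            rw [cf_truncT]
            split_ifs with hlt
            · exact ihk k' hlt.2 l' hk'
            · simpa using mul_nonneg hε.le (major_nonneg D N τ η k' l')) hk l
        rw [mul_assoc, ← hw] at this
        refine this.trans ?_
        calc Hg * (δ' * ε * ((k : ℝ) ^ m * major D N τ η k l))
            = δ / 4 * ((k : ℝ) ^ m * (ε * major D N τ η k l)) := by
              rw [hδ']; field_simp
          _ ≤ _ := by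
              rw [hU]
              have := pow_le_phi (m := m) (c := c) k l
              gcongr
      have h4 : δ * phi m c k l * ‖cf u k l‖ * w ≤ δ * U := by
        calc δ * phi m c k l * ‖cf u k l‖ * w ≤ ‖L m c k l‖ * ‖cf u k l‖ * w := by
              gcongr; exact hL k l hk
          _ = ‖lowerPart m c k l (cf u k) + ((if k = 1 then taylorCoeff a l else 0) +
                cf (compose G (truncT k (cf u))) k l)‖ * w := by rw [← norm_mul, heq k l hk]
          _ ≤ (‖lowerPart m c k l (cf u k)‖ + (‖(if k = 1 then taylorCoeff a l else 0)‖ +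
                ‖cf (compose G (truncT k (cf u))) k l‖)) * w := by
              gcongr
              exact (norm_add_le _ _).trans (add_le_add_right (norm_add_le _ _) _)
          _ ≤ _ := by linarith
      rw [mul_assoc, ← hw]
      refine le_of_mul_le_mul_left ?_ (mul_pos hδ hphi)
      calc _ = δ * phi m c k l * ‖cf u k l‖ * w := by ring
        _ ≤ _ := h4
        _ = _ := by rw [hU]; ring

/-! ### Convergence -/

theorem convergesNearZero_of_le {ι : Type} [Fintype ι] {f : MvPowerSeries ι ℂ} {H Y : ℝ}
    (hY : 0 < Y) (h : ∀ e : ι →₀ ℕ, ‖MvPowerSeries.coeff e f‖ ≤ H * Y ^ e.degree) :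
    ConvergesNearZero f := by
  have hball : Metric.ball (0 : ι → ℂ) (2 * Y)⁻¹ ∈ 𝓝 (0 : ι → ℂ) :=
    Metric.ball_mem_nhds _ (by positivity)
  filter_upwards [hball] with z hz
  rw [mem_ball_zero_iff] at hz
  refine Summable.of_norm_bounded
    ((summable_pow_degree (ι := ι) (x := 1 / 2) (by norm_num) (by norm_num)).mul_left H) fun e => ?_
  rw [norm_mul, norm_prod]
  have h1 : ∏ i, ‖z i ^ e i‖ ≤ ((2 * Y)⁻¹) ^ e.degree := by
    rw [Finsupp.degree_eq_sum, ← Finset.prod_pow_eq_pow_sum]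
    refine Finset.prod_le_prod (fun i _ => norm_nonneg _) fun i _ => ?_
    rw [norm_pow]
    exact pow_le_pow_left₀ (norm_nonneg _) ((norm_le_pi_norm z i).trans hz.le) _
  have hH : 0 ≤ H := by
    have := (norm_nonneg _).trans (h 0)
    simpa using this
  calc ‖MvPowerSeries.coeff e f‖ * ∏ i, ‖z i ^ e i‖ ≤ H * Y ^ e.degree * ((2 * Y)⁻¹) ^ e.degree :=
        mul_le_mul (h e) h1 (Finset.prod_nonneg fun i _ => norm_nonneg _) (by positivity)
    _ = H * (1 / 2) ^ e.degree := by
        rw [mul_assoc, ← mul_pow]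
        congr 2
        field_simp

theorem mem_Gevrey_of_major_bound {D N : ℕ} {s σ τ η r ε : ℝ} (hτ : 0 ≤ τ) (hη : 0 ≤ η)
    (hs : 1 + τ ≤ s) (hσ : 1 + η ≤ σ) (hr : 0 < r) (hε : 0 < ε) {u : FormalTX}
    (hu0 : ∀ l, cf u 0 l = 0)
    (hu : ∀ k l, 1 ≤ k → ‖cf u k l‖ * r ^ l * (ε ^ 2) ^ k ≤ ε * major D N τ η k l) :
    u ∈ Gevrey s σ := by
  refine ⟨by linarith, by linarith, ?_⟩
  -- The binomial weight is at most 2^(4Dk+l); Y absorbs it together with the scalings ε^(2k) and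
  -- r^l.
  set Y : ℝ := max ((2 ^ (4 * D) : ℝ) / ε ^ 2) (2 / r) with hY
  have hY0 : 0 < Y := lt_max_of_lt_right (by positivity)
  refine convergesNearZero_of_le (H := ε) hY0 fun e => ?_
  set k := e 0 with hk'
  set l := e 1 with hl'
  have hdeg : e.degree = k + l := by rw [Finsupp.degree_eq_sum, Fin.sum_univ_two]
  have hk1 : (1 : ℝ) ≤ k ! := by exact_mod_cast Nat.factorial_pos k
  have hl1 : (1 : ℝ) ≤ l ! := by exact_mod_cast Nat.factorial_pos l
  set g : ℝ := (k ! : ℝ) ^ (s - 1) * (l ! : ℝ) ^ (σ - 1) with hg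
  have hg0 : 0 < g := by positivity
  change ‖MvPowerSeries.coeff e u / ((g : ℝ) : ℂ)‖ ≤ _
  rw [coeff_eq_cf, norm_div, Complex.norm_real, Real.norm_of_nonneg hg0.le, div_le_iff₀ hg0, hdeg]
  rcases Nat.eq_zero_or_pos k with h0 | hk
  · rw [← hk', h0, hu0, norm_zero]
    positivity
  have h1 := hu k l hk
  have hw0 : 0 < r ^ l * (ε ^ 2) ^ k := by positivity
  rw [mul_assoc, ← le_div_iff₀ hw0] at h1
  refine h1.trans ?_
  rw [div_le_iff₀ hw0]
  have hkN : ((k : ℝ) ^ N)⁻¹ ≤ 1 :=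
    inv_le_one_of_one_le₀ (one_le_pow₀ (by exact_mod_cast hk))
  have ht : (k ! : ℝ) ^ τ ≤ (k ! : ℝ) ^ (s - 1) :=
    Real.rpow_le_rpow_of_exponent_le hk1 (by linarith)
  have hx : (l ! : ℝ) ^ η ≤ (l ! : ℝ) ^ (σ - 1) :=
    Real.rpow_le_rpow_of_exponent_le hl1 (by linarith)
  have hb : (Nat.multichoose (D * (4 * k - 2)) l : ℝ) ≤ (2 ^ (4 * D)) ^ k * 2 ^ l := by
    rw [← pow_mul, ← pow_add]
    have h2 : D * (4 * k - 2) + l ≤ 4 * D * k + l := by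
      have : D * (4 * k - 2) ≤ D * (4 * k) := Nat.mul_le_mul_left _ (by omega)
      nlinarith
    exact_mod_cast (multichoose_le_two_pow _ _).trans (Nat.pow_le_pow_right (by norm_num) h2)
  have hYk : (2 ^ (4 * D) : ℝ) ≤ Y * ε ^ 2 := by
    rw [← div_le_iff₀ (by positivity)]
    exact le_max_left _ _
  have hYl : (2 : ℝ) ≤ Y * r := by
    rw [← div_le_iff₀ hr]
    exact le_max_right _ _
  calc ε * major D N τ η k l
      ≤ ε * (1 * (k ! : ℝ) ^ (s - 1) * (l ! : ℝ) ^ (σ - 1) * ((2 ^ (4 * D)) ^ k * 2 ^ l)) := by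
        unfold major
        gcongr
    _ ≤ ε * (1 * (k ! : ℝ) ^ (s - 1) * (l ! : ℝ) ^ (σ - 1) * ((Y * ε ^ 2) ^ k * (Y * r) ^ l)) := by
        gcongr
    _ = _ := by rw [hg, pow_add, mul_pow, mul_pow]; ring

end TotChar

theorem theorem6p1 (m : ℕ) (hm : 1 ≤ m)
    (c : ℕ × ℕ → ℂ → ℂ) (hc : ∀ p ∈ TotChar.I m, AnalyticAt ℂ (c p) 0)
    (a : ℂ → ℂ) (ha : AnalyticAt ℂ a 0)
    (M : Finset (ℕ × ℕ)) (G : (TotChar.Vars M → ℂ) → ℂ) (hG : AnalyticAt ℂ G 0)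
    (hG₂ : TotChar.OrderAtLeastTwo G)
    (hN : TotChar.NonResonant m c) (hGP : TotChar.GenPoincare m c) :
    (∃! u : TotChar.FormalTX, TotChar.IsFormalSolution m c a G u) ∧
      ∀ u : TotChar.FormalTX, TotChar.IsFormalSolution m c a G u →
        ∀ s σ : ℝ, TotChar.s0 m c G ≤ s → TotChar.sigma0 m c ≤ σ → u ∈ TotChar.Gevrey s σ := by
  refine ⟨TotChar.existsUnique_isFormalSolution a hG₂ hN, fun u hu s σ hs hσ => ?_⟩
  obtain ⟨D, N, r, ε, hr, hε, h⟩ := TotChar.exists_major_bound hc ha hG hG₂ hN hGP hu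
  exact TotChar.mem_Gevrey_of_major_bound (sub_nonneg.2 (TotChar.one_le_s0 m c G))
    (sub_nonneg.2 TotChar.one_le_sigma0) (by linarith) (by linarith) hr hε
    ((TotChar.isFormalSolution_iff hG₂).1 hu).1 h
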